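/- Let $M=\mathring M\sqcup\partial M$ be a smooth compact Riemannian manifold of dimension $n\ge 1$ with (possibly empty) boundary $\partial M$. For $c>0$, a function $v:\mathring M\to\mathbb R$ is called $c$-semiconcave on $\mathring M$ if for every unit speed geodesic $\gamma:[a,b]\to\mathring M$ the function $t\mapsto c\,t^2-v(\gamma(t))$ is convex on $[a,b]$. Let $L>0$ and $C>0$ be constants, and suppose that we are given: (a) a function $d:\mathring M\to\mathbb R$ which is bounded and $C$-semiconcave on $\mathring M$; (b) a family of functions $u_m:\mathring M\to\mathbb R$, indexed by the real numbers $m>0$, such that for every $m>0$, with $E_m:=\{x\in\mathring M: u_m(x)<d(x)\}$, (b.1) $u_m\le d$ on $\mathring M$; (b.2) $u_m$ is $L$-Lipschitz on $\mathring M$ with respect to the Riemannian distance; (b.3) $u_m$ is $C^\infty$ on $E_m$ and $-\Delta u_m=2m$ in $E_m$, where $\Delta$ is the Laplace–Beltrami operator; (b.4) $E_m$ is precompact in $\mathring M$; (b.5) for every $\eta>0$ there is a neighborhood $\mathcal N_{\eta,m}$ of $\partial E_m$ in $\mathring M$ such that $D^2u_m\le (C+\eta)\,\mathrm{Id}$ in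 $E_m\cap\mathcal N_{\eta,m}$, where $D^2u_m$ is the second covariant derivative. Then for every $\eta>0$ there exists $m_0>0$ such that $u_m$ is $(C+\eta)$-semiconcave on $\mathring M$ for every $m\ge m_0$. -/

import Mathlib

open Set Topology Bundle
open scoped Manifold ContDiff NNReal

noncomputable section

namespace RiemannianChart

/- In this section `M` is a smooth manifold of dimension `n` with model `I` (possibly with boundary)
and a Riemannian metric, i.e. an inner product on every tangent space. All objects of Riemannian
geometry are given by their classical expressions in local coordinates; the coordinates used are
those of the chart `extChartAt I x₀` around a point `x₀`, with values in `range I ⊆ ℝⁿ`. -/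
variable {n : ℕ} {H : Type*} [TopologicalSpace H]
  (I : ModelWithCorners ℝ (EuclideanSpace ℝ (Fin n)) H)
  {M : Type*} [TopologicalSpace M] [ChartedSpace H M]

/-- The partial derivative `∂ᵢ f (y)` of a function of the coordinates (a derivative within
`range I`, hence the usual derivative at interior points of `range I`). -/
def partialDeriv (i : Fin n) (f : EuclideanSpace ℝ (Fin n) → ℝ) (y : EuclideanSpace ℝ (Fin n)) :
    ℝ :=
  fderivWithin ℝ f (range I) y (EuclideanSpace.single i 1)

/-- The coordinate vector field `∂ᵢ` of the chart around `x₀`, at the point with coordinates `y`. -/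
def coordVector (x₀ : M) (i : Fin n) (y : EuclideanSpace ℝ (Fin n)) :
    TangentSpace I ((extChartAt I x₀).symm y) :=
  mfderivWithin 𝓘(ℝ, EuclideanSpace ℝ (Fin n)) I (extChartAt I x₀).symm (range I) y
    (EuclideanSpace.single i (1 : ℝ) : EuclideanSpace ℝ (Fin n))

/-- The `k`-th component `X^k` of a tangent vector `X` at `p`, in the chart around `x₀`. -/
def coordComponent (x₀ : M) {p : M} (X : TangentSpace I p) (k : Fin n) : ℝ :=
  (fun v : EuclideanSpace ℝ (Fin n) => v k)
    (mfderiv I 𝓘(ℝ, EuclideanSpace ℝ (Fin n)) (extChartAt I x₀) p X)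

variable [RiemannianBundle (fun x : M => TangentSpace I x)]

/-- The matrix `(g_ij)` of the metric in the chart around `x₀`. -/
def metricMatrix (x₀ : M) (y : EuclideanSpace ℝ (Fin n)) : Matrix (Fin n) (Fin n) ℝ :=
  Matrix.of fun i j => inner ℝ (coordVector I x₀ i y) (coordVector I x₀ j y)

/-- The Christoffel symbols of the Levi-Civita connection in the chart around `x₀`,
`Γᵏ_ij = 1/2 ∑_l g^{kl} (∂ᵢ g_jl + ∂ⱼ g_il - ∂_l g_ij)`. -/
def christoffel (x₀ : M) (k i j : Fin n) (y : EuclideanSpace ℝ (Fin n)) : ℝ :=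
  (1 / 2) * ∑ l, (metricMatrix I x₀ y)⁻¹ k l *
    (partialDeriv I i (fun z => metricMatrix I x₀ z j l) y
      + partialDeriv I j (fun z => metricMatrix I x₀ z i l) y
      - partialDeriv I l (fun z => metricMatrix I x₀ z i j) y)

/-- The components `(D²u)_ij = ∂ᵢ∂ⱼ u - ∑_k Γᵏ_ij ∂ₖ u` of the second covariant derivative of `u`
in the chart around `x₀`. -/
def hessianMatrix (x₀ : M) (u : M → ℝ) (y : EuclideanSpace ℝ (Fin n)) :
    Matrix (Fin n) (Fin n) ℝ :=
  Matrix.of fun i j =>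
    partialDeriv I i (partialDeriv I j (u ∘ (extChartAt I x₀).symm)) y
      - ∑ k, christoffel I x₀ k i j y * partialDeriv I k (u ∘ (extChartAt I x₀).symm) y

/-- The Hessian `D²u(X, Y)` (second covariant derivative) of `u` at `p`, computed in the chart
around `p`. -/
def hessian (u : M → ℝ) (p : M) (X Y : TangentSpace I p) : ℝ :=
  ∑ i, ∑ j, hessianMatrix I p u (extChartAt I p p) i j
    * coordComponent I p X i * coordComponent I p Y j

/-- The Laplace-Beltrami operator `Δu = ∑_ij g^{ij} (D²u)_ij`, the trace of the Hessian. -/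
def laplacian (u : M → ℝ) (p : M) : ℝ :=
  ∑ i, ∑ j, (metricMatrix I p (extChartAt I p p))⁻¹ i j
    * hessianMatrix I p u (extChartAt I p p) i j

/-- `γ : [a, b] → M` is a unit speed geodesic with values in the interior of `M`: it is `C²`,
`|γ'| = 1`, and `D_{γ'} γ' = 0`, i.e. `(γᵏ)'' + ∑_ij Γᵏ_ij (γⁱ)' (γʲ)' = 0` in local coordinates
(at time `t`, in the chart around `γ t`; at the end points the derivatives are one-sided).
Values of `γ` outside `[a, b]` play no role. -/
structure IsUnitSpeedGeodesic (γ : ℝ → M) (a b : ℝ) : Prop where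
  lt : a < b
  mem_interior : ∀ t ∈ Icc a b, γ t ∈ I.interior M
  contMDiffOn : ContMDiffOn 𝓘(ℝ, ℝ) I 2 γ (Icc a b)
  unit_speed : ∀ t ∈ Icc a b,
    ‖(mfderivWithin 𝓘(ℝ, ℝ) I γ (Icc a b) t (1 : ℝ) : TangentSpace I (γ t))‖ = 1
  geodesic_eq : ∀ t ∈ Icc a b, ∀ k : Fin n,
    derivWithin (derivWithin (fun s => extChartAt I (γ t) (γ s) k) (Icc a b)) (Icc a b) t
      + ∑ i, ∑ j, christoffel I (γ t) k i j (extChartAt I (γ t) (γ t))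
          * derivWithin (fun s => extChartAt I (γ t) (γ s) i) (Icc a b) t
          * derivWithin (fun s => extChartAt I (γ t) (γ s) j) (Icc a b) t = 0

/-- `u` is `C`-semiconcave on the interior of `M`: for every unit speed geodesic
`γ : [a, b] → interior M` the function `t ↦ C t² - u (γ t)` is convex on `[a, b]`. -/
def IsSemiconcave (C : ℝ) (u : M → ℝ) : Prop :=
  ∀ (γ : ℝ → M) (a b : ℝ), IsUnitSpeedGeodesic I γ a b →
    ConvexOn ℝ (Icc a b) (fun t => C * t ^ 2 - u (γ t))

/-- `D²u ≤ c Id` at the point `p`. -/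
def HessianLE (u : M → ℝ) (c : ℝ) (p : M) : Prop :=
  ∀ X : TangentSpace I p, hessian I u p X X ≤ c * ‖X‖ ^ 2

/-- The non-contact set `{u < d}` in the interior of `M`. -/
def nonContactSet (u d : M → ℝ) : Set M :=
  {x | x ∈ I.interior M ∧ u x < d x}

end RiemannianChart

end

/-!
Along a unit speed geodesic the second derivative of `u` is `D²u (γ', γ')`, and at a contact point,
where `u = d`, the inequality `u ≤ d` transfers the semiconcavity of `d` to `u`. So `u_m` is
`(C + η)`-semiconcave as soon as `D²u_m < (C + η) g` in the non-contact set `E_m`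
(`isSemiconcave_of_hessian_lt`). This bound is assumed near `∂E_m`, and a maximum principle carries
it to the whole of `E_m` once `m` is large.

The maximum principle is applied to `D²u + ε |∇u|² g`. Suppose that its largest eigenvalue has a
local maximum at an interior point, in the unit direction `X`. In a chart, extend `X` to a field
that is parallel at this point to first order, and write the first- and second-order conditions at
the maximum. Since `Δu` is constant, the equation `Δu = const`, differentiated once and twice,
cancels all the derivatives of `u` of order three and four. What is left bounds
`2 ε |D²u|²` by terms at most linear in `D²u`, with coefficients that depend only on the metric and
on the Lipschitz constant of `u` (`LocalGeometry.bochner_inequality`). Hence `|D²u|`, and therefore `|Δu|`, is bounded by a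
constant that does not depend on `u` (`LocalGeometry.abs_laplacian_le`). If `2 m` is larger than
this constant there is no such maximum, and a compactness argument (`exists_touching`) shows that
the strict upper bound of `D²u + ε |∇u|² g` near `∂E_m` holds in all of `E_m`
(`exists_subset_belowSet`). The gradients being bounded (`exists_chartGradSq_le`), `ε |∇u|²` is
absorbed in `η` when `ε` is small.

Three facts surround this core. The constants are uniform up to the boundary of `M`, because the
metric is smooth up to the boundary in every chart and `M` is compact (`exists_localGeometry`,
`eventually_localGeometry`). The maximum principle uses the Hessian near a point in a single chart,
whereas the Hessian at each point is given in the chart around that point: the change of charts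
rests on the transformation law of the Christoffel symbols (`IsLeviCivita.map_christoffel`), which
follows from Koszul's formula. Finally, `E_m` has to be open, so `d` has to be lower semicontinuous:
a bounded semiconcave function is, because the points near `p` lie on geodesics that start at `p`
and have length bounded below (`exists_geodesic_through`, `IsSemiconcave.eventually_lt`).
-/

namespace RiemannianChart

set_option linter.unusedSectionVars false
set_option maxSynthPendingDepth 3
set_option synthInstance.maxHeartbeats 400000

/-! ### Second-order jets of functions of one real variable -/

section Jets

variable {E F G : Type*} [NormedAddCommGroup E] [NormedSpace ℝ E]
  [NormedAddCommGroup F] [NormedSpace ℝ F] [NormedAddCommGroup G] [NormedSpace ℝ G]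

/-- `f` is twice differentiable at `0` with `f 0 = f₀`, `f' 0 = f₁` and `f'' 0 = f₂`. -/
def HasJetTwo (f : ℝ → F) (f₀ f₁ f₂ : F) : Prop :=
  ∃ f' : ℝ → F, f 0 = f₀ ∧ f' 0 = f₁ ∧ (∀ᶠ t in 𝓝 (0 : ℝ), HasDerivAt f (f' t) t) ∧
    HasDerivAt f' f₂ 0

lemma HasJetTwo.clm_apply {f : ℝ → F →L[ℝ] G} {x : ℝ → F} {f₀ f₁ f₂ : F →L[ℝ] G} {x₀ x₁ x₂ : F}
    (hf : HasJetTwo f f₀ f₁ f₂) (hx : HasJetTwo x x₀ x₁ x₂) :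
    HasJetTwo (fun t => f t (x t)) (f₀ x₀) (f₁ x₀ + f₀ x₁) (f₂ x₀ + (2 : ℝ) • f₁ x₁ + f₀ x₂) := by
  obtain ⟨f', rfl, rfl, hf, hf'⟩ := hf
  obtain ⟨x', rfl, rfl, hx, hx'⟩ := hx
  refine ⟨fun t => f' t (x t) + f t (x' t), rfl, rfl, ?_, ?_⟩
  · filter_upwards [hf, hx] with t h1 h2 using h1.clm_apply h2
  · refine ((hf'.clm_apply hx.self_of_nhds).add (hf.self_of_nhds.clm_apply hx')).congr_deriv ?_
    rw [two_smul]
    abel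

lemma HasJetTwo.add {f g : ℝ → F} {f₀ f₁ f₂ g₀ g₁ g₂ : F} (hf : HasJetTwo f f₀ f₁ f₂)
    (hg : HasJetTwo g g₀ g₁ g₂) :
    HasJetTwo (fun t => f t + g t) (f₀ + g₀) (f₁ + g₁) (f₂ + g₂) := by
  obtain ⟨f', rfl, rfl, hf, hf'⟩ := hf
  obtain ⟨x', rfl, rfl, hx, hx'⟩ := hg
  refine ⟨fun t => f' t + x' t, rfl, rfl, ?_, hf'.add hx'⟩
  filter_upwards [hf, hx] with t h1 h2 using h1.add h2

lemma HasJetTwo.sub {f g : ℝ → F} {f₀ f₁ f₂ g₀ g₁ g₂ : F} (hf : HasJetTwo f f₀ f₁ f₂)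
    (hg : HasJetTwo g g₀ g₁ g₂) :
    HasJetTwo (fun t => f t - g t) (f₀ - g₀) (f₁ - g₁) (f₂ - g₂) := by
  obtain ⟨f', rfl, rfl, hf, hf'⟩ := hf
  obtain ⟨x', rfl, rfl, hx, hx'⟩ := hg
  refine ⟨fun t => f' t - x' t, rfl, rfl, ?_, hf'.sub hx'⟩
  filter_upwards [hf, hx] with t h1 h2 using h1.sub h2

lemma HasJetTwo.const (c : F) : HasJetTwo (fun _ => c) c 0 0 :=
  ⟨fun _ => 0, rfl, rfl, .of_forall fun t => hasDerivAt_const t c, hasDerivAt_const 0 0⟩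

lemma HasJetTwo.congr {f : ℝ → F} {f₀ f₁ f₂ g₀ g₁ g₂ : F} (hf : HasJetTwo f f₀ f₁ f₂)
    (h₀ : f₀ = g₀) (h₁ : f₁ = g₁) (h₂ : f₂ = g₂) : HasJetTwo f g₀ g₁ g₂ := by
  rwa [← h₀, ← h₁, ← h₂]

lemma HasJetTwo.sum {ι : Type*} {s : Finset ι} {f : ι → ℝ → F} {f₀ f₁ f₂ : ι → F}
    (hf : ∀ i ∈ s, HasJetTwo (f i) (f₀ i) (f₁ i) (f₂ i)) :
    HasJetTwo (fun t => ∑ i ∈ s, f i t) (∑ i ∈ s, f₀ i) (∑ i ∈ s, f₁ i) (∑ i ∈ s, f₂ i) := by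
  classical
  induction s using Finset.induction_on with
  | empty => simpa using HasJetTwo.const (0 : F)
  | insert a s ha ih =>
    simp only [Finset.sum_insert ha]
    exact (hf a (Finset.mem_insert_self a s)).add
      (ih fun i hi => hf i (Finset.mem_insert_of_mem hi))

lemma HasJetTwo.line (c d : F) : HasJetTwo (fun t : ℝ => c - t • d) c (-d) 0 := by
  refine ⟨fun _ => -d, by simp, rfl, .of_forall fun t => ?_, hasDerivAt_const 0 _⟩
  simpa using ((hasDerivAt_id t).smul_const d).const_sub c

lemma HasJetTwo.mul {f g : ℝ → ℝ} {f₀ f₁ f₂ g₀ g₁ g₂ : ℝ} (hf : HasJetTwo f f₀ f₁ f₂)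
    (hg : HasJetTwo g g₀ g₁ g₂) :
    HasJetTwo (fun t => f t * g t) (f₀ * g₀) (f₁ * g₀ + f₀ * g₁)
      (f₂ * g₀ + 2 * (f₁ * g₁) + f₀ * g₂) := by
  obtain ⟨f', rfl, rfl, hf, hf'⟩ := hf
  obtain ⟨x', rfl, rfl, hx, hx'⟩ := hg
  refine ⟨fun t => f' t * g t + f t * x' t, rfl, rfl, ?_, ?_⟩
  · filter_upwards [hf, hx] with t h1 h2 using h1.mul h2
  · refine ((hf'.mul hx.self_of_nhds).add (hf.self_of_nhds.mul hx')).congr_deriv ?_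
    ring

/-- The second-order jet of a `C²` function along the line `t ↦ y + t w`. -/
lemma HasJetTwo.comp_line {A : E → F} {y : E} (hA : ContDiffAt ℝ 2 A y) (w : E) :
    HasJetTwo (fun t : ℝ => A (y + t • w)) (A y) (fderiv ℝ A y w)
      (fderiv ℝ (fderiv ℝ A) y w w) := by
  have hl : ∀ t : ℝ, HasDerivAt (fun t : ℝ => y + t • w) w t := fun t => by
    simpa using ((hasDerivAt_id t).smul_const w).const_add y
  have hd : ∀ᶠ z in 𝓝 y, DifferentiableAt ℝ A z := by
    filter_upwards [hA.eventually (by simp)] with z hz using hz.differentiableAt (by simp)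
  have hc : Filter.Tendsto (fun t : ℝ => y + t • w) (𝓝 0) (𝓝 y) := by
    simpa using (hl 0).continuousAt.tendsto
  refine ⟨fun t => fderiv ℝ A (y + t • w) w, by simp, by simp, ?_, ?_⟩
  · filter_upwards [hc.eventually hd] with t ht
    exact HasFDerivAt.comp_hasDerivAt t ht.hasFDerivAt (hl t)
  · have h1 : DifferentiableAt ℝ (fderiv ℝ A) y :=
      (hA.fderiv_right (m := 1) (by norm_num)).differentiableAt (by simp)
    have h2 : HasDerivAt (fun t : ℝ => fderiv ℝ A (y + t • w)) (fderiv ℝ (fderiv ℝ A) y w) 0 :=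
      h1.hasFDerivAt.comp_hasDerivAt_of_eq (0 : ℝ) (hl 0) (by simp)
    refine (h2.clm_apply (hasDerivAt_const 0 w)).congr_deriv ?_
    rw [map_zero, add_zero]

lemma HasJetTwo.of_isLocalMax {f : ℝ → ℝ} {f₀ f₁ f₂ : ℝ} (hf : HasJetTwo f f₀ f₁ f₂)
    (hmax : IsLocalMax f 0) : f₁ = 0 ∧ f₂ ≤ 0 := by
  obtain ⟨f', rfl, rfl, hd, hd'⟩ := hf
  have h0 : f' 0 = 0 := hmax.hasDerivAt_eq_zero hd.self_of_nhds
  refine ⟨h0, ?_⟩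
  by_contra! hpos
  have he : deriv f =ᶠ[𝓝 0] f' := by
    filter_upwards [hd] with t ht using ht.deriv
  have hmin : IsLocalMin f 0 := by
    apply isLocalMin_of_deriv_deriv_pos
    · rw [he.deriv_eq, hd'.deriv]; exact hpos
    · rw [he.self_of_nhds, h0]
    · exact hd.self_of_nhds.continuousAt
  have hc : f =ᶠ[𝓝 0] fun _ => f 0 := by
    filter_upwards [hmax, hmin] with t h1 h2 using le_antisymm h1 h2
  have hc' : deriv f =ᶠ[𝓝 0] fun _ => 0 := by
    have := hc.deriv
    simpa using this
  have : f₂ = 0 := by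
    have h := (he.symm.trans hc').deriv_eq
    rw [hd'.deriv] at h
    simpa using h
  exact hpos.ne' this

lemma HasJetTwo.unique {f : ℝ → F} {f₀ f₁ f₂ g₀ g₁ g₂ : F} (hf : HasJetTwo f f₀ f₁ f₂)
    {g : ℝ → F} (hg : HasJetTwo g g₀ g₁ g₂) (h : f =ᶠ[𝓝 0] g) : f₁ = g₁ ∧ f₂ = g₂ := by
  obtain ⟨f', rfl, rfl, hf, hf'⟩ := hf
  obtain ⟨g', rfl, rfl, hg, hg'⟩ := hg
  have he : f' =ᶠ[𝓝 0] g' := by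
    filter_upwards [hf, hg, h.eventuallyEq_nhds] with t h1 h2 h3
    exact h1.unique (h2.congr_of_eventuallyEq h3)
  exact ⟨he.self_of_nhds, hf'.unique (hg'.congr_of_eventuallyEq he)⟩

end Jets

/-! ### Symmetry of the derivatives of order up to four -/

section Symmetry

variable {E F : Type*} [NormedAddCommGroup E] [NormedSpace ℝ E]
  [NormedAddCommGroup F] [NormedSpace ℝ F]

lemma hasFDerivAt_clm_apply_const {A : E → E →L[ℝ] F} {y : E} (hA : DifferentiableAt ℝ A y)
    (b : E) : HasFDerivAt (fun z => A z b) ((fderiv ℝ A y).flip b) y := by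
  simpa using hA.hasFDerivAt.clm_apply (hasFDerivAt_const b y)

/-- The derivative of a field of symmetric bilinear maps is symmetric in the arguments of the
field. -/
lemma fderiv_apply_symm {A : E → E →L[ℝ] E →L[ℝ] F} {y : E} (hA : DifferentiableAt ℝ A y)
    (hs : ∀ᶠ z in 𝓝 y, ∀ a b, A z a b = A z b a) (w a b : E) :
    fderiv ℝ A y w a b = fderiv ℝ A y w b a := by
  have key : ∀ a b, HasFDerivAt (fun z => A z a b) _ y := fun a b =>
    (hA.hasFDerivAt.clm_apply (hasFDerivAt_const a y)).clm_apply (hasFDerivAt_const b y)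
  have h := (key a b).unique ((key b a).congr_of_eventuallyEq
    (by filter_upwards [hs] with z hz using hz a b))
  simpa using DFunLike.congr_fun h w

lemma fderiv_fderiv_symm {v : E → F} {y : E} (hv : ContDiffAt ℝ 2 v y) (a b : E) :
    fderiv ℝ (fderiv ℝ v) y a b = fderiv ℝ (fderiv ℝ v) y b a :=
  (hv.isSymmSndFDerivAt (by simp)) a b

variable {v : E → ℝ} {y : E}

lemma eventually_fderiv_two_symm (hv : ContDiffAt ℝ 4 v y) :
    ∀ᶠ z in 𝓝 y, ∀ a b, fderiv ℝ (fderiv ℝ v) z a b = fderiv ℝ (fderiv ℝ v) z b a := by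
  filter_upwards [hv.eventually (by simp)] with z hz
  exact fderiv_fderiv_symm (hz.of_le (by norm_num))

lemma contDiffAt_fderiv_two {n m : WithTop ℕ∞} (hv : ContDiffAt ℝ n v y) (h : m + 2 ≤ n) :
    ContDiffAt ℝ m (fderiv ℝ (fderiv ℝ v)) y := by
  refine ContDiffAt.fderiv_right (n := m + 1) (ContDiffAt.fderiv_right hv ?_) le_rfl
  rwa [add_assoc, one_add_one_eq_two]

lemma fderiv_three_symm_right (hv : ContDiffAt ℝ 4 v y) (w a b : E) :
    fderiv ℝ (fderiv ℝ (fderiv ℝ v)) y w a b = fderiv ℝ (fderiv ℝ (fderiv ℝ v)) y w b a :=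
  fderiv_apply_symm ((contDiffAt_fderiv_two (m := 1) hv (by norm_num)).differentiableAt (by simp))
    (eventually_fderiv_two_symm hv) w a b

lemma fderiv_three_symm_left (hv : ContDiffAt ℝ 4 v y) (w a : E) :
    fderiv ℝ (fderiv ℝ (fderiv ℝ v)) y w a = fderiv ℝ (fderiv ℝ (fderiv ℝ v)) y a w :=
  fderiv_fderiv_symm (hv.fderiv_right (m := 2) (by norm_num)) w a

lemma differentiableAt_fderiv_three (hv : ContDiffAt ℝ 4 v y) :
    DifferentiableAt ℝ (fderiv ℝ (fderiv ℝ (fderiv ℝ v))) y :=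
  ((contDiffAt_fderiv_two (m := 2) hv (by norm_num)).fderiv_right (m := 1)
    (by norm_num)).differentiableAt (by simp)

/-- The two pairs of arguments of a fourth derivative can be exchanged. -/
lemma fderiv_four_swap (hv : ContDiffAt ℝ 4 v y) (a b : E) :
    fderiv ℝ (fderiv ℝ (fderiv ℝ (fderiv ℝ v))) y a a b b
      = fderiv ℝ (fderiv ℝ (fderiv ℝ (fderiv ℝ v))) y b b a a := by
  have hd := differentiableAt_fderiv_three hv
  have h12 : ∀ a b, fderiv ℝ (fderiv ℝ (fderiv ℝ (fderiv ℝ v))) y a b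
      = fderiv ℝ (fderiv ℝ (fderiv ℝ (fderiv ℝ v))) y b a := fun a b =>
    fderiv_fderiv_symm (contDiffAt_fderiv_two (m := 2) hv (by norm_num)) a b
  have h23 : ∀ a b c, fderiv ℝ (fderiv ℝ (fderiv ℝ (fderiv ℝ v))) y a b c
      = fderiv ℝ (fderiv ℝ (fderiv ℝ (fderiv ℝ v))) y a c b := fun a b c => by
    refine fderiv_apply_symm hd ?_ a b c
    filter_upwards [hv.eventually (by simp)] with z hz using fderiv_three_symm_left hz
  have h34 : ∀ a b c d, fderiv ℝ (fderiv ℝ (fderiv ℝ (fderiv ℝ v))) y a b c d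
      = fderiv ℝ (fderiv ℝ (fderiv ℝ (fderiv ℝ v))) y a b d c := fun a b c d => by
    have hb := hasFDerivAt_clm_apply_const hd b
    have h := fderiv_apply_symm hb.differentiableAt (by
      filter_upwards [hv.eventually (by simp)] with z hz using fderiv_three_symm_right hz b) a c d
    rwa [hb.fderiv] at h
  rw [h23, h12, h34, h23]

end Symmetry

/-! ### Bounds by powers of two constants -/

section Bounds

variable {F G : Type*} [NormedAddCommGroup F] [NormedSpace ℝ F]
  [NormedAddCommGroup G] [NormedSpace ℝ G]

/-- The bound `‖x‖ ≤ Kᵃ Sˢ`, with the bookkeeping of the exponents left to unification. Here `K`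
bounds the geometry and the gradient, and `S` is `1 + |D²v|`: only the power of `S` matters, and the
power of `K` is never optimized. -/
def PowBound (K S : ℝ) (s a : ℕ) (x : F) : Prop := ‖x‖ ≤ K ^ a * S ^ s

variable {K S : ℝ} {s s' a b : ℕ}

lemma PowBound.clm_apply (hK : 2 ≤ K) (hS : 1 ≤ S) {f : F →L[ℝ] G} {x : F}
    (hf : PowBound K S s a f) (hx : PowBound K S s' b x) :
    PowBound K S (s + s') (a + b) (f x) := by
  unfold PowBound at *
  calc ‖f x‖ ≤ ‖f‖ * ‖x‖ := f.le_opNorm x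
    _ ≤ (K ^ a * S ^ s) * (K ^ b * S ^ s') := by gcongr
    _ = _ := by ring

lemma PowBound.mul (hK : 2 ≤ K) (hS : 1 ≤ S) {f x : ℝ}
    (hf : PowBound K S s a f) (hx : PowBound K S s' b x) :
    PowBound K S (s + s') (a + b) (f * x) := by
  unfold PowBound at *
  rw [norm_mul]
  calc ‖f‖ * ‖x‖ ≤ (K ^ a * S ^ s) * (K ^ b * S ^ s') := by gcongr
    _ = _ := by ring

lemma PowBound.mono (hK : 2 ≤ K) (hS : 1 ≤ S) {x : F} (hx : PowBound K S s a x) (hs : s ≤ s')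
    (hab : a ≤ b) : PowBound K S s' b x := by
  unfold PowBound at *
  calc ‖x‖ ≤ K ^ a * S ^ s := hx
    _ ≤ K ^ b * S ^ s' := by gcongr; linarith

lemma PowBound.add (hK : 2 ≤ K) (hS : 1 ≤ S) {x y : F} (hx : PowBound K S s a x)
    (hy : PowBound K S s' b y) : PowBound K S (max s s') (max a b + 1) (x + y) := by
  have hx' := hx.mono hK hS (le_max_left s s') (le_max_left a b)
  have hy' := hy.mono hK hS (le_max_right s s') (le_max_right a b)
  unfold PowBound at *
  calc ‖x + y‖ ≤ ‖x‖ + ‖y‖ := norm_add_le _ _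
    _ ≤ K ^ max a b * S ^ max s s' * 2 := by linarith
    _ ≤ K ^ max a b * S ^ max s s' * K := by gcongr
    _ = _ := by ring

lemma PowBound.neg {x : F} (hx : PowBound K S s a x) : PowBound K S s a (-x) := by
  unfold PowBound at *
  rwa [norm_neg]

lemma PowBound.sub (hK : 2 ≤ K) (hS : 1 ≤ S) {x y : F} (hx : PowBound K S s a x)
    (hy : PowBound K S s' b y) : PowBound K S (max s s') (max a b + 1) (x - y) := by
  rw [sub_eq_add_neg]
  exact hx.add hK hS hy.neg

lemma PowBound.sum (hK : 2 ≤ K) (hS : 1 ≤ S) {ι : Type*} [Fintype ι] (hι : Fintype.card ι ≤ K)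
    {x : ι → F} (hx : ∀ i, PowBound K S s a (x i)) : PowBound K S s (a + 1) (∑ i, x i) := by
  unfold PowBound at *
  calc ‖∑ i, x i‖ ≤ ∑ i, ‖x i‖ := norm_sum_le _ _
    _ ≤ ∑ _i : ι, K ^ a * S ^ s := Finset.sum_le_sum fun i _ => hx i
    _ = Fintype.card ι * (K ^ a * S ^ s) := by simp
    _ ≤ K * (K ^ a * S ^ s) := by gcongr
    _ = _ := by ring

lemma PowBound.two (hK : 2 ≤ K) : PowBound K S 0 1 (2 : ℝ) := by
  simpa [PowBound] using hK

end Bounds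

/-! ### The Hessian form and its jet along a line -/

noncomputable section HessForm

variable {E : Type*} [NormedAddCommGroup E] [NormedSpace ℝ E]

/-- The bilinear form `(X, Y) ↦ α (Γ (X, Y))`. -/
def compForm : (E →L[ℝ] ℝ) →L[ℝ] (E →L[ℝ] E →L[ℝ] E) →L[ℝ] (E →L[ℝ] E →L[ℝ] ℝ) :=
  (ContinuousLinearMap.compL ℝ E (E →L[ℝ] E) (E →L[ℝ] ℝ)) ∘L (ContinuousLinearMap.compL ℝ E E ℝ)

@[simp] lemma compForm_apply (α : E →L[ℝ] ℝ) (G : E →L[ℝ] E →L[ℝ] E) (X Y : E) :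
    compForm α G X Y = α (G X Y) := rfl

lemma norm_compForm_le (α : E →L[ℝ] ℝ) (G : E →L[ℝ] E →L[ℝ] E) :
    ‖compForm α G‖ ≤ ‖α‖ * ‖G‖ := by
  refine ContinuousLinearMap.opNorm_le_bound₂ _ (by positivity) fun X Y => ?_
  calc ‖α (G X Y)‖ ≤ ‖α‖ * ‖G X Y‖ := α.le_opNorm _
    _ ≤ ‖α‖ * (‖G‖ * ‖X‖ * ‖Y‖) := by gcongr; exact G.le_opNorm₂ X Y
    _ = _ := by ring

lemma PowBound.compForm {K S : ℝ} {s s' a b : ℕ} (hK : 2 ≤ K) (hS : 1 ≤ S) {α : E →L[ℝ] ℝ}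
    {G : E →L[ℝ] E →L[ℝ] E} (hα : PowBound K S s a α) (hG : PowBound K S s' b G) :
    PowBound K S (s + s') (a + b) (compForm α G) := by
  unfold PowBound at *
  calc _ ≤ ‖α‖ * ‖G‖ := norm_compForm_le _ _
    _ ≤ (K ^ a * S ^ s) * (K ^ b * S ^ s') := by gcongr
    _ = _ := by ring

/-- The second covariant derivative of `v` for the connection with Christoffel symbols `Γ`. -/
def hessForm (Γ : E → E →L[ℝ] E →L[ℝ] E) (v : E → ℝ) (z : E) : E →L[ℝ] E →L[ℝ] ℝ :=
  fderiv ℝ (fderiv ℝ v) z - compForm (fderiv ℝ v z) (Γ z)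

/-- The trace `∑ₖ B (bₖ, Pₖ)` of the bilinear form `B` with respect to a metric, when the vector
`Pₖ` is obtained from the `k`-th element of the basis dual to `b` by raising the index. -/
def traceForm {κ : Type*} [Fintype κ] (b P : κ → E) (B : E →L[ℝ] E →L[ℝ] ℝ) : ℝ :=
  ∑ k, B (b k) (P k)

/-- The squared norm of the linear form `α`, computed with the trace of `traceForm`; it is `|∇v|²`
when `α` is the derivative of `v`. -/
def gradSqForm {κ : Type*} [Fintype κ] (b P : κ → E) (α : E →L[ℝ] ℝ) : ℝ :=
  ∑ k, α (b k) * α (P k)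

/-- A metric `g` near `y` with Levi-Civita connection `Γ` and trace given by `b` and `P`, together
with an orthonormal frame `e` at `y`, everything being bounded by `K` up to the second derivatives.
The field `fderiv_trace` says that the inverse metric is parallel, and `norm_sq_le` that the norm of
a bilinear form is controlled by its components in the frame. -/
structure LocalGeometry {ι κ : Type*} [Fintype ι] [Fintype κ] (g : E → E →L[ℝ] E →L[ℝ] ℝ)
    (Γ : E → E →L[ℝ] E →L[ℝ] E) (b : κ → E) (P : κ → E → E) (y : E) (e : ι → E)
    (K : ℝ) : Prop where
  contDiffAt_metric : ContDiffAt ℝ 2 g y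
  contDiffAt_christoffel : ContDiffAt ℝ 2 Γ y
  contDiffAt_trace : ∀ k, ContDiffAt ℝ 2 (P k) y
  christoffel_symm : ∀ᶠ z in 𝓝 y, ∀ X Y, Γ z X Y = Γ z Y X
  compat : ∀ w X Y, fderiv ℝ g y w X Y = g y (Γ y w X) Y + g y X (Γ y w Y)
  trace_eq : ∀ B, traceForm b (fun k => P k y) B = ∑ i, B (e i) (e i)
  fderiv_trace : ∀ w B, (∀ X Y, B X Y = B Y X) →
    traceForm b (fun k => fderiv ℝ (P k) y w) B = -2 * ∑ i, B (e i) (Γ y w (e i))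
  norm_sq_le : ∀ B : E →L[ℝ] E →L[ℝ] ℝ, ‖B‖ ^ 2 ≤ K * ∑ i, ∑ j, B (e i) (e j) ^ 2
  norm_le_of_unit : ∀ X, g y X X = 1 → ‖X‖ ≤ K
  two_le : 2 ≤ K
  card_le : Fintype.card ι ≤ K
  card_le' : Fintype.card κ ≤ K
  frame_le : ∀ i, ‖e i‖ ≤ K
  basis_le : ∀ k, ‖b k‖ ≤ K
  metric_le : ‖g y‖ ≤ K
  fderiv_metric_le : ‖fderiv ℝ g y‖ ≤ K
  fderiv_two_metric_le : ‖fderiv ℝ (fderiv ℝ g) y‖ ≤ K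
  christoffel_le : ‖Γ y‖ ≤ K
  fderiv_christoffel_le : ‖fderiv ℝ Γ y‖ ≤ K
  fderiv_two_christoffel_le : ‖fderiv ℝ (fderiv ℝ Γ) y‖ ≤ K
  trace_le : ∀ k, ‖P k y‖ ≤ K
  fderiv_trace_le : ∀ k, ‖fderiv ℝ (P k) y‖ ≤ K
  fderiv_two_trace_le : ∀ k, ‖fderiv ℝ (fderiv ℝ (P k)) y‖ ≤ K

section JetFormulas

variable {g : E → E →L[ℝ] E →L[ℝ] ℝ} {Γ : E → E →L[ℝ] E →L[ℝ] E}
  {y : E} {v : E → ℝ}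

/-- Jet of a path of bilinear forms, evaluated at an affine path of vectors. -/
lemma HasJetTwo.form_apply_line {A : ℝ → E →L[ℝ] E →L[ℝ] ℝ} {A₀ A₁ A₂ : E →L[ℝ] E →L[ℝ] ℝ}
    (hA : HasJetTwo A A₀ A₁ A₂) (X Y : E) :
    HasJetTwo (fun t => A t (X - t • Y) (X - t • Y)) (A₀ X X) (A₁ X X - A₀ Y X - A₀ X Y)
      (A₂ X X - 2 * A₁ Y X - 2 * A₁ X Y + 2 * A₀ Y Y) := by
  refine ((hA.clm_apply (.line X Y)).clm_apply (.line X Y)).congr rfl ?_ ?_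
  · simp only [add_apply, map_neg, neg_apply]
    ring
  · simp only [add_apply, map_neg, neg_apply,
      smul_apply, smul_eq_mul, map_zero, zero_apply]
    ring

/-- First derivative of the Hessian form in the direction `w`. -/
def hessFormDeriv (Γ : E → E →L[ℝ] E →L[ℝ] E) (v : E → ℝ) (y w : E) : E →L[ℝ] E →L[ℝ] ℝ :=
  fderiv ℝ (fderiv ℝ (fderiv ℝ v)) y w
    - (compForm (fderiv ℝ (fderiv ℝ v) y w) (Γ y) + compForm (fderiv ℝ v y) (fderiv ℝ Γ y w))

/-- Second derivative of the Hessian form in the direction `w`. -/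
def hessFormDerivTwo (Γ : E → E →L[ℝ] E →L[ℝ] E) (v : E → ℝ) (y w : E) : E →L[ℝ] E →L[ℝ] ℝ :=
  fderiv ℝ (fderiv ℝ (fderiv ℝ (fderiv ℝ v))) y w w
    - (compForm (fderiv ℝ (fderiv ℝ (fderiv ℝ v)) y w w) (Γ y)
      + (2 : ℝ) • compForm (fderiv ℝ (fderiv ℝ v) y w) (fderiv ℝ Γ y w)
      + compForm (fderiv ℝ v y) (fderiv ℝ (fderiv ℝ Γ) y w w))

lemma hasJetTwo_hessForm_apply (hv : ContDiffAt ℝ 4 v y) (hΓ : ContDiffAt ℝ 2 Γ y) (w : E)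
    {ξ ζ : ℝ → E} {ξ₀ ξ₁ ξ₂ ζ₀ ζ₁ ζ₂ : E} (hξ : HasJetTwo ξ ξ₀ ξ₁ ξ₂) (hζ : HasJetTwo ζ ζ₀ ζ₁ ζ₂) :
    HasJetTwo (fun t : ℝ => hessForm Γ v (y + t • w) (ξ t) (ζ t)) (hessForm Γ v y ξ₀ ζ₀)
      (hessFormDeriv Γ v y w ξ₀ ζ₀ + hessForm Γ v y ξ₁ ζ₀ + hessForm Γ v y ξ₀ ζ₁)
      (hessFormDerivTwo Γ v y w ξ₀ ζ₀ + 2 * hessFormDeriv Γ v y w ξ₁ ζ₀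
        + 2 * hessFormDeriv Γ v y w ξ₀ ζ₁ + 2 * hessForm Γ v y ξ₁ ζ₁
        + hessForm Γ v y ξ₂ ζ₀ + hessForm Γ v y ξ₀ ζ₂) := by
  have h2 := HasJetTwo.comp_line (contDiffAt_fderiv_two (m := 2) hv (by norm_num)) w
  have h1 := HasJetTwo.comp_line (hv.fderiv_right (m := 2) (by norm_num)) w
  have hG := HasJetTwo.comp_line hΓ w
  refine (((h2.clm_apply hξ).clm_apply hζ).sub
    (h1.clm_apply ((hG.clm_apply hξ).clm_apply hζ))).congr rfl ?_ ?_
  · simp only [hessFormDeriv, hessForm, compForm_apply, add_apply, sub_apply, map_add]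
    ring
  · simp only [hessFormDeriv, hessFormDerivTwo, hessForm, compForm_apply, add_apply, sub_apply,
      smul_apply, map_add, map_smul, smul_eq_mul]
    ring

variable {κ : Type*} [Fintype κ] {b : κ → E} {P : κ → E → E}

lemma hasJetTwo_gradSqForm (hv : ContDiffAt ℝ 4 v y) (hP : ∀ k, ContDiffAt ℝ 2 (P k) y) (w : E) :
    HasJetTwo (fun t : ℝ => gradSqForm b (fun k => P k (y + t • w)) (fderiv ℝ v (y + t • w)))
      (gradSqForm b (fun k => P k y) (fderiv ℝ v y))
      (∑ k, (fderiv ℝ (fderiv ℝ v) y w (b k) * fderiv ℝ v y (P k y)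
        + fderiv ℝ v y (b k) *
          (fderiv ℝ (fderiv ℝ v) y w (P k y) + fderiv ℝ v y (fderiv ℝ (P k) y w))))
      (∑ k, (fderiv ℝ (fderiv ℝ (fderiv ℝ v)) y w w (b k) * fderiv ℝ v y (P k y)
        + 2 * (fderiv ℝ (fderiv ℝ v) y w (b k) *
          (fderiv ℝ (fderiv ℝ v) y w (P k y) + fderiv ℝ v y (fderiv ℝ (P k) y w)))
        + fderiv ℝ v y (b k) * (fderiv ℝ (fderiv ℝ (fderiv ℝ v)) y w w (P k y)
          + 2 * fderiv ℝ (fderiv ℝ v) y w (fderiv ℝ (P k) y w)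
          + fderiv ℝ v y (fderiv ℝ (fderiv ℝ (P k)) y w w)))) := by
  have h1 := HasJetTwo.comp_line (hv.fderiv_right (m := 2) (by norm_num)) w
  refine HasJetTwo.sum fun k _ => ?_
  have hb := (h1.clm_apply (HasJetTwo.const (b k)))
  have hP := h1.clm_apply (HasJetTwo.comp_line (hP k) w)
  refine (hb.mul hP).congr rfl ?_ ?_
  · simp
  · simp

lemma hasJetTwo_traceForm_hessForm (hv : ContDiffAt ℝ 4 v y) (hΓ : ContDiffAt ℝ 2 Γ y)
    (hP : ∀ k, ContDiffAt ℝ 2 (P k) y) (w : E) :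
    HasJetTwo (fun t : ℝ => traceForm b (fun k => P k (y + t • w)) (hessForm Γ v (y + t • w)))
      (traceForm b (fun k => P k y) (hessForm Γ v y))
      (traceForm b (fun k => P k y) (hessFormDeriv Γ v y w)
        + traceForm b (fun k => fderiv ℝ (P k) y w) (hessForm Γ v y))
      (traceForm b (fun k => P k y) (hessFormDerivTwo Γ v y w)
        + 2 * traceForm b (fun k => fderiv ℝ (P k) y w) (hessFormDeriv Γ v y w)
        + traceForm b (fun k => fderiv ℝ (fderiv ℝ (P k)) y w w) (hessForm Γ v y)) := by
  simp only [traceForm, Finset.mul_sum, ← Finset.sum_add_distrib]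
  refine HasJetTwo.sum fun k _ => ?_
  refine (hasJetTwo_hessForm_apply hv hΓ w (HasJetTwo.const (b k))
    (HasJetTwo.comp_line (hP k) w)).congr rfl ?_ ?_
  · simp
  · simp

end JetFormulas

end HessForm

/-! ### The conditions at a maximum and the differentiated equation -/

noncomputable section MaxConditions

variable {E : Type*} [NormedAddCommGroup E] [NormedSpace ℝ E] {ι κ : Type*} [Fintype ι] [Fintype κ]
  {g : E → E →L[ℝ] E →L[ℝ] ℝ} {Γ : E → E →L[ℝ] E →L[ℝ] E} {b : κ → E} {P : κ → E → E} {y : E}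
  {e : ι → E} {K : ℝ} {v : E → ℝ}

/-- The terms in the derivative of the Hessian form that contain derivatives of `v` of order at most
two. -/
def hessRemainder (Γ : E → E →L[ℝ] E →L[ℝ] E) (v : E → ℝ) (y w X Y : E) : ℝ :=
  fderiv ℝ (fderiv ℝ v) y w (Γ y X Y) + fderiv ℝ v y (fderiv ℝ Γ y w X Y)

/-- The terms in the second derivative of the Hessian form that contain derivatives of `v` of order
at most two. -/
def hessRemainderTwo (Γ : E → E →L[ℝ] E →L[ℝ] E) (v : E → ℝ) (y w X Y : E) : ℝ :=
  2 * fderiv ℝ (fderiv ℝ v) y w (fderiv ℝ Γ y w X Y)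
    + fderiv ℝ v y (fderiv ℝ (fderiv ℝ Γ) y w w X Y)

lemma hessFormDeriv_apply (w X Y : E) :
    hessFormDeriv Γ v y w X Y
      = fderiv ℝ (fderiv ℝ (fderiv ℝ v)) y w X Y - hessRemainder Γ v y w X Y := by
  simp only [hessFormDeriv, hessRemainder, compForm_apply, add_apply, sub_apply]

lemma hessFormDerivTwo_apply (w X Y : E) :
    hessFormDerivTwo Γ v y w X Y
      = fderiv ℝ (fderiv ℝ (fderiv ℝ (fderiv ℝ v))) y w w X Y
        - fderiv ℝ (fderiv ℝ (fderiv ℝ v)) y w w (Γ y X Y) - hessRemainderTwo Γ v y w X Y := by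
  simp only [hessFormDerivTwo, hessRemainderTwo, compForm_apply, add_apply, sub_apply, smul_apply,
    smul_eq_mul]
  ring

/-- The first derivative of `gradSqForm` along `w`. -/
def gradSqDeriv (b : κ → E) (P : κ → E → E) (v : E → ℝ) (y w : E) : ℝ :=
  ∑ k, (fderiv ℝ (fderiv ℝ v) y w (b k) * fderiv ℝ v y (P k y)
        + fderiv ℝ v y (b k) *
          (fderiv ℝ (fderiv ℝ v) y w (P k y) + fderiv ℝ v y (fderiv ℝ (P k) y w)))

/-- The terms in the second derivative of `gradSqForm` along `w` that are at most linear in the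
second derivative of `v` and do not contain the third one. -/
def gradSqRemainder (b : κ → E) (P : κ → E → E) (v : E → ℝ) (y w : E) : ℝ :=
  ∑ k, (2 * (fderiv ℝ (fderiv ℝ v) y w (b k) * fderiv ℝ v y (fderiv ℝ (P k) y w))
    + fderiv ℝ v y (b k) * (2 * fderiv ℝ (fderiv ℝ v) y w (fderiv ℝ (P k) y w)
          + fderiv ℝ v y (fderiv ℝ (fderiv ℝ (P k)) y w w)))

/-- The second derivative of `t ↦ g (X - t Y, X - t Y)` along `w`, for `Y = Γ (w, X)`. -/
def metricDerivTwo (g : E → E →L[ℝ] E →L[ℝ] ℝ) (Γ : E → E →L[ℝ] E →L[ℝ] E) (y X w : E) : ℝ :=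
  fderiv ℝ (fderiv ℝ g) y w w X X - 2 * fderiv ℝ g y w (Γ y w X) X
    - 2 * fderiv ℝ g y w X (Γ y w X) + 2 * g y (Γ y w X) (Γ y w X)

/-- The contraction with the inverse metric is a sum over the orthonormal frame. -/
lemma LocalGeometry.sum_tensor (hG : LocalGeometry g Γ b P y e K) (α β : E →L[ℝ] ℝ) :
    ∑ k, α (b k) * β (P k y) = ∑ i, α (e i) * β (e i) := by
  have := hG.trace_eq (α.smulRight β)
  simpa [traceForm] using this

/-- The second derivative of `|∇v|²` along `w`. The sum of squares on the right-hand side is the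
good term of the Bochner inequality. -/
lemma LocalGeometry.gradSq_deriv_two (hG : LocalGeometry g Γ b P y e K) (w : E) :
    (∑ k, (fderiv ℝ (fderiv ℝ (fderiv ℝ v)) y w w (b k) * fderiv ℝ v y (P k y)
        + 2 * (fderiv ℝ (fderiv ℝ v) y w (b k) *
          (fderiv ℝ (fderiv ℝ v) y w (P k y) + fderiv ℝ v y (fderiv ℝ (P k) y w)))
        + fderiv ℝ v y (b k) * (fderiv ℝ (fderiv ℝ (fderiv ℝ v)) y w w (P k y)
          + 2 * fderiv ℝ (fderiv ℝ v) y w (fderiv ℝ (P k) y w)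
          + fderiv ℝ v y (fderiv ℝ (fderiv ℝ (P k)) y w w))))
      = 2 * ∑ i, fderiv ℝ v y (e i) * fderiv ℝ (fderiv ℝ (fderiv ℝ v)) y w w (e i)
        + 2 * ∑ i, fderiv ℝ (fderiv ℝ v) y w (e i) ^ 2 + gradSqRemainder b P v y w := by
  have h1 := hG.sum_tensor (fderiv ℝ (fderiv ℝ (fderiv ℝ v)) y w w) (fderiv ℝ v y)
  have h2 := hG.sum_tensor (fderiv ℝ v y) (fderiv ℝ (fderiv ℝ (fderiv ℝ v)) y w w)
  have h3 := hG.sum_tensor (fderiv ℝ (fderiv ℝ v) y w) (fderiv ℝ (fderiv ℝ v) y w)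
  have h4 : ∑ i, fderiv ℝ (fderiv ℝ (fderiv ℝ v)) y w w (e i) * fderiv ℝ v y (e i)
      = ∑ i, fderiv ℝ v y (e i) * fderiv ℝ (fderiv ℝ (fderiv ℝ v)) y w w (e i) :=
    Finset.sum_congr rfl fun i _ => mul_comm _ _
  have h5 : ∑ i, fderiv ℝ (fderiv ℝ v) y w (e i) * fderiv ℝ (fderiv ℝ v) y w (e i)
      = ∑ i, fderiv ℝ (fderiv ℝ v) y w (e i) ^ 2 :=
    Finset.sum_congr rfl fun i _ => (sq _).symm
  rw [h4] at h1
  rw [h5] at h3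
  rw [two_mul (∑ i, fderiv ℝ v y (e i) * _)]
  nth_rewrite 1 [← h1]
  rw [← h2, ← h3]
  simp only [gradSqRemainder, Finset.mul_sum, ← Finset.sum_add_distrib]
  refine Finset.sum_congr rfl fun k _ => ?_
  ring

/-- Symmetry of the derivative of the Hessian form. -/
lemma hessFormDeriv_symm (hv : ContDiffAt ℝ 4 v y) (hΓ : ContDiffAt ℝ 2 Γ y)
    (hs : ∀ᶠ z in 𝓝 y, ∀ X Y, Γ z X Y = Γ z Y X) (w X Y : E) :
    hessFormDeriv Γ v y w X Y = hessFormDeriv Γ v y w Y X := by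
  rw [hessFormDeriv_apply, hessFormDeriv_apply, fderiv_three_symm_right hv, hessRemainder,
    hessRemainder, hs.self_of_nhds, fderiv_apply_symm (hΓ.differentiableAt (by simp)) hs]

lemma hessForm_symm (hv : ContDiffAt ℝ 4 v y)
    (hs : ∀ X Y, Γ y X Y = Γ y Y X) (X Y : E) :
    hessForm Γ v y X Y = hessForm Γ v y Y X := by
  simp only [hessForm, sub_apply, compForm_apply, hs X Y,
    fderiv_fderiv_symm (hv.of_le (by norm_num)) X Y]

/-- First- and second-order conditions at an interior maximum, along the field that extends `X`
by being parallel at `y` to first order. -/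
lemma LocalGeometry.max_conditions (hG : LocalGeometry g Γ b P y e K) (hv : ContDiffAt ℝ 4 v y)
    {ε c : ℝ}
    (hmax : ∀ᶠ z in 𝓝 y, ∀ X, hessForm Γ v z X X
      + (ε * gradSqForm b (fun k => P k z) (fderiv ℝ v z) - c) * g z X X ≤ 0)
    {X : E} (hX : g y X X = 1)
    (htouch : hessForm Γ v y X X
      + (ε * gradSqForm b (fun k => P k y) (fderiv ℝ v y) - c) * g y X X = 0) (w : E) :
    hessFormDeriv Γ v y w X X - 2 * hessForm Γ v y (Γ y w X) X + ε * gradSqDeriv b P v y w = 0 ∧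
    hessFormDerivTwo Γ v y w X X - 4 * hessFormDeriv Γ v y w (Γ y w X) X
      + 2 * hessForm Γ v y (Γ y w X) (Γ y w X)
      + ε * (2 * ∑ i, fderiv ℝ v y (e i) * fderiv ℝ (fderiv ℝ (fderiv ℝ v)) y w w (e i)
        + 2 * ∑ i, fderiv ℝ (fderiv ℝ v) y w (e i) ^ 2 + gradSqRemainder b P v y w)
      - hessForm Γ v y X X * metricDerivTwo g Γ y X w ≤ 0 := by
  set Y := Γ y w X with hY
  -- along the line `y + t w` the direction is `X - t Γ (w, X)`, which keeps `|X|² = 1` to first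
  -- order
  have jl := HasJetTwo.line X Y
  have jT := hasJetTwo_hessForm_apply hv hG.contDiffAt_christoffel w jl jl
  have jN := hasJetTwo_gradSqForm (b := b) hv hG.contDiffAt_trace w
  rw [hG.gradSq_deriv_two] at jN
  have jg := (HasJetTwo.comp_line hG.contDiffAt_metric w).form_apply_line X Y
  have jall := jT.add ((((HasJetTwo.const ε).mul jN).sub (HasJetTwo.const c)).mul jg)
  have hg1 : fderiv ℝ g y w X X - g y Y X - g y X Y = 0 := by
    rw [hG.compat]; ring
  have hcont : Filter.Tendsto (fun t : ℝ => y + t • w) (𝓝 0) (𝓝 y) := by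
    have : Continuous fun t : ℝ => y + t • w := by fun_prop
    simpa using this.tendsto 0
  have hloc : IsLocalMax (fun t : ℝ => hessForm Γ v (y + t • w) (X - t • Y) (X - t • Y)
      + (ε * gradSqForm b (fun k => P k (y + t • w)) (fderiv ℝ v (y + t • w)) - c)
        * g (y + t • w) (X - t • Y) (X - t • Y)) 0 := by
    filter_upwards [hcont.eventually hmax] with t ht
    refine (ht _).trans_eq ?_
    simp only [zero_smul, add_zero, sub_zero, htouch]
  obtain ⟨h1, h2⟩ := jall.of_isLocalMax hloc
  have hs0 : ∀ X Y, hessForm Γ v y X Y = hessForm Γ v y Y X :=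
    hessForm_symm hv hG.christoffel_symm.self_of_nhds
  have hs1 := hessFormDeriv_symm hv hG.contDiffAt_christoffel hG.christoffel_symm w
  rw [hg1] at h1 h2
  rw [hX] at h1 h2 htouch
  -- the multiplier of `g`, hence the constant `c`, is eliminated by the equality at `y`
  have hc : ε * gradSqForm b (fun k => P k y) (fderiv ℝ v y) - c = - hessForm Γ v y X X := by
    linarith
  simp only [map_neg, neg_apply, map_zero, zero_apply, hs0 X Y, hs1 X Y] at h1 h2
  refine ⟨?_, ?_⟩
  · rw [← h1]
    simp only [gradSqDeriv]
    ring
  · refine le_trans (le_of_eq ?_) h2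
    rw [hc]
    simp only [metricDerivTwo, ← hY]
    ring

/-- The equation `tr (D²v) = const` differentiated once and twice in the direction `w`. -/
lemma LocalGeometry.equation_conditions (hG : LocalGeometry g Γ b P y e K)
    (hv : ContDiffAt ℝ 4 v y) {m : ℝ}
    (heq : ∀ᶠ z in 𝓝 y, traceForm b (fun k => P k z) (hessForm Γ v z) = m) (w : E) :
    ∑ i, hessFormDeriv Γ v y w (e i) (e i)
      + traceForm b (fun k => fderiv ℝ (P k) y w) (hessForm Γ v y) = 0 ∧
    ∑ i, hessFormDerivTwo Γ v y w (e i) (e i)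
      - 4 * ∑ i, hessFormDeriv Γ v y w (e i) (Γ y w (e i))
      + traceForm b (fun k => fderiv ℝ (fderiv ℝ (P k)) y w w) (hessForm Γ v y) = 0 := by
  have j := hasJetTwo_traceForm_hessForm (b := b) hv hG.contDiffAt_christoffel
    hG.contDiffAt_trace w
  have hcont : Filter.Tendsto (fun t : ℝ => y + t • w) (𝓝 0) (𝓝 y) := by
    have : Continuous fun t : ℝ => y + t • w := by fun_prop
    simpa using this.tendsto 0
  obtain ⟨h1, h2⟩ := j.unique (HasJetTwo.const m) (hcont.eventually heq)
  rw [hG.trace_eq] at h1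
  rw [hG.trace_eq, hG.fderiv_trace _ _
    (hessFormDeriv_symm hv hG.contDiffAt_christoffel hG.christoffel_symm w)] at h2
  exact ⟨h1, by linarith⟩

end MaxConditions

/-! ### The Bochner inequality at a maximum -/

noncomputable section Bochner

variable {E : Type*} [NormedAddCommGroup E] [NormedSpace ℝ E] {ι κ : Type*} [Fintype ι] [Fintype κ]
  {g : E → E →L[ℝ] E →L[ℝ] ℝ} {Γ : E → E →L[ℝ] E →L[ℝ] E} {b : κ → E} {P : κ → E → E} {y : E}
  {e : ι → E} {K : ℝ} {v : E → ℝ}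

/-- Everything that remains in the Bochner formula at a maximum after the derivatives of `v` of
order three and four have cancelled. -/
def bochnerRemainder (Γ : E → E →L[ℝ] E →L[ℝ] E) (g : E → E →L[ℝ] E →L[ℝ] ℝ) (b : κ → E)
    (P : κ → E → E) (v : E → ℝ) (y : E) (e : ι → E) (ε : ℝ) (X : E) : ℝ :=
  ∑ i, (hessRemainderTwo Γ v y (e i) X X
      - 4 * hessRemainder Γ v y (e i) (Γ y (e i) X) X
      - 2 * hessForm Γ v y (Γ y (e i) X) (Γ y (e i) X) - ε * gradSqRemainder b P v y (e i)
      + hessForm Γ v y X X * metricDerivTwo g Γ y X (e i))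
  + traceForm b (fun k => fderiv ℝ (fderiv ℝ (P k)) y X X) (hessForm Γ v y)
  + 4 * ∑ i, hessRemainder Γ v y X (e i) (Γ y X (e i))
  - ∑ i, hessRemainderTwo Γ v y X (e i) (e i)
  - hessRemainder Γ v y (∑ i, Γ y (e i) (e i)) X X
  - 2 * hessForm Γ v y (Γ y (∑ i, Γ y (e i) (e i)) X) X
  + ε * gradSqDeriv b P v y (∑ i, Γ y (e i) (e i))
  - traceForm b (fun k => fderiv ℝ (P k) y (Γ y X X)) (hessForm Γ v y)
  + ∑ i, hessRemainder Γ v y (Γ y X X) (e i) (e i)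
  + 2 * ε * ∑ j, fderiv ℝ v y (e j) *
    (traceForm b (fun k => fderiv ℝ (P k) y (e j)) (hessForm Γ v y)
      - ∑ i, hessRemainder Γ v y (e j) (e i) (e i))

/-- **Bochner inequality at a maximum.** When `v` has constant Laplacian and the largest value of
`D²v (X, X) / |X|² + ε |∇v|²` is attained at `y` in the direction `X`, the derivatives of `v` of
order three and four cancel and `2 ε |D²v|²` is bounded by terms linear in `D²v`. -/
lemma LocalGeometry.bochner_inequality (hG : LocalGeometry g Γ b P y e K)
    (hv : ContDiffAt ℝ 4 v y) {ε c m : ℝ}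
    (heq : ∀ᶠ z in 𝓝 y, traceForm b (fun k => P k z) (hessForm Γ v z) = m)
    (hmax : ∀ᶠ z in 𝓝 y, ∀ X, hessForm Γ v z X X
      + (ε * gradSqForm b (fun k => P k z) (fderiv ℝ v z) - c) * g z X X ≤ 0)
    {X : E} (hX : g y X X = 1)
    (htouch : hessForm Γ v y X X
      + (ε * gradSqForm b (fun k => P k y) (fderiv ℝ v y) - c) * g y X X = 0) :
    2 * ε * ∑ i, ∑ j, fderiv ℝ (fderiv ℝ v) y (e i) (e j) ^ 2
      ≤ bochnerRemainder Γ g b P v y e ε X := by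
  have hΓ := hG.christoffel_symm.self_of_nhds
  have hmaxA := fun i => (hG.max_conditions hv hmax hX htouch (e i)).2
  have hmaxB := (hG.max_conditions hv hmax hX htouch (∑ i, Γ y (e i) (e i))).1
  have heqX := (hG.equation_conditions hv heq X).2
  have heqZ := (hG.equation_conditions hv heq (Γ y X X)).1
  have heqE := fun j => (hG.equation_conditions hv heq (e j)).1
  have hsum := Finset.sum_le_sum fun i (_ : i ∈ Finset.univ) => hmaxA i
  have h12 := fun a b => fderiv_three_symm_left hv a b
  have h23 := fun a b c => fderiv_three_symm_right hv a b c
  have h4 := fun a b => fderiv_four_swap hv a b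
  simp only [hessFormDeriv_apply, hessFormDerivTwo_apply] at hsum hmaxB heqX heqZ heqE
  set L := fderiv ℝ v y
  set H := fderiv ℝ (fderiv ℝ v) y
  set D3 := fderiv ℝ (fderiv ℝ (fderiv ℝ v)) y
  set D4 := fderiv ℝ (fderiv ℝ (fderiv ℝ (fderiv ℝ v))) y
  simp only [Finset.sum_add_distrib, Finset.sum_sub_distrib, ← Finset.mul_sum,
    Finset.sum_const_zero, mul_add, mul_sub] at hsum heqX heqZ heqE
  -- the terms of order four in `hsum` are those of the equation differentiated twice along `X`
  have s1 : ∑ i, D4 (e i) (e i) X X = ∑ i, D4 X X (e i) (e i) :=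
    Finset.sum_congr rfl fun i _ => h4 _ _
  -- the terms of order three are those of the equation differentiated along `Γ (X, X)` and `eⱼ`,
  -- and of the first-order condition at the maximum along `∑ᵢ Γ (eᵢ, eᵢ)`
  have s2 : ∑ i, D3 (e i) (e i) (Γ y X X) = ∑ i, D3 (Γ y X X) (e i) (e i) :=
    Finset.sum_congr rfl fun i _ => by rw [h23, h12]
  have s3 : ∑ i, D3 (e i) (Γ y (e i) X) X = ∑ i, D3 X (e i) (Γ y X (e i)) :=
    Finset.sum_congr rfl fun i _ => by rw [h23, h12, hΓ (e i) X]
  have s5 : ∑ i, D3 X X (Γ y (e i) (e i)) = D3 (∑ i, Γ y (e i) (e i)) X X := by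
    rw [← map_sum, h23, h12]
  have s6 : ∑ i, ∑ j, L (e j) * D3 (e i) (e i) (e j)
      = - ∑ j, L (e j) * (traceForm b (fun k => fderiv ℝ (P k) y (e j)) (hessForm Γ v y)
        - ∑ i, hessRemainder Γ v y (e j) (e i) (e i)) := by
    rw [Finset.sum_comm, ← Finset.sum_neg_distrib]
    refine Finset.sum_congr rfl fun j _ => ?_
    rw [← Finset.mul_sum, ← mul_neg]
    congr 1
    have : ∑ i, D3 (e i) (e i) (e j) = ∑ i, D3 (e j) (e i) (e i) :=
      Finset.sum_congr rfl fun i _ => by rw [h23, h12]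
    linarith [heqE j]
  unfold bochnerRemainder
  simp only [Finset.sum_add_distrib, Finset.sum_sub_distrib, ← Finset.mul_sum]
  rw [s1, s2, s3, s6] at hsum
  rw [s5] at heqX
  linarith

lemma LocalGeometry.powBound_hessForm (hG : LocalGeometry g Γ b P y e K)
    (hL : ‖fderiv ℝ v y‖ ≤ K) {S : ℝ} (hS : 1 ≤ S) (hH : ‖fderiv ℝ (fderiv ℝ v) y‖ ≤ S)
    {X Y : E} {a a' : ℕ} (hX : PowBound K S 0 a X) (hY : PowBound K S 0 a' Y) :
    PowBound K S 1 (a + a' + 3) (hessForm Γ v y X Y) := by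
  have hK := hG.two_le
  have bL : PowBound K S 0 1 (fderiv ℝ v y) := by simpa [PowBound] using hL
  have bH : PowBound K S 1 0 (fderiv ℝ (fderiv ℝ v) y) := by simpa [PowBound] using hH
  have bG : PowBound K S 0 1 (Γ y) := by simpa [PowBound] using hG.christoffel_le
  simp only [hessForm, sub_apply, compForm_apply]
  exact (((bH.clm_apply hK hS hX).clm_apply hK hS hY).sub hK hS
    (bL.clm_apply hK hS ((bG.clm_apply hK hS hX).clm_apply hK hS hY))).mono hK hS
      (by omega) (by omega)

lemma LocalGeometry.powBound_hessRemainder (hG : LocalGeometry g Γ b P y e K)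
    (hL : ‖fderiv ℝ v y‖ ≤ K) {S : ℝ} (hS : 1 ≤ S) (hH : ‖fderiv ℝ (fderiv ℝ v) y‖ ≤ S)
    {w X Y : E} {d a a' : ℕ} (hw : PowBound K S 0 d w)
    (hX : PowBound K S 0 a X) (hY : PowBound K S 0 a' Y) :
    PowBound K S 1 (d + a + a' + 3) (hessRemainder Γ v y w X Y) := by
  have hK := hG.two_le
  have bL : PowBound K S 0 1 (fderiv ℝ v y) := by simpa [PowBound] using hL
  have bH : PowBound K S 1 0 (fderiv ℝ (fderiv ℝ v) y) := by simpa [PowBound] using hH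
  have bG : PowBound K S 0 1 (Γ y) := by simpa [PowBound] using hG.christoffel_le
  have bG1 : PowBound K S 0 1 (fderiv ℝ Γ y) := by
    simpa [PowBound] using hG.fderiv_christoffel_le
  exact (((bH.clm_apply hK hS hw).clm_apply hK hS
    ((bG.clm_apply hK hS hX).clm_apply hK hS hY)).add hK hS (bL.clm_apply hK hS
      (((bG1.clm_apply hK hS hw).clm_apply hK hS hX).clm_apply hK hS hY))).mono hK hS
        (by omega) (by omega)

lemma LocalGeometry.powBound_hessRemainderTwo (hG : LocalGeometry g Γ b P y e K)
    (hL : ‖fderiv ℝ v y‖ ≤ K) {S : ℝ} (hS : 1 ≤ S) (hH : ‖fderiv ℝ (fderiv ℝ v) y‖ ≤ S)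
    {w X Y : E} {d a a' : ℕ} (hw : PowBound K S 0 d w)
    (hX : PowBound K S 0 a X) (hY : PowBound K S 0 a' Y) :
    PowBound K S 1 (2 * d + a + a' + 4) (hessRemainderTwo Γ v y w X Y) := by
  have hK := hG.two_le
  have bL : PowBound K S 0 1 (fderiv ℝ v y) := by simpa [PowBound] using hL
  have bH : PowBound K S 1 0 (fderiv ℝ (fderiv ℝ v) y) := by simpa [PowBound] using hH
  have bG1 : PowBound K S 0 1 (fderiv ℝ Γ y) := by
    simpa [PowBound] using hG.fderiv_christoffel_le
  have bG2 : PowBound K S 0 1 (fderiv ℝ (fderiv ℝ Γ) y) := by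
    simpa [PowBound] using hG.fderiv_two_christoffel_le
  exact (((PowBound.two hK).mul hK hS ((bH.clm_apply hK hS hw).clm_apply hK hS
    (((bG1.clm_apply hK hS hw).clm_apply hK hS hX).clm_apply hK hS hY))).add hK hS
      (bL.clm_apply hK hS ((((bG2.clm_apply hK hS hw).clm_apply hK hS hw).clm_apply hK hS
        hX).clm_apply hK hS hY))).mono hK hS (by omega) (by omega)

lemma LocalGeometry.powBound_gradSqDeriv (hG : LocalGeometry g Γ b P y e K)
    (hL : ‖fderiv ℝ v y‖ ≤ K) {S : ℝ} (hS : 1 ≤ S) (hH : ‖fderiv ℝ (fderiv ℝ v) y‖ ≤ S)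
    {w : E} {d : ℕ} (hw : PowBound K S 0 d w) :
    PowBound K S 1 (d + 7) (gradSqDeriv b P v y w) := by
  have hK := hG.two_le
  have bL : PowBound K S 0 1 (fderiv ℝ v y) := by simpa [PowBound] using hL
  have bH : PowBound K S 1 0 (fderiv ℝ (fderiv ℝ v) y) := by simpa [PowBound] using hH
  have bb : ∀ k, PowBound K S 0 1 (b k) := fun k => by simpa [PowBound] using hG.basis_le k
  have bP : ∀ k, PowBound K S 0 1 (P k y) := fun k => by simpa [PowBound] using hG.trace_le k
  have bP1 : ∀ k, PowBound K S 0 1 (fderiv ℝ (P k) y) := fun k => by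
    simpa [PowBound] using hG.fderiv_trace_le k
  have bHw := bH.clm_apply hK hS hw
  have := PowBound.sum hK hS hG.card_le' fun k =>
    ((bHw.clm_apply hK hS (bb k)).mul hK hS (bL.clm_apply hK hS (bP k))).add hK hS
      ((bL.clm_apply hK hS (bb k)).mul hK hS ((bHw.clm_apply hK hS (bP k)).add hK hS
        (bL.clm_apply hK hS ((bP1 k).clm_apply hK hS hw))))
  exact this.mono hK hS (by omega) (by omega)

lemma LocalGeometry.powBound_gradSqRemainder (hG : LocalGeometry g Γ b P y e K)
    (hL : ‖fderiv ℝ v y‖ ≤ K) {S : ℝ} (hS : 1 ≤ S) (hH : ‖fderiv ℝ (fderiv ℝ v) y‖ ≤ S)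
    {w : E} {d : ℕ} (hw : PowBound K S 0 d w) :
    PowBound K S 1 (2 * d + 9) (gradSqRemainder b P v y w) := by
  have hK := hG.two_le
  have bL : PowBound K S 0 1 (fderiv ℝ v y) := by simpa [PowBound] using hL
  have bH : PowBound K S 1 0 (fderiv ℝ (fderiv ℝ v) y) := by simpa [PowBound] using hH
  have bb : ∀ k, PowBound K S 0 1 (b k) := fun k => by simpa [PowBound] using hG.basis_le k
  have bP1 : ∀ k, PowBound K S 0 1 (fderiv ℝ (P k) y) := fun k => by
    simpa [PowBound] using hG.fderiv_trace_le k
  have bP2 : ∀ k, PowBound K S 0 1 (fderiv ℝ (fderiv ℝ (P k)) y) := fun k => by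
    simpa [PowBound] using hG.fderiv_two_trace_le k
  have bHw := bH.clm_apply hK hS hw
  have := PowBound.sum hK hS hG.card_le' fun k =>
    ((PowBound.two hK).mul hK hS ((bHw.clm_apply hK hS (bb k)).mul hK hS (bL.clm_apply hK hS
      ((bP1 k).clm_apply hK hS hw)))).add hK hS
    ((bL.clm_apply hK hS (bb k)).mul hK hS
      (((PowBound.two hK).mul hK hS (bHw.clm_apply hK hS ((bP1 k).clm_apply hK hS hw))).add hK hS
        (bL.clm_apply hK hS (((bP2 k).clm_apply hK hS hw).clm_apply hK hS hw))))
  exact this.mono hK hS (by omega) (by omega)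

lemma LocalGeometry.powBound_metricDerivTwo (hG : LocalGeometry g Γ b P y e K)
    {S : ℝ} (hS : 1 ≤ S) {X w : E} (hX : PowBound K S 0 1 X) (hw : PowBound K S 0 1 w) :
    PowBound K S 0 15 (metricDerivTwo g Γ y X w) := by
  have hK := hG.two_le
  have bg : PowBound K S 0 1 (g y) := by simpa [PowBound] using hG.metric_le
  have bg1 : PowBound K S 0 1 (fderiv ℝ g y) := by simpa [PowBound] using hG.fderiv_metric_le
  have bg2 : PowBound K S 0 1 (fderiv ℝ (fderiv ℝ g) y) := by
    simpa [PowBound] using hG.fderiv_two_metric_le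
  have bG : PowBound K S 0 1 (Γ y) := by simpa [PowBound] using hG.christoffel_le
  have bY := (bG.clm_apply hK hS hw).clm_apply hK hS hX
  have two := PowBound.two (S := S) hK
  have h1 := (((bg2.clm_apply hK hS hw).clm_apply hK hS hw).clm_apply hK hS hX).clm_apply hK hS hX
  have h2 := two.mul hK hS (((bg1.clm_apply hK hS hw).clm_apply hK hS bY).clm_apply hK hS hX)
  have h3 := two.mul hK hS (((bg1.clm_apply hK hS hw).clm_apply hK hS hX).clm_apply hK hS bY)
  have h4 := two.mul hK hS ((bg.clm_apply hK hS bY).clm_apply hK hS bY)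
  exact (((h1.sub hK hS h2).sub hK hS h3).add hK hS h4).mono hK hS (by omega) (by omega)

lemma LocalGeometry.powBound_traceForm_hessForm (hG : LocalGeometry g Γ b P y e K)
    (hL : ‖fderiv ℝ v y‖ ≤ K) {S : ℝ} (hS : 1 ≤ S) (hH : ‖fderiv ℝ (fderiv ℝ v) y‖ ≤ S)
    {Q : κ → E} {d : ℕ} (hQ : ∀ k, PowBound K S 0 d (Q k)) :
    PowBound K S 1 (d + 5) (traceForm b Q (hessForm Γ v y)) := by
  have hK := hG.two_le
  have bb : ∀ k, PowBound K S 0 1 (b k) := fun k => by simpa [PowBound] using hG.basis_le k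
  exact (PowBound.sum hK hS hG.card_le' fun k =>
    hG.powBound_hessForm hL hS hH (bb k) (hQ k)).mono hK hS (by omega) (by omega)

/-- The remainder of the Bochner inequality is at most linear in `D²v`. -/
lemma LocalGeometry.powBound_bochnerRemainder (hG : LocalGeometry g Γ b P y e K)
    (hL : ‖fderiv ℝ v y‖ ≤ K) {S : ℝ} (hS : 1 ≤ S) (hH : ‖fderiv ℝ (fderiv ℝ v) y‖ ≤ S)
    {ε : ℝ} (hε : 0 ≤ ε) (hε1 : ε ≤ 1) {X : E} (hX : g y X X = 1) :
    PowBound K S 1 40 (bochnerRemainder Γ g b P v y e ε X) := by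
  have hK := hG.two_le
  have two := PowBound.two (S := S) hK
  have four : PowBound K S 0 2 (4 : ℝ) := by
    have : (4 : ℝ) ≤ K ^ 2 := by nlinarith
    simpa [PowBound] using this
  have bε : PowBound K S 0 0 ε := by
    simpa [PowBound, abs_of_nonneg hε] using hε1
  have bX : PowBound K S 0 1 X := by simpa [PowBound] using hG.norm_le_of_unit X hX
  have be : ∀ i, PowBound K S 0 1 (e i) := fun i => by simpa [PowBound] using hG.frame_le i
  have bL : PowBound K S 0 1 (fderiv ℝ v y) := by simpa [PowBound] using hL
  have bG : PowBound K S 0 1 (Γ y) := by simpa [PowBound] using hG.christoffel_le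
  have bGG : ∀ {X Y : E} {a a' : ℕ}, PowBound K S 0 a X → PowBound K S 0 a' Y →
      PowBound K S 0 (1 + a + a') (Γ y X Y) := fun hX hY =>
    (bG.clm_apply hK hS hX).clm_apply hK hS hY
  have bP1 : ∀ k, PowBound K S 0 1 (fderiv ℝ (P k) y) := fun k => by
    simpa [PowBound] using hG.fderiv_trace_le k
  have bP2 : ∀ k, PowBound K S 0 1 (fderiv ℝ (fderiv ℝ (P k)) y) := fun k => by
    simpa [PowBound] using hG.fderiv_two_trace_le k
  have bB : PowBound K S 0 4 (∑ i, Γ y (e i) (e i)) :=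
    PowBound.sum hK hS hG.card_le fun i => bGG (be i) (be i)
  have t1 := PowBound.sum hK hS hG.card_le fun i =>
    (((((hG.powBound_hessRemainderTwo hL hS hH (be i) bX bX).sub hK hS
      (four.mul hK hS (hG.powBound_hessRemainder hL hS hH (be i) (bGG (be i) bX) bX))).sub hK hS
      (two.mul hK hS (hG.powBound_hessForm hL hS hH (bGG (be i) bX) (bGG (be i) bX)))).sub hK hS
      (bε.mul hK hS (hG.powBound_gradSqRemainder hL hS hH (be i)))).add hK hS
      ((hG.powBound_hessForm hL hS hH bX bX).mul hK hS
        (hG.powBound_metricDerivTwo hS bX (be i))))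
  have t2 := hG.powBound_traceForm_hessForm hL hS hH fun k =>
    ((bP2 k).clm_apply hK hS bX).clm_apply hK hS bX
  have t3 := four.mul hK hS (PowBound.sum hK hS hG.card_le fun i =>
    hG.powBound_hessRemainder hL hS hH bX (be i) (bGG bX (be i)))
  have t4 := PowBound.sum hK hS hG.card_le fun i =>
    hG.powBound_hessRemainderTwo hL hS hH bX (be i) (be i)
  have t5 := hG.powBound_hessRemainder hL hS hH bB bX bX
  have t6 := two.mul hK hS (hG.powBound_hessForm hL hS hH (bGG bB bX) bX)
  have t7 := bε.mul hK hS (hG.powBound_gradSqDeriv hL hS hH bB)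
  have t8 := hG.powBound_traceForm_hessForm hL hS hH fun k =>
    (bP1 k).clm_apply hK hS (bGG bX bX)
  have t9 := PowBound.sum hK hS hG.card_le fun i =>
    hG.powBound_hessRemainder hL hS hH (bGG bX bX) (be i) (be i)
  have t10 := (two.mul hK hS bε).mul hK hS (PowBound.sum hK hS hG.card_le fun j =>
    (bL.clm_apply hK hS (be j)).mul hK hS
      ((hG.powBound_traceForm_hessForm hL hS hH fun k => (bP1 k).clm_apply hK hS (be j)).sub hK hS
        (PowBound.sum hK hS hG.card_le fun i =>
          hG.powBound_hessRemainder hL hS hH (be j) (be i) (be i))))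
  exact (((((((((t1.add hK hS t2).add hK hS t3).sub hK hS t4).sub hK hS t5).sub hK hS t6).add
    hK hS t7).sub hK hS t8).add hK hS t9).add hK hS t10).mono hK hS (by simp) (by simp)

/-- At a maximum of `D²v (X, X) / |X|² + ε |∇v|²`, the constant value of the Laplacian is bounded in
terms of `ε` and of the geometry. -/
theorem LocalGeometry.abs_laplacian_le (hG : LocalGeometry g Γ b P y e K)
    (hv : ContDiffAt ℝ 4 v y) (hL : ‖fderiv ℝ v y‖ ≤ K) {ε c m : ℝ} (hε : 0 < ε) (hε1 : ε ≤ 1)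
    (heq : ∀ᶠ z in 𝓝 y, traceForm b (fun k => P k z) (hessForm Γ v z) = m)
    (hmax : ∀ᶠ z in 𝓝 y, ∀ X, hessForm Γ v z X X
      + (ε * gradSqForm b (fun k => P k z) (fderiv ℝ v z) - c) * g z X X ≤ 0)
    {X : E} (hX : g y X X = 1)
    (htouch : hessForm Γ v y X X
      + (ε * gradSqForm b (fun k => P k y) (fderiv ℝ v y) - c) * g y X X = 0) :
    |m| ≤ K ^ 6 * (2 + K ^ 41 / ε) := by
  have hK := hG.two_le
  set h := ‖fderiv ℝ (fderiv ℝ v) y‖ with hh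
  have h0 : 0 ≤ h := norm_nonneg _
  have hS : 1 ≤ 1 + h := by linarith
  have hH : ‖fderiv ℝ (fderiv ℝ v) y‖ ≤ 1 + h := by linarith
  have h1 := hG.bochner_inequality hv heq hmax hX htouch
  have h2 := hG.powBound_bochnerRemainder hL hS hH hε.le hε1 hX
  have h3 := hG.norm_sq_le (fderiv ℝ (fderiv ℝ v) y)
  have h4 : 2 * ε * ∑ i, ∑ j, fderiv ℝ (fderiv ℝ v) y (e i) (e j) ^ 2 ≤ K ^ 40 * (1 + h) := by
    refine h1.trans ((le_abs_self _).trans ?_)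
    simpa [PowBound] using h2
  -- a quadratic inequality for `h = |D²v|`
  have h5 : 2 * h ^ 2 ≤ K ^ 41 / ε * (1 + h) := by
    rw [div_mul_eq_mul_div, le_div_iff₀ hε]
    calc 2 * h ^ 2 * ε = 2 * ε * h ^ 2 := by ring
      _ ≤ 2 * ε * (K * ∑ i, ∑ j, fderiv ℝ (fderiv ℝ v) y (e i) (e j) ^ 2) := by gcongr
      _ = K * (2 * ε * ∑ i, ∑ j, fderiv ℝ (fderiv ℝ v) y (e i) (e j) ^ 2) := by ring
      _ ≤ K * (K ^ 40 * (1 + h)) := by gcongr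
      _ = _ := by ring
  have h6 : 1 + h ≤ 2 + K ^ 41 / ε := by
    have : (1 + h) * (1 + h) ≤ (2 + K ^ 41 / ε) * (1 + h) := by nlinarith [sq_nonneg (1 - h)]
    exact le_of_mul_le_mul_right this (by linarith)
  -- the Laplacian is a trace of the Hessian
  have h7 : PowBound K (1 + h) 1 6 m := by
    rw [← heq.self_of_nhds]
    exact hG.powBound_traceForm_hessForm hL hS hH (d := 1) fun k => by
      simpa [PowBound] using hG.trace_le k
  calc |m| ≤ K ^ 6 * (1 + h) := by simpa [PowBound] using h7
    _ ≤ _ := by gcongr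

end Bochner

/-! ### Christoffel symbols and Hessians under a change of coordinates -/

section ChangeOfCoordinates

variable {E : Type*} [NormedAddCommGroup E] [NormedSpace ℝ E]

/-- Koszul's formula: `G` is the value at `y` of the Christoffel symbols of the metric `g`. -/
def IsLeviCivita (g : E → E →L[ℝ] E →L[ℝ] ℝ) (G : E →L[ℝ] E →L[ℝ] E) (y : E) : Prop :=
  ∀ X Y Z, 2 * g y (G X Y) Z = fderiv ℝ g y X Y Z + fderiv ℝ g y Y X Z - fderiv ℝ g y Z X Y

variable {g g' : E → E →L[ℝ] E →L[ℝ] ℝ} {G G' : E →L[ℝ] E →L[ℝ] E} {τ : E → E} {y : E}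

/-- The compatibility of the Levi-Civita connection with the metric. -/
lemma IsLeviCivita.compat (hG : IsLeviCivita g G y) (hd : DifferentiableAt ℝ g y)
    (hs : ∀ᶠ z in 𝓝 y, ∀ X Y, g z X Y = g z Y X) (w X Y : E) :
    fderiv ℝ g y w X Y = g y (G w X) Y + g y X (G w Y) := by
  have h1 := hG w X Y
  have h2 := hG w Y X
  have hs' := fderiv_apply_symm hd hs
  rw [hs.self_of_nhds X (G w Y)]
  rw [hs' w Y X, hs' Y w X] at h2
  rw [hs' X w Y] at h1
  linarith [hs' X Y w, hs' Y X w]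

/-- The derivative of the pullback `g` of the metric `g'` by `τ`. -/
lemma fderiv_pullback_metric (hg' : DifferentiableAt ℝ g' (τ y)) (hτ : ContDiffAt ℝ 2 τ y)
    (hg : DifferentiableAt ℝ g y)
    (hpull : ∀ᶠ z in 𝓝 y, ∀ X Y, g z X Y = g' (τ z) (fderiv ℝ τ z X) (fderiv ℝ τ z Y))
    (w X Y : E) :
    fderiv ℝ g y w X Y
      = fderiv ℝ g' (τ y) (fderiv ℝ τ y w) (fderiv ℝ τ y X) (fderiv ℝ τ y Y)
        + g' (τ y) (fderiv ℝ (fderiv ℝ τ) y w X) (fderiv ℝ τ y Y)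
        + g' (τ y) (fderiv ℝ τ y X) (fderiv ℝ (fderiv ℝ τ) y w Y) := by
  have hl : HasDerivAt (fun t : ℝ => y + t • w) w 0 := by
    simpa using ((hasDerivAt_id (0 : ℝ)).smul_const w).const_add y
  have h0 : y + (0 : ℝ) • w = y := by simp
  have hcont : Filter.Tendsto (fun t : ℝ => y + t • w) (𝓝 0) (𝓝 y) := by
    simpa using hl.continuousAt.tendsto
  have hτ1 : HasDerivAt (fun t : ℝ => τ (y + t • w)) (fderiv ℝ τ y w) 0 :=
    (hτ.differentiableAt (by simp)).hasFDerivAt.comp_hasDerivAt_of_eq (0 : ℝ) hl h0.symm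
  have hτ2 : HasDerivAt (fun t : ℝ => fderiv ℝ τ (y + t • w)) (fderiv ℝ (fderiv ℝ τ) y w) 0 :=
    ((hτ.fderiv_right (m := 1) (by norm_num)).differentiableAt
      (by simp)).hasFDerivAt.comp_hasDerivAt_of_eq (0 : ℝ) hl h0.symm
  have hA : HasDerivAt (fun t : ℝ => g' (τ (y + t • w)))
      (fderiv ℝ g' (τ y) (fderiv ℝ τ y w)) 0 :=
    hg'.hasFDerivAt.comp_hasDerivAt_of_eq (0 : ℝ) hτ1 (by simp)
  have hB : HasDerivAt (fun t : ℝ => g (y + t • w)) (fderiv ℝ g y w) 0 :=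
    hg.hasFDerivAt.comp_hasDerivAt_of_eq (0 : ℝ) hl h0.symm
  have hX := hτ2.clm_apply (hasDerivAt_const (0 : ℝ) X)
  have hY := hτ2.clm_apply (hasDerivAt_const (0 : ℝ) Y)
  have h1 := (hB.clm_apply (hasDerivAt_const (0 : ℝ) X)).clm_apply (hasDerivAt_const (0 : ℝ) Y)
  have h2 := (hA.clm_apply hX).clm_apply hY
  have := h1.unique (h2.congr_of_eventuallyEq (by
    filter_upwards [hcont.eventually hpull] with t ht using ht X Y))
  simpa using this

/-- **Transformation law of the Christoffel symbols.** -/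
lemma IsLeviCivita.map_christoffel (hG : IsLeviCivita g G y) (hG' : IsLeviCivita g' G' (τ y))
    (hg' : DifferentiableAt ℝ g' (τ y)) (hτ : ContDiffAt ℝ 2 τ y) (hg : DifferentiableAt ℝ g y)
    (hpull : ∀ᶠ z in 𝓝 y, ∀ X Y, g z X Y = g' (τ z) (fderiv ℝ τ z X) (fderiv ℝ τ z Y))
    (hs : ∀ X Y, g' (τ y) X Y = g' (τ y) Y X) (hpos : ∀ X, g' (τ y) X X = 0 → X = 0)
    (hsurj : Function.Surjective (fderiv ℝ τ y)) (X Y : E) :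
    fderiv ℝ τ y (G X Y)
      = fderiv ℝ (fderiv ℝ τ) y X Y + G' (fderiv ℝ τ y X) (fderiv ℝ τ y Y) := by
  rw [← sub_eq_zero]
  apply hpos
  -- the difference of the two sides is tested against itself, which is the image of some `Z`
  obtain ⟨Z, hZ⟩ := hsurj (fderiv ℝ τ y (G X Y)
    - (fderiv ℝ (fderiv ℝ τ) y X Y + G' (fderiv ℝ τ y X) (fderiv ℝ τ y Y)))
  nth_rewrite 2 [← hZ]
  have h1 := hG X Y Z
  have h2 := hG' (fderiv ℝ τ y X) (fderiv ℝ τ y Y) (fderiv ℝ τ y Z)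
  have hp := fderiv_pullback_metric hg' hτ hg hpull
  have hsym := fderiv_fderiv_symm hτ
  rw [hp X Y Z, hp Y X Z, hp Z X Y, hpull.self_of_nhds] at h1
  rw [hsym Y X, hsym Z X, hsym Z Y, hs (fderiv ℝ (fderiv ℝ τ) y X Z) (fderiv ℝ τ y Y)] at h1
  simp only [map_sub, map_add, sub_apply, add_apply]
  linarith

/-- The Hessian and the derivative of a function are tensors: if the connections are related by `τ`,
then `v' ∘ τ` has the pullbacks of those of `v'`. -/
lemma hessForm_comp {Γ Γ' : E → E →L[ℝ] E →L[ℝ] E} {v v' : E → ℝ} (hv' : ContDiffAt ℝ 2 v' (τ y))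
    (hτ : ContDiffAt ℝ 2 τ y) (hv : v =ᶠ[𝓝 y] v' ∘ τ)
    (hΓ : ∀ X Y, fderiv ℝ τ y (Γ y X Y)
      = fderiv ℝ (fderiv ℝ τ) y X Y + Γ' (τ y) (fderiv ℝ τ y X) (fderiv ℝ τ y Y)) (X Y : E) :
    hessForm Γ v y X Y = hessForm Γ' v' (τ y) (fderiv ℝ τ y X) (fderiv ℝ τ y Y) ∧
      fderiv ℝ v y X = fderiv ℝ v' (τ y) (fderiv ℝ τ y X) := by
  have hτd : ∀ᶠ z in 𝓝 y, DifferentiableAt ℝ τ z := by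
    filter_upwards [hτ.eventually (by simp)] with z hz using hz.differentiableAt (by simp)
  have hvd : ∀ᶠ z in 𝓝 (τ y), DifferentiableAt ℝ v' z := by
    filter_upwards [hv'.eventually (by simp)] with z hz using hz.differentiableAt (by simp)
  have h1 : ∀ᶠ z in 𝓝 y, ∀ Y, fderiv ℝ v z Y = fderiv ℝ v' (τ z) (fderiv ℝ τ z Y) := by
    filter_upwards [hτd, hτ.continuousAt.eventually hvd, hv.eventuallyEq_nhds] with z h2 h3 h4 Y
    rw [h4.fderiv_eq, fderiv_comp z h3 h2]
    rfl
  refine ⟨?_, h1.self_of_nhds X⟩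
  have hD : DifferentiableAt ℝ (fderiv ℝ v) y :=
    (((hv'.comp y hτ).congr_of_eventuallyEq hv).fderiv_right (m := 1)
      (by norm_num)).differentiableAt (by simp)
  have hτ2 : DifferentiableAt ℝ (fderiv ℝ τ) y :=
    (hτ.fderiv_right (m := 1) (by norm_num)).differentiableAt (by simp)
  have hv2 : DifferentiableAt ℝ (fderiv ℝ v') (τ y) :=
    (hv'.fderiv_right (m := 1) (by norm_num)).differentiableAt (by simp)
  have e1 := hD.hasFDerivAt.clm_apply (hasFDerivAt_const Y y)
  have e2 := (hv2.hasFDerivAt.comp y hτd.self_of_nhds.hasFDerivAt).clm_apply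
    (hτ2.hasFDerivAt.clm_apply (hasFDerivAt_const Y y))
  have e3 := e1.unique (e2.congr_of_eventuallyEq (by
    filter_upwards [h1] with z hz using hz Y))
  have e4 : fderiv ℝ (fderiv ℝ v) y X Y
      = fderiv ℝ (fderiv ℝ v') (τ y) (fderiv ℝ τ y X) (fderiv ℝ τ y Y)
        + fderiv ℝ v' (τ y) (fderiv ℝ (fderiv ℝ τ) y X Y) := by
    have := DFunLike.congr_fun e3 X
    simpa [add_comm] using this
  simp only [hessForm, sub_apply, compForm_apply, h1.self_of_nhds, hΓ, e4, map_add]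
  ring

end ChangeOfCoordinates

/-! ### Smoothness and local bounds in a chart -/

section MatrixSmooth

variable {E : Type*} [NormedAddCommGroup E] [NormedSpace ℝ E] {n : ℕ} {s : Set E}
  {A : E → Matrix (Fin n) (Fin n) ℝ}

lemma contDiffOn_det (hA : ∀ i j, ContDiffOn ℝ ∞ (fun z => A z i j) s) :
    ContDiffOn ℝ ∞ (fun z => (A z).det) s := by
  simp only [Matrix.det_apply]
  refine ContDiffOn.sum fun σ _ => ContDiffOn.const_smul _ ?_
  exact contDiffOn_prod fun i _ => hA _ _

lemma contDiffOn_inv (hA : ∀ i j, ContDiffOn ℝ ∞ (fun z => A z i j) s)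
    (hd : ∀ z ∈ s, (A z).det ≠ 0) (i j : Fin n) :
    ContDiffOn ℝ ∞ (fun z => (A z)⁻¹ i j) s := by
  have h1 : ContDiffOn ℝ ∞ (fun z => (A z).adjugate i j) s := by
    simp only [Matrix.adjugate_apply]
    refine contDiffOn_det fun k l => ?_
    by_cases hk : k = j
    · subst hk
      simpa using contDiffOn_const
    · simpa [Matrix.updateRow_ne hk] using hA k l
  have h2 : ∀ z, (A z)⁻¹ i j = ((A z).det)⁻¹ * (A z).adjugate i j := fun z => by
    rw [Matrix.inv_def, Matrix.smul_apply, Ring.inverse_eq_inv', smul_eq_mul]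
  simp only [h2]
  exact ((contDiffOn_det hA).inv hd).mul h1

end MatrixSmooth

section LocalBounds

variable {E F : Type*} [NormedAddCommGroup E] [NormedSpace ℝ E]
  [NormedAddCommGroup F] [NormedSpace ℝ F]

/-- A smooth function on a set is locally bounded, up to the points of the set that are not
interior, together with its derivatives of order at most two. -/
lemma exists_bound_of_contDiffOn {f : E → F} {s : Set E} (hs : UniqueDiffOn ℝ s)
    (hf : ContDiffOn ℝ ∞ f s) {y : E} (hy : y ∈ s) :
    ∃ K : ℝ, ∀ᶠ z in 𝓝[s] y, z ∈ interior s →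
      ‖f z‖ ≤ K ∧ ‖fderiv ℝ f z‖ ≤ K ∧ ‖fderiv ℝ (fderiv ℝ f) z‖ ≤ K := by
  have h1 : ContDiffOn ℝ ∞ (fderivWithin ℝ f s) s := hf.fderivWithin hs (by simp)
  have h2 : ContDiffOn ℝ ∞ (fderivWithin ℝ (fderivWithin ℝ f s) s) s :=
    h1.fderivWithin hs (by simp)
  have b0 := (hf.continuousOn y hy).norm.eventually (Iic_mem_nhds (lt_add_one ‖f y‖))
  have b1 := (h1.continuousOn y hy).norm.eventually (Iic_mem_nhds (lt_add_one _))
  have b2 := (h2.continuousOn y hy).norm.eventually (Iic_mem_nhds (lt_add_one _))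
  refine ⟨max (‖f y‖ + 1) (max (‖fderivWithin ℝ f s y‖ + 1)
    (‖fderivWithin ℝ (fderivWithin ℝ f s) s y‖ + 1)), ?_⟩
  filter_upwards [b0, b1, b2] with z c0 c1 c2 hz
  have e1 : ∀ z ∈ interior s, fderivWithin ℝ f s z = fderiv ℝ f z := fun z hz =>
    fderivWithin_of_mem_nhds (mem_interior_iff_mem_nhds.1 hz)
  have e2 : fderivWithin ℝ (fderivWithin ℝ f s) s z = fderiv ℝ (fderiv ℝ f) z := by
    rw [fderivWithin_of_mem_nhds (mem_interior_iff_mem_nhds.1 hz)]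
    exact Filter.EventuallyEq.fderiv_eq
      (by filter_upwards [isOpen_interior.mem_nhds hz] with w hw using e1 w hw)
  rw [e1 z hz] at c1
  rw [e2] at c2
  exact ⟨c0.trans (le_max_left _ _), c1.trans ((le_max_left _ _).trans (le_max_right _ _)),
    c2.trans ((le_max_right _ _).trans (le_max_right _ _))⟩

end LocalBounds

noncomputable section Charts

variable {n : ℕ} {H : Type*} [TopologicalSpace H]
  (I : ModelWithCorners ℝ (EuclideanSpace ℝ (Fin n)) H)
  {M : Type*} [TopologicalSpace M] [ChartedSpace H M] [IsManifold I ∞ M]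

/-- The derivative of the inverse of the chart around `x₀`, within `range I` so that it makes sense
at the boundary; its columns are the vectors `coordVector`. -/
def chartSymmDeriv (x₀ : M) (y : EuclideanSpace ℝ (Fin n)) :
    EuclideanSpace ℝ (Fin n) →L[ℝ] TangentSpace I ((extChartAt I x₀).symm y) :=
  mfderivWithin 𝓘(ℝ, EuclideanSpace ℝ (Fin n)) I (extChartAt I x₀).symm (range I) y

lemma uniqueDiffOn_target (x₀ : M) : UniqueDiffOn ℝ (extChartAt I x₀).target :=
  uniqueDiffOn_extChartAt_target x₀

lemma contMDiffOn_coordVector (x₀ : M) (i : Fin n) :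
    ContMDiffOn 𝓘(ℝ, EuclideanSpace ℝ (Fin n)) I.tangent ∞
      (fun y => (⟨(extChartAt I x₀).symm y, coordVector I x₀ i y⟩ : TangentBundle I M))
      (extChartAt I x₀).target := by
  have h1 : ContMDiffOn 𝓘(ℝ, EuclideanSpace ℝ (Fin n)) I ∞ (extChartAt I x₀).symm
      (extChartAt I x₀).target := contMDiffOn_extChartAt_symm x₀
  have h2 := h1.contMDiffOn_tangentMapWithin (m := ∞) (by simp)
    (uniqueDiffOn_target I x₀).uniqueMDiffOn
  have h3 : ContMDiff 𝓘(ℝ, EuclideanSpace ℝ (Fin n))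
      (𝓘(ℝ, EuclideanSpace ℝ (Fin n))).tangent ∞
      (fun y => (⟨y, EuclideanSpace.single i (1 : ℝ)⟩ :
        TangentBundle 𝓘(ℝ, EuclideanSpace ℝ (Fin n)) (EuclideanSpace ℝ (Fin n)))) := by
    intro y
    rw [contMDiffAt_totalSpace]
    refine ⟨contMDiffAt_id, ?_⟩
    simpa using contMDiffAt_const
  have h4 := h2.comp h3.contMDiffOn (s := (extChartAt I x₀).target) (fun y hy => hy)
  refine h4.congr fun y hy => ?_
  simp only [Function.comp, tangentMapWithin, coordVector]
  congr 2
  rw [mfderivWithin_congr_set (nhdsWithin_eq_iff_eventuallyEq.1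
    (nhdsWithin_extChartAt_target_eq_of_mem hy).symm)]

variable [RiemannianBundle (fun x : M => TangentSpace I x)]
  [IsContMDiffRiemannianBundle I ∞ (EuclideanSpace ℝ (Fin n)) (fun x : M => TangentSpace I x)]

lemma contDiffOn_metricMatrix (x₀ : M) (i j : Fin n) :
    ContDiffOn ℝ ∞ (fun y => metricMatrix I x₀ y i j) (extChartAt I x₀).target := by
  rw [← contMDiffOn_iff_contDiffOn]
  exact (contMDiffOn_coordVector I x₀ i).inner_bundle (contMDiffOn_coordVector I x₀ j)

end Charts

/-! ### The metric and the Christoffel symbols of a chart -/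

noncomputable section Forms

variable {n : ℕ}

lemma sum_coord_smul_single (X : EuclideanSpace ℝ (Fin n)) :
    ∑ i, X i • EuclideanSpace.single i (1 : ℝ) = X := by
  have := (EuclideanSpace.basisFun (Fin n) ℝ).sum_repr X
  simpa using this

/-- The bilinear form with matrix `A`. -/
def matrixForm (A : Matrix (Fin n) (Fin n) ℝ) :
    EuclideanSpace ℝ (Fin n) →L[ℝ] EuclideanSpace ℝ (Fin n) →L[ℝ] ℝ :=
  ∑ i, ∑ j, A i j • (EuclideanSpace.proj i : EuclideanSpace ℝ (Fin n) →L[ℝ] ℝ).smulRight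
    (EuclideanSpace.proj j : EuclideanSpace ℝ (Fin n) →L[ℝ] ℝ)

lemma matrixForm_apply (A : Matrix (Fin n) (Fin n) ℝ) (X Y : EuclideanSpace ℝ (Fin n)) :
    matrixForm A X Y = ∑ i, ∑ j, A i j * (X i * Y j) := by
  simp [matrixForm]

lemma matrixForm_single (A : Matrix (Fin n) (Fin n) ℝ) (i j : Fin n) :
    matrixForm A (EuclideanSpace.single i 1) (EuclideanSpace.single j 1) = A i j := by
  simp [matrixForm_apply]

/-- A bilinear map with values in the space, given by its components. -/
def matrixMap (A : Fin n → Matrix (Fin n) (Fin n) ℝ) :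
    EuclideanSpace ℝ (Fin n) →L[ℝ] EuclideanSpace ℝ (Fin n) →L[ℝ] EuclideanSpace ℝ (Fin n) :=
  ∑ k, ∑ i, ∑ j, A k i j • (EuclideanSpace.proj i : EuclideanSpace ℝ (Fin n) →L[ℝ] ℝ).smulRight
    ((EuclideanSpace.proj j : EuclideanSpace ℝ (Fin n) →L[ℝ] ℝ).smulRight
      (EuclideanSpace.single k (1 : ℝ)))

lemma matrixMap_apply (A : Fin n → Matrix (Fin n) (Fin n) ℝ) (X Y : EuclideanSpace ℝ (Fin n)) :
    matrixMap A X Y = ∑ k, matrixForm (A k) X Y • EuclideanSpace.single k (1 : ℝ) := by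
  simp only [matrixMap, matrixForm_apply, Finset.sum_smul]
  simp [sum_apply, smul_smul, mul_assoc]

lemma matrixMap_apply_coord (A : Fin n → Matrix (Fin n) (Fin n) ℝ)
    (X Y : EuclideanSpace ℝ (Fin n)) (k : Fin n) :
    matrixMap A X Y k = matrixForm (A k) X Y := by
  rw [matrixMap_apply]
  simp [Finset.sum_apply, Pi.single_apply]

variable {s : Set (EuclideanSpace ℝ (Fin n))}

lemma contDiffOn_matrixForm {A : EuclideanSpace ℝ (Fin n) → Matrix (Fin n) (Fin n) ℝ}
    (hA : ∀ i j, ContDiffOn ℝ ∞ (fun z => A z i j) s) :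
    ContDiffOn ℝ ∞ (fun z => matrixForm (A z)) s :=
  ContDiffOn.sum fun i _ => ContDiffOn.sum fun j _ => (hA i j).smul contDiffOn_const

lemma contDiffOn_matrixMap {A : EuclideanSpace ℝ (Fin n) → Fin n → Matrix (Fin n) (Fin n) ℝ}
    (hA : ∀ k i j, ContDiffOn ℝ ∞ (fun z => A z k i j) s) :
    ContDiffOn ℝ ∞ (fun z => matrixMap (A z)) s :=
  ContDiffOn.sum fun k _ => ContDiffOn.sum fun i _ => ContDiffOn.sum fun j _ =>
    (hA k i j).smul contDiffOn_const

lemma bilin_ext {B B' : EuclideanSpace ℝ (Fin n) →L[ℝ] EuclideanSpace ℝ (Fin n) →L[ℝ] ℝ}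
    (h : ∀ i j, B (EuclideanSpace.single i 1) (EuclideanSpace.single j 1)
      = B' (EuclideanSpace.single i 1) (EuclideanSpace.single j 1)) : B = B' := by
  ext X Y
  rw [← sum_coord_smul_single X, ← sum_coord_smul_single Y]
  simp [map_sum, sum_apply, h]

lemma bilin_apply_eq_sum (B : EuclideanSpace ℝ (Fin n) →L[ℝ] EuclideanSpace ℝ (Fin n) →L[ℝ] ℝ)
    (X Y : EuclideanSpace ℝ (Fin n)) :
    B X Y = ∑ i, ∑ j, B (EuclideanSpace.single i 1) (EuclideanSpace.single j 1) * (X i * Y j) := by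
  have : B = matrixForm (Matrix.of fun i j =>
      B (EuclideanSpace.single i 1) (EuclideanSpace.single j 1)) :=
    bilin_ext fun i j => by rw [matrixForm_single]; rfl
  conv_lhs => rw [this]
  rw [matrixForm_apply]
  rfl

end Forms

noncomputable section Charts

variable {n : ℕ} {H : Type*} [TopologicalSpace H]
  (I : ModelWithCorners ℝ (EuclideanSpace ℝ (Fin n)) H)
  {M : Type*} [TopologicalSpace M] [ChartedSpace H M]
  [RiemannianBundle (fun x : M => TangentSpace I x)]

/-- The metric in the chart around `x₀`, as a field of bilinear forms. -/
def chartMetric (x₀ : M) (y : EuclideanSpace ℝ (Fin n)) :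
    EuclideanSpace ℝ (Fin n) →L[ℝ] EuclideanSpace ℝ (Fin n) →L[ℝ] ℝ :=
  matrixForm (metricMatrix I x₀ y)

/-- The Christoffel symbols in the chart around `x₀`, as a field of bilinear maps. -/
def chartChristoffel (x₀ : M) (y : EuclideanSpace ℝ (Fin n)) :
    EuclideanSpace ℝ (Fin n) →L[ℝ] EuclideanSpace ℝ (Fin n) →L[ℝ] EuclideanSpace ℝ (Fin n) :=
  matrixMap fun k => Matrix.of fun i j => christoffel I x₀ k i j y

/-- The vector obtained from the coordinate form `dx^k` by raising its index. -/
def chartTraceVec (x₀ : M) (k : Fin n) (y : EuclideanSpace ℝ (Fin n)) :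
    EuclideanSpace ℝ (Fin n) :=
  ∑ j, (metricMatrix I x₀ y)⁻¹ k j • EuclideanSpace.single j (1 : ℝ)

lemma chartMetric_apply (x₀ : M) (y X Y : EuclideanSpace ℝ (Fin n)) :
    chartMetric I x₀ y X Y = inner ℝ (chartSymmDeriv I x₀ y X) (chartSymmDeriv I x₀ y Y) := by
  have hm : ∀ i j, metricMatrix I x₀ y i j
      = inner ℝ (chartSymmDeriv I x₀ y (EuclideanSpace.single i 1))
        (chartSymmDeriv I x₀ y (EuclideanSpace.single j 1)) := fun _ _ => rfl
  rw [chartMetric, matrixForm_apply]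
  conv_rhs => rw [← sum_coord_smul_single X, ← sum_coord_smul_single Y]
  simp only [map_sum, map_smul, sum_inner, inner_sum, real_inner_smul_left, real_inner_smul_right,
    hm]
  rw [Finset.sum_comm]
  refine Finset.sum_congr rfl fun i _ => Finset.sum_congr rfl fun j _ => by ring

lemma chartMetric_symm (x₀ : M) (y X Y : EuclideanSpace ℝ (Fin n)) :
    chartMetric I x₀ y X Y = chartMetric I x₀ y Y X := by
  rw [chartMetric_apply, chartMetric_apply, real_inner_comm]

variable [IsManifold I ∞ M]

lemma chartSymmDeriv_injective {x₀ : M} {y : EuclideanSpace ℝ (Fin n)}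
    (hy : y ∈ (extChartAt I x₀).target) : Function.Injective (chartSymmDeriv I x₀ y) :=
  (isInvertible_mfderivWithin_extChartAt_symm hy).injective

lemma chartMetric_pos {x₀ : M} {y : EuclideanSpace ℝ (Fin n)}
    (hy : y ∈ (extChartAt I x₀).target) {X : EuclideanSpace ℝ (Fin n)} (hX : X ≠ 0) :
    0 < chartMetric I x₀ y X X := by
  rw [chartMetric_apply, real_inner_self_eq_norm_sq]
  have : chartSymmDeriv I x₀ y X ≠ 0 := fun h =>
    hX (chartSymmDeriv_injective I hy (by rw [h, map_zero]))
  positivity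

lemma metricMatrix_det_ne_zero {x₀ : M} {y : EuclideanSpace ℝ (Fin n)}
    (hy : y ∈ (extChartAt I x₀).target) : (metricMatrix I x₀ y).det ≠ 0 := by
  intro h
  obtain ⟨w, hw, hw0⟩ := Matrix.exists_mulVec_eq_zero_iff.2 h
  have hne : (WithLp.toLp 2 w : EuclideanSpace ℝ (Fin n)) ≠ 0 := by
    intro h0
    exact hw (by simpa using congrArg WithLp.ofLp h0)
  have := chartMetric_pos I hy hne
  rw [chartMetric, matrixForm_apply] at this
  have h2 : ∑ i, w i * (metricMatrix I x₀ y).mulVec w i = 0 := by simp [hw0]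
  simp only [Matrix.mulVec, dotProduct, Finset.mul_sum] at h2
  refine this.ne' (Eq.trans ?_ h2)
  exact Finset.sum_congr rfl fun i _ => Finset.sum_congr rfl fun j _ => by
    simp only []; ring

lemma metricMatrix_symm (x₀ : M) (y : EuclideanSpace ℝ (Fin n)) (i j : Fin n) :
    metricMatrix I x₀ y i j = metricMatrix I x₀ y j i :=
  real_inner_comm (coordVector I x₀ j y) (coordVector I x₀ i y)

variable [IsContMDiffRiemannianBundle I ∞ (EuclideanSpace ℝ (Fin n))
  (fun x : M => TangentSpace I x)]

lemma contDiffOn_chartMetric (x₀ : M) :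
    ContDiffOn ℝ ∞ (chartMetric I x₀) (extChartAt I x₀).target :=
  contDiffOn_matrixForm (contDiffOn_metricMatrix I x₀)

lemma contDiffOn_chartTraceVec (x₀ : M) (k : Fin n) :
    ContDiffOn ℝ ∞ (chartTraceVec I x₀ k) (extChartAt I x₀).target :=
  ContDiffOn.sum fun j _ => (contDiffOn_inv (contDiffOn_metricMatrix I x₀)
    (fun _ hz => metricMatrix_det_ne_zero I hz) k j).smul contDiffOn_const

lemma contDiffOn_partialDeriv (x₀ : M) {f : EuclideanSpace ℝ (Fin n) → ℝ}
    (hf : ContDiffOn ℝ ∞ f (extChartAt I x₀).target) (i : Fin n) :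
    ContDiffOn ℝ ∞ (partialDeriv I i f) (extChartAt I x₀).target := by
  have h := (hf.fderivWithin (m := ∞) (uniqueDiffOn_target I x₀) (by simp)).clm_apply
    (contDiffOn_const (c := (EuclideanSpace.single i (1 : ℝ) : EuclideanSpace ℝ (Fin n))))
  refine h.congr fun y hy => ?_
  rw [partialDeriv, fderivWithin_congr_set (nhdsWithin_eq_iff_eventuallyEq.1
    (nhdsWithin_extChartAt_target_eq_of_mem hy).symm)]

lemma contDiffOn_chartChristoffel (x₀ : M) :
    ContDiffOn ℝ ∞ (chartChristoffel I x₀) (extChartAt I x₀).target := by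
  refine contDiffOn_matrixMap fun k i j => ?_
  simp only [Matrix.of_apply, christoffel]
  refine contDiffOn_const.mul (ContDiffOn.sum fun l _ => ?_)
  have hd := fun a b c => contDiffOn_partialDeriv I x₀ (contDiffOn_metricMatrix I x₀ a b) c
  exact (contDiffOn_inv (contDiffOn_metricMatrix I x₀)
    (fun _ hz => metricMatrix_det_ne_zero I hz) k l).mul
    (((hd _ _ _).add (hd _ _ _)).sub (hd _ _ _))

end Charts

/-! ### Positive definiteness and Koszul's formula -/

section PosDef

variable {E : Type*} [NormedAddCommGroup E] [NormedSpace ℝ E] [FiniteDimensional ℝ E]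

lemma exists_pos_mul_sq_le (B : E →L[ℝ] E →L[ℝ] ℝ) (hB : ∀ X, X ≠ 0 → 0 < B X X) :
    ∃ δ > 0, ∀ X, δ * ‖X‖ ^ 2 ≤ B X X := by
  have hc : IsCompact (Metric.sphere (0 : E) 1) := isCompact_sphere 0 1
  have hcont : Continuous fun X : E => B X X := by fun_prop
  have hne0 : ∀ X ∈ Metric.sphere (0 : E) 1, X ≠ 0 := by
    rintro X hX rfl
    simp at hX
  obtain ⟨δ, hδ, h⟩ : ∃ δ > 0, ∀ X ∈ Metric.sphere (0 : E) 1, δ ≤ B X X := by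
    rcases (Metric.sphere (0 : E) 1).eq_empty_or_nonempty with he | hne
    · exact ⟨1, one_pos, by simp [he]⟩
    · obtain ⟨X, hX, hmin⟩ := hc.exists_isMinOn hne hcont.continuousOn
      exact ⟨B X X, hB X (hne0 X hX), fun Y hY => hmin hY⟩
  refine ⟨δ, hδ, fun X => ?_⟩
  rcases eq_or_ne X 0 with rfl | hX
  · simp
  · have hn : ‖X‖ ≠ 0 := norm_ne_zero_iff.2 hX
    have := h (‖X‖⁻¹ • X) (by simp [norm_smul, hn])
    simp only [map_smul, smul_apply, smul_eq_mul] at this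
    calc δ * ‖X‖ ^ 2 ≤ (‖X‖⁻¹ * (‖X‖⁻¹ * B X X)) * ‖X‖ ^ 2 := by gcongr
      _ = B X X := by field_simp

lemma sq_le_of_norm_sub_le {B B' : E →L[ℝ] E →L[ℝ] ℝ} {δ : ℝ} (hB : ∀ X, δ * ‖X‖ ^ 2 ≤ B X X)
    (h : ‖B' - B‖ ≤ δ / 2) (X : E) : δ / 2 * ‖X‖ ^ 2 ≤ B' X X := by
  have h1 : |(B' - B) X X| ≤ ‖B' - B‖ * ‖X‖ * ‖X‖ := (B' - B).le_opNorm₂ X X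
  have h2 : (B' - B) X X = B' X X - B X X := rfl
  have h3 : ‖B' - B‖ * ‖X‖ * ‖X‖ ≤ δ / 2 * ‖X‖ * ‖X‖ := by gcongr
  have := hB X
  rw [h2] at h1
  nlinarith [abs_le.1 h1]

/-- Positive definiteness of a bilinear form is an open condition. -/
lemma eventually_posDef {α : Type*} {l : Filter α} {B : α → E →L[ℝ] E →L[ℝ] ℝ}
    {B₀ : E →L[ℝ] E →L[ℝ] ℝ} (hB : Filter.Tendsto B l (𝓝 B₀)) (h : ∀ X, X ≠ 0 → 0 < B₀ X X) :
    ∃ δ > 0, ∀ᶠ a in l, ∀ X, δ * ‖X‖ ^ 2 ≤ B a X X := by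
  obtain ⟨δ, hδ, hδ'⟩ := exists_pos_mul_sq_le B₀ h
  refine ⟨δ / 2, by positivity, ?_⟩
  filter_upwards [hB.eventually (Metric.closedBall_mem_nhds B₀ (half_pos hδ))] with a ha X
  exact sq_le_of_norm_sub_le hδ' (by simpa [dist_eq_norm] using ha) X

end PosDef

noncomputable section Charts

variable {n : ℕ} {H : Type*} [TopologicalSpace H]
  (I : ModelWithCorners ℝ (EuclideanSpace ℝ (Fin n)) H)
  {M : Type*} [TopologicalSpace M] [ChartedSpace H M]
  [RiemannianBundle (fun x : M => TangentSpace I x)] [IsManifold I ∞ M]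

lemma interior_target_subset_interior_range (x₀ : M) :
    interior (extChartAt I x₀).target ⊆ interior (range I) :=
  interior_mono (extChartAt_target_subset_range x₀)

lemma partialDeriv_of_mem_interior {y : EuclideanSpace ℝ (Fin n)} (hy : y ∈ interior (range I))
    (i : Fin n) (f : EuclideanSpace ℝ (Fin n) → ℝ) :
    partialDeriv I i f y = fderiv ℝ f y (EuclideanSpace.single i 1) := by
  rw [partialDeriv, fderivWithin_of_mem_nhds (mem_interior_iff_mem_nhds.1 hy)]

/-- Raising the index: the vector `chartTraceVec` represents the coordinate form `dx^k`. -/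
lemma chartTraceVec_spec {x₀ : M} {y : EuclideanSpace ℝ (Fin n)}
    (hy : y ∈ (extChartAt I x₀).target) (k : Fin n) (Y : EuclideanSpace ℝ (Fin n)) :
    chartMetric I x₀ y (chartTraceVec I x₀ k y) Y = Y k := by
  have hdet : IsUnit (metricMatrix I x₀ y).det := (metricMatrix_det_ne_zero I hy).isUnit
  have h := Matrix.nonsing_inv_mul _ hdet
  simp only [chartTraceVec, map_sum, map_smul, sum_apply, smul_apply, smul_eq_mul]
  conv_lhs => rw [← sum_coord_smul_single Y]
  simp only [map_sum, map_smul, smul_eq_mul, chartMetric, matrixForm_single, Finset.mul_sum]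
  rw [Finset.sum_comm]
  have h' : ∀ l, ∑ j, (metricMatrix I x₀ y)⁻¹ k j * metricMatrix I x₀ y j l
      = (1 : Matrix (Fin n) (Fin n) ℝ) k l := fun l => by rw [← h, Matrix.mul_apply]
  calc _ = ∑ l, Y l * ∑ j, (metricMatrix I x₀ y)⁻¹ k j * metricMatrix I x₀ y j l := by
        refine Finset.sum_congr rfl fun l _ => ?_
        rw [Finset.mul_sum]
        exact Finset.sum_congr rfl fun j _ => by ring
    _ = Y k := by simp [h', Matrix.one_apply]

variable [IsContMDiffRiemannianBundle I ∞ (EuclideanSpace ℝ (Fin n))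
  (fun x : M => TangentSpace I x)]

lemma contDiffAt_chartMetric {x₀ : M} {y : EuclideanSpace ℝ (Fin n)}
    (hy : y ∈ interior (extChartAt I x₀).target) : ContDiffAt ℝ ∞ (chartMetric I x₀) y :=
  (contDiffOn_chartMetric I x₀).contDiffAt (mem_interior_iff_mem_nhds.1 hy)

lemma contDiffAt_chartChristoffel {x₀ : M} {y : EuclideanSpace ℝ (Fin n)}
    (hy : y ∈ interior (extChartAt I x₀).target) : ContDiffAt ℝ ∞ (chartChristoffel I x₀) y :=
  (contDiffOn_chartChristoffel I x₀).contDiffAt (mem_interior_iff_mem_nhds.1 hy)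

lemma contDiffAt_chartTraceVec {x₀ : M} {y : EuclideanSpace ℝ (Fin n)}
    (hy : y ∈ interior (extChartAt I x₀).target) (k : Fin n) :
    ContDiffAt ℝ ∞ (chartTraceVec I x₀ k) y :=
  (contDiffOn_chartTraceVec I x₀ k).contDiffAt (mem_interior_iff_mem_nhds.1 hy)

lemma partialDeriv_metricMatrix {x₀ : M} {y : EuclideanSpace ℝ (Fin n)}
    (hy : y ∈ interior (extChartAt I x₀).target) (l i j : Fin n) :
    partialDeriv I l (fun z => metricMatrix I x₀ z i j) y
      = fderiv ℝ (chartMetric I x₀) y (EuclideanSpace.single l 1) (EuclideanSpace.single i 1)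
        (EuclideanSpace.single j 1) := by
  rw [partialDeriv_of_mem_interior I (interior_target_subset_interior_range I x₀ hy)]
  have hd : DifferentiableAt ℝ (chartMetric I x₀) y :=
    (contDiffAt_chartMetric I hy).differentiableAt (by simp)
  have h := (hasFDerivAt_clm_apply_const (hasFDerivAt_clm_apply_const hd
    (EuclideanSpace.single i (1 : ℝ))).differentiableAt (EuclideanSpace.single j (1 : ℝ))).fderiv
  rw [(hasFDerivAt_clm_apply_const hd (EuclideanSpace.single i (1 : ℝ))).fderiv] at h
  have e : (fun z => metricMatrix I x₀ z i j) = fun z =>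
      chartMetric I x₀ z (EuclideanSpace.single i 1) (EuclideanSpace.single j 1) := by
    funext z
    rw [chartMetric, matrixForm_single]
  rw [e, h]
  rfl

/-- The Christoffel symbols of a chart satisfy Koszul's formula. -/
lemma isLeviCivita_chartChristoffel {x₀ : M} {y : EuclideanSpace ℝ (Fin n)}
    (hy : y ∈ interior (extChartAt I x₀).target) :
    IsLeviCivita (chartMetric I x₀) (chartChristoffel I x₀ y) y := by
  set A := fderiv ℝ (chartMetric I x₀) y with hA
  set g := chartMetric I x₀ y with hg
  set G := chartChristoffel I x₀ y with hG
  have key : ∀ i j c : Fin n, 2 * g (G (EuclideanSpace.single i 1) (EuclideanSpace.single j 1))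
      (EuclideanSpace.single c 1) =
      A (EuclideanSpace.single i 1) (EuclideanSpace.single j 1) (EuclideanSpace.single c 1)
      + A (EuclideanSpace.single j 1) (EuclideanSpace.single i 1) (EuclideanSpace.single c 1)
      - A (EuclideanSpace.single c 1) (EuclideanSpace.single i 1) (EuclideanSpace.single j 1) := by
    intro i j c
    have hGv : G (EuclideanSpace.single i 1) (EuclideanSpace.single j 1)
        = (1 / 2 : ℝ) • ∑ l, (A (EuclideanSpace.single i 1) (EuclideanSpace.single j 1)
            (EuclideanSpace.single l 1)
          + A (EuclideanSpace.single j 1) (EuclideanSpace.single i 1) (EuclideanSpace.single l 1)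
          - A (EuclideanSpace.single l 1) (EuclideanSpace.single i 1) (EuclideanSpace.single j 1))
          • chartTraceVec I x₀ l y := by
      rw [hG, chartChristoffel, matrixMap_apply]
      simp only [matrixForm_single, Matrix.of_apply, christoffel, partialDeriv_metricMatrix I hy,
        chartTraceVec, ← hA, Finset.smul_sum, Finset.mul_sum, Finset.sum_smul, smul_smul]
      rw [Finset.sum_comm]
      refine Finset.sum_congr rfl fun l _ => Finset.sum_congr rfl fun k _ => ?_
      congr 1
      have hs : (metricMatrix I x₀ y)⁻¹ k l = (metricMatrix I x₀ y)⁻¹ l k := by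
        have hT : (metricMatrix I x₀ y).transpose = metricMatrix I x₀ y := by
          ext a b
          exact metricMatrix_symm I x₀ y b a
        calc _ = (metricMatrix I x₀ y)⁻¹.transpose l k := rfl
          _ = _ := by rw [Matrix.transpose_nonsing_inv, hT]
      rw [hs]
      ring
    rw [hGv]
    simp only [map_smul, map_sum, smul_apply, sum_apply, smul_eq_mul, hg,
      chartTraceVec_spec I (interior_subset hy)]
    simp
  have ext0 : ∀ f : EuclideanSpace ℝ (Fin n) →L[ℝ] ℝ,
      (∀ i, f (EuclideanSpace.single i 1) = 0) → ∀ X, f X = 0 := by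
    intro f hf X
    rw [← sum_coord_smul_single X]
    simp [map_sum, hf]
  intro X Y Z
  have h1 : ∀ i j Z, 2 * g (G (EuclideanSpace.single i 1) (EuclideanSpace.single j 1)) Z =
      A (EuclideanSpace.single i 1) (EuclideanSpace.single j 1) Z
      + A (EuclideanSpace.single j 1) (EuclideanSpace.single i 1) Z
      - A Z (EuclideanSpace.single i 1) (EuclideanSpace.single j 1) := fun i j Z => by
    have := ext0 ((2 : ℝ) • g (G (EuclideanSpace.single i 1) (EuclideanSpace.single j 1))
      - (A (EuclideanSpace.single i 1) (EuclideanSpace.single j 1)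
      + A (EuclideanSpace.single j 1) (EuclideanSpace.single i 1)
      - (A.flip (EuclideanSpace.single i 1)).flip (EuclideanSpace.single j 1)))
      (fun c => sub_eq_zero.2 (key i j c)) Z
    exact sub_eq_zero.1 this
  have h2 : ∀ i Y Z, 2 * g (G (EuclideanSpace.single i 1) Y) Z =
      A (EuclideanSpace.single i 1) Y Z + A Y (EuclideanSpace.single i 1) Z
      - A Z (EuclideanSpace.single i 1) Y := fun i Y Z => by
    have := ext0 ((2 : ℝ) • (g.flip Z).comp (G (EuclideanSpace.single i 1))
      - ((A (EuclideanSpace.single i 1)).flip Z + (A.flip (EuclideanSpace.single i 1)).flip Z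
      - A Z (EuclideanSpace.single i 1)))
      (fun c => sub_eq_zero.2 (h1 i c Z)) Y
    exact sub_eq_zero.1 this
  have := ext0 ((2 : ℝ) • (g.flip Z).comp (G.flip Y)
      - ((A.flip Y).flip Z + (A Y).flip Z - (A Z).flip Y))
      (fun c => sub_eq_zero.2 (h2 c Y Z)) X
  exact sub_eq_zero.1 this

/-- The symmetry is read off from Koszul's formula by non-degeneracy of the metric. -/
lemma christoffel_symm {x₀ : M} {y : EuclideanSpace ℝ (Fin n)}
    (hy : y ∈ interior (extChartAt I x₀).target) (X Y : EuclideanSpace ℝ (Fin n)) :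
    chartChristoffel I x₀ y X Y = chartChristoffel I x₀ y Y X := by
  rw [← sub_eq_zero]
  by_contra hne
  have hpos := chartMetric_pos I (interior_subset hy) hne
  have hL := isLeviCivita_chartChristoffel I hy
  set W := chartChristoffel I x₀ y X Y - chartChristoffel I x₀ y Y X with hW
  have h1 := hL X Y W
  have h2 := hL Y X W
  have hs := fderiv_apply_symm ((contDiffAt_chartMetric I hy).differentiableAt (by simp))
    (.of_forall fun z => chartMetric_symm I x₀ z) W X Y
  have h3 : chartMetric I x₀ y W W = chartMetric I x₀ y (chartChristoffel I x₀ y X Y) W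
      - chartMetric I x₀ y (chartChristoffel I x₀ y Y X) W := by
    have e : chartMetric I x₀ y W = chartMetric I x₀ y (chartChristoffel I x₀ y X Y)
        - chartMetric I x₀ y (chartChristoffel I x₀ y Y X) := by rw [hW, map_sub]
    exact DFunLike.congr_fun e W
  linarith

end Charts

/-! ### Orthonormal frames and bounded geometry -/

section Frames

variable {E : Type*} [NormedAddCommGroup E] [NormedSpace ℝ E] {ι : Type*} [Fintype ι]

/-- The family `e` is made of unit vectors for `g` and satisfies the expansion formula of an
orthonormal basis. -/
def IsFrame (g : E →L[ℝ] E →L[ℝ] ℝ) (e : ι → E) : Prop :=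
  (∀ a, g (e a) (e a) = 1) ∧ ∀ X, X = ∑ a, g X (e a) • e a

/-- The norm of a bilinear form is controlled by its components in an orthonormal frame. -/
lemma IsFrame.norm_sq_le {g : E →L[ℝ] E →L[ℝ] ℝ} {e : ι → E} (he : IsFrame g e) {k : ℝ}
    (hk : 1 ≤ k) (hg : ‖g‖ ≤ k) (hek : ∀ a, ‖e a‖ ≤ k) (hc : Fintype.card ι ≤ k)
    (B : E →L[ℝ] E →L[ℝ] ℝ) : ‖B‖ ^ 2 ≤ k ^ 10 * ∑ a, ∑ b, B (e a) (e b) ^ 2 := by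
  have hk0 : 0 ≤ k := by linarith
  have hcoef : ∀ X a, |g X (e a)| ≤ k ^ 2 * ‖X‖ := fun X a => by
    calc |g X (e a)| ≤ ‖g‖ * ‖X‖ * ‖e a‖ := g.le_opNorm₂ X (e a)
      _ ≤ k * ‖X‖ * k := by gcongr; exact hek a
      _ = _ := by ring
  have h1 : ‖B‖ ≤ k ^ 4 * ∑ a, ∑ b, |B (e a) (e b)| := by
    refine ContinuousLinearMap.opNorm_le_bound₂ _ (by positivity) fun X Y => ?_
    have hBX : B X Y = ∑ a, ∑ b, g X (e a) * (g Y (e b) * B (e a) (e b)) := by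
      conv_lhs => rw [he.2 X, he.2 Y]
      simp only [map_sum, map_smul, sum_apply, smul_apply, smul_eq_mul, Finset.mul_sum]
      rw [Finset.sum_comm]
      exact Finset.sum_congr rfl fun a _ => Finset.sum_congr rfl fun b _ => by ring
    rw [hBX, Real.norm_eq_abs, Finset.mul_sum, Finset.sum_mul, Finset.sum_mul]
    refine (Finset.abs_sum_le_sum_abs _ _).trans (Finset.sum_le_sum fun a _ => ?_)
    rw [Finset.mul_sum, Finset.sum_mul, Finset.sum_mul]
    refine (Finset.abs_sum_le_sum_abs _ _).trans (Finset.sum_le_sum fun b _ => ?_)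
    rw [abs_mul, abs_mul]
    calc _ ≤ (k ^ 2 * ‖X‖) * ((k ^ 2 * ‖Y‖) * |B (e a) (e b)|) := by
          gcongr
          exacts [hcoef X a, hcoef Y b]
      _ = _ := by ring
  have h2 : (∑ a, ∑ b, |B (e a) (e b)|) ^ 2 ≤ k ^ 2 * ∑ a, ∑ b, B (e a) (e b) ^ 2 := by
    calc (∑ a, ∑ b, |B (e a) (e b)|) ^ 2
        ≤ Fintype.card ι * ∑ a, (∑ b, |B (e a) (e b)|) ^ 2 := sq_sum_le_card_mul_sum_sq
      _ ≤ k * ∑ a, (k * ∑ b, B (e a) (e b) ^ 2) := by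
          gcongr with a
          calc _ ≤ (Fintype.card ι : ℝ) * ∑ b, |B (e a) (e b)| ^ 2 := sq_sum_le_card_mul_sum_sq
            _ ≤ _ := by simp only [sq_abs]; gcongr
      _ = _ := by rw [← Finset.mul_sum]; ring
  calc ‖B‖ ^ 2 ≤ (k ^ 4 * ∑ a, ∑ b, |B (e a) (e b)|) ^ 2 := by gcongr
    _ = k ^ 8 * (∑ a, ∑ b, |B (e a) (e b)|) ^ 2 := by ring
    _ ≤ k ^ 8 * (k ^ 2 * ∑ a, ∑ b, B (e a) (e b) ^ 2) := by gcongr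
    _ = _ := by ring

end Frames

noncomputable section Charts

variable {n : ℕ} {ι : Type*} [Fintype ι] {H : Type*} [TopologicalSpace H]
  (I : ModelWithCorners ℝ (EuclideanSpace ℝ (Fin n)) H)
  {M : Type*} [TopologicalSpace M] [ChartedSpace H M]
  [RiemannianBundle (fun x : M => TangentSpace I x)] [IsManifold I ∞ M]

lemma sum_coord_mul {n : ℕ} (f : EuclideanSpace ℝ (Fin n) →L[ℝ] ℝ) (X : EuclideanSpace ℝ (Fin n)) :
    ∑ k, X k * f (EuclideanSpace.single k 1) = f X := by
  conv_rhs => rw [← sum_coord_smul_single X]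
  simp

/-- The coordinate basis. -/
abbrev stdVec (n : ℕ) (k : Fin n) : EuclideanSpace ℝ (Fin n) := EuclideanSpace.single k 1

/-- If the vectors `V k` represent the linear forms `(T Y)ₖ`, the trace along them is the trace in
a frame of `B (T ·, ·)`. -/
lemma traceForm_eq_sum_of_spec {g : EuclideanSpace ℝ (Fin n) →L[ℝ] EuclideanSpace ℝ (Fin n) →L[ℝ] ℝ}
    {e : ι → EuclideanSpace ℝ (Fin n)} (he : IsFrame g e)
    (T : EuclideanSpace ℝ (Fin n) →L[ℝ] EuclideanSpace ℝ (Fin n))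
    {V : Fin n → EuclideanSpace ℝ (Fin n)} (hV : ∀ k Y, g (V k) Y = T Y k)
    (B : EuclideanSpace ℝ (Fin n) →L[ℝ] EuclideanSpace ℝ (Fin n) →L[ℝ] ℝ) :
    traceForm (stdVec n) V B = ∑ a, B (T (e a)) (e a) := by
  have h : ∀ k, B (stdVec n k) (V k) = ∑ a, T (e a) k * B (stdVec n k) (e a) := fun k => by
    conv_lhs => rw [he.2 (V k)]
    simp [hV]
  simp only [traceForm, h]
  rw [Finset.sum_comm]
  exact Finset.sum_congr rfl fun a _ => sum_coord_mul (B.flip (e a)) (T (e a))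

/-- The coordinate trace `∑ g^{ij} Bᵢⱼ` is the sum of `B (e, e)` over an orthonormal frame. -/
lemma traceForm_chartTraceVec {x₀ : M} {y : EuclideanSpace ℝ (Fin n)}
    (hy : y ∈ (extChartAt I x₀).target) {e : ι → EuclideanSpace ℝ (Fin n)}
    (he : IsFrame (chartMetric I x₀ y) e)
    (B : EuclideanSpace ℝ (Fin n) →L[ℝ] EuclideanSpace ℝ (Fin n) →L[ℝ] ℝ) :
    traceForm (stdVec n) (fun k => chartTraceVec I x₀ k y) B = ∑ a, B (e a) (e a) :=
  traceForm_eq_sum_of_spec he (.id ℝ _) (fun k Y => chartTraceVec_spec I hy k Y) B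

lemma exists_isFrame {x₀ : M} {y : EuclideanSpace ℝ (Fin n)}
    (hy : y ∈ (extChartAt I x₀).target) :
    ∃ e : Fin n → EuclideanSpace ℝ (Fin n), IsFrame (chartMetric I x₀ y) e := by
  have : FiniteDimensional ℝ (TangentSpace I ((extChartAt I x₀).symm y)) :=
    inferInstanceAs (FiniteDimensional ℝ (EuclideanSpace ℝ (Fin n)))
  have hfr : Module.finrank ℝ (TangentSpace I ((extChartAt I x₀).symm y)) = n :=
    (finrank_euclideanSpace_fin (𝕜 := ℝ) (n := n))
  let o := (stdOrthonormalBasis ℝ (TangentSpace I ((extChartAt I x₀).symm y))).reindex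
    (finCongr hfr)
  have hsurj : Function.Surjective (chartSymmDeriv I x₀ y) :=
    (isInvertible_mfderivWithin_extChartAt_symm hy).surjective
  choose e he using fun a => hsurj (o a)
  refine ⟨e, fun a => ?_, fun Y => chartSymmDeriv_injective I hy ?_⟩
  · rw [chartMetric_apply, he, real_inner_self_eq_norm_sq, o.orthonormal.1 a]
    norm_num
  · simp only [map_sum, map_smul, he, chartMetric_apply]
    conv_lhs => rw [← o.sum_repr' (chartSymmDeriv I x₀ y Y)]
    exact Finset.sum_congr rfl fun a _ => by rw [real_inner_comm]

variable [IsContMDiffRiemannianBundle I ∞ (EuclideanSpace ℝ (Fin n))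
  (fun x : M => TangentSpace I x)]

lemma chartMetric_compat {x₀ : M} {y : EuclideanSpace ℝ (Fin n)}
    (hy : y ∈ interior (extChartAt I x₀).target) (w X Y : EuclideanSpace ℝ (Fin n)) :
    fderiv ℝ (chartMetric I x₀) y w X Y
      = chartMetric I x₀ y (chartChristoffel I x₀ y w X) Y
        + chartMetric I x₀ y X (chartChristoffel I x₀ y w Y) :=
  (isLeviCivita_chartChristoffel I hy).compat
    ((contDiffAt_chartMetric I hy).differentiableAt (by simp))
    (.of_forall fun z => chartMetric_symm I x₀ z) w X Y

/-- The covariant derivative of the inverse metric vanishes. -/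
lemma traceForm_fderiv_chartTraceVec {x₀ : M} {y : EuclideanSpace ℝ (Fin n)}
    (hy : y ∈ interior (extChartAt I x₀).target) {e : ι → EuclideanSpace ℝ (Fin n)}
    (he : IsFrame (chartMetric I x₀ y) e) (w : EuclideanSpace ℝ (Fin n))
    (B : EuclideanSpace ℝ (Fin n) →L[ℝ] EuclideanSpace ℝ (Fin n) →L[ℝ] ℝ)
    (hB : ∀ X Y, B X Y = B Y X) :
    traceForm (stdVec n) (fun k => fderiv ℝ (chartTraceVec I x₀ k) y w) B
      = -2 * ∑ a, B (e a) (chartChristoffel I x₀ y w (e a)) := by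
  have hg := (contDiffAt_chartMetric I hy).differentiableAt (by simp)
  -- differentiating `g (Pₖ, Y) = Yₖ` gives the covariant derivative of the vector `Pₖ`
  have hspec : ∀ k Y, chartMetric I x₀ y (fderiv ℝ (chartTraceVec I x₀ k) y w
      + chartChristoffel I x₀ y w (chartTraceVec I x₀ k y)) Y
      = (-chartChristoffel I x₀ y w) Y k := by
    intro k Y
    have hP := (contDiffAt_chartTraceVec I hy k).differentiableAt (by simp)
    have h1 := (hg.hasFDerivAt.clm_apply hP.hasFDerivAt).clm_apply (hasFDerivAt_const Y y)
    have h2 : (fun z => chartMetric I x₀ z (chartTraceVec I x₀ k z) Y) =ᶠ[𝓝 y] fun _ => Y k := by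
      filter_upwards [mem_interior_iff_mem_nhds.1 hy] with z hz using chartTraceVec_spec I hz k Y
    have h3 := h1.unique ((hasFDerivAt_const (Y k) y).congr_of_eventuallyEq h2)
    have h4 := DFunLike.congr_fun h3 w
    simp at h4
    have h5 := chartMetric_compat I hy w (chartTraceVec I x₀ k y) Y
    have h6 := chartTraceVec_spec I (interior_subset hy) k (chartChristoffel I x₀ y w Y)
    have h7 : (-chartChristoffel I x₀ y w) Y k = -(chartChristoffel I x₀ y w Y k) := rfl
    rw [h7, map_add, add_apply]
    linarith
  have t1 := traceForm_eq_sum_of_spec he (-chartChristoffel I x₀ y w) hspec B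
  have t2 := traceForm_chartTraceVec I (interior_subset hy) he
    ((B.flip.comp (chartChristoffel I x₀ y w)).flip)
  simp only [traceForm, map_add, Finset.sum_add_distrib, ContinuousLinearMap.flip_apply,
    ContinuousLinearMap.comp_apply, neg_apply, map_neg, Finset.sum_neg_distrib] at t1 t2 ⊢
  simp only [hB (chartChristoffel I x₀ y w _)] at t1
  linarith

/-- Near a point `y₀` of its target, possibly on the boundary, a chart has bounded geometry at the
interior points, with a constant that can be taken larger than any given `A`. -/
lemma exists_localGeometry (A : ℝ) (x₀ : M) {y₀ : EuclideanSpace ℝ (Fin n)}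
    (hy₀ : y₀ ∈ (extChartAt I x₀).target) :
    ∃ K : ℝ, A ≤ K ∧ ∀ᶠ y in 𝓝[(extChartAt I x₀).target] y₀, y ∈ interior (extChartAt I x₀).target →
      ∀ e : Fin n → EuclideanSpace ℝ (Fin n), IsFrame (chartMetric I x₀ y) e →
        LocalGeometry (chartMetric I x₀) (chartChristoffel I x₀) (stdVec n)
          (chartTraceVec I x₀) y e K := by
  have hu := uniqueDiffOn_target I x₀
  obtain ⟨Kg, hKg⟩ := exists_bound_of_contDiffOn hu (contDiffOn_chartMetric I x₀) hy₀
  obtain ⟨KΓ, hKΓ⟩ := exists_bound_of_contDiffOn hu (contDiffOn_chartChristoffel I x₀) hy₀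
  choose KP hKP using fun k => exists_bound_of_contDiffOn hu (contDiffOn_chartTraceVec I x₀ k) hy₀
  obtain ⟨δ, hδ, hpos⟩ := eventually_posDef
    ((contDiffOn_chartMetric I x₀).continuousOn y₀ hy₀) (fun X hX => chartMetric_pos I hy₀ hX)
  -- `k` bounds all the data, and `IsFrame.norm_sq_le` costs the tenth power
  set k : ℝ := |A| + 2 + n + |Kg| + |KΓ| + ∑ i, |KP i| + δ⁻¹ with hk
  have hδ' : 0 < δ⁻¹ := inv_pos.2 hδ
  have hKPn : 0 ≤ ∑ i, |KP i| := Finset.sum_nonneg fun i _ => abs_nonneg _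
  have hn : (0 : ℝ) ≤ n := Nat.cast_nonneg n
  have hk2 : 2 ≤ k := by linarith [abs_nonneg A, abs_nonneg Kg, abs_nonneg KΓ]
  have hkg : Kg ≤ k := by linarith [le_abs_self Kg, abs_nonneg KΓ, abs_nonneg A]
  have hkΓ : KΓ ≤ k := by linarith [le_abs_self KΓ, abs_nonneg A, abs_nonneg Kg]
  have hkP : ∀ i, KP i ≤ k := fun i => by
    have := Finset.single_le_sum (f := fun i => |KP i|) (fun i _ => abs_nonneg _)
      (Finset.mem_univ i)
    linarith [le_abs_self (KP i), abs_nonneg A, abs_nonneg Kg, abs_nonneg KΓ]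
  have hkn : (n : ℝ) ≤ k := by linarith [abs_nonneg A, abs_nonneg Kg, abs_nonneg KΓ]
  have hkδ : δ⁻¹ ≤ k := by linarith [abs_nonneg A, abs_nonneg Kg, abs_nonneg KΓ]
  have hkA : A ≤ k := by linarith [le_abs_self A, abs_nonneg Kg, abs_nonneg KΓ]
  clear_value k
  have hk10 : k ≤ k ^ 10 := le_self_pow₀ (by linarith) (by norm_num)
  refine ⟨k ^ 10, hkA.trans hk10, ?_⟩
  filter_upwards [hKg, hKΓ, Filter.eventually_all.2 hKP, hpos] with y hg hΓ hP hδy hy e he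
  obtain ⟨g0, g1, g2⟩ := hg hy
  obtain ⟨c0, c1, c2⟩ := hΓ hy
  have hyt := interior_subset hy
  have hunit : ∀ X, chartMetric I x₀ y X X = 1 → ‖X‖ ≤ k := fun X hX => by
    have h1 := hδy X
    rw [hX] at h1
    have h2 : ‖X‖ ^ 2 ≤ δ⁻¹ := by
      rw [← one_div, le_div_iff₀ hδ]
      linarith
    nlinarith [norm_nonneg X]
  have hinf := (WithTop.coe_le_coe.2 le_top : ((2 : ℕ∞) : WithTop ℕ∞) ≤ ∞)
  exact
    { contDiffAt_metric := (contDiffAt_chartMetric I hy).of_le hinf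
      contDiffAt_christoffel := (contDiffAt_chartChristoffel I hy).of_le hinf
      contDiffAt_trace := fun i => (contDiffAt_chartTraceVec I hy i).of_le hinf
      christoffel_symm := by
        filter_upwards [isOpen_interior.mem_nhds hy] with z hz using christoffel_symm I hz
      compat := chartMetric_compat I hy
      trace_eq := traceForm_chartTraceVec I hyt he
      fderiv_trace := traceForm_fderiv_chartTraceVec I hy he
      norm_sq_le := he.norm_sq_le (by linarith) (g0.trans hkg) (fun a => hunit _ (he.1 a))
        (by simpa using hkn)
      norm_le_of_unit := fun X hX => (hunit X hX).trans hk10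
      two_le := hk2.trans hk10
      card_le := (by simpa using hkn : (Fintype.card (Fin n) : ℝ) ≤ k).trans hk10
      card_le' := (by simpa using hkn : (Fintype.card (Fin n) : ℝ) ≤ k).trans hk10
      frame_le := fun a => (hunit _ (he.1 a)).trans hk10
      basis_le := fun i => by
        rw [stdVec, PiLp.norm_single, norm_one]
        linarith
      metric_le := (g0.trans hkg).trans hk10
      fderiv_metric_le := (g1.trans hkg).trans hk10
      fderiv_two_metric_le := (g2.trans hkg).trans hk10
      christoffel_le := (c0.trans hkΓ).trans hk10
      fderiv_christoffel_le := (c1.trans hkΓ).trans hk10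
      fderiv_two_christoffel_le := (c2.trans hkΓ).trans hk10
      trace_le := fun i => ((hP i hy).1.trans (hkP i)).trans hk10
      fderiv_trace_le := fun i => ((hP i hy).2.1.trans (hkP i)).trans hk10
      fderiv_two_trace_le := fun i => ((hP i hy).2.2.trans (hkP i)).trans hk10 }

end Charts

/-! ### Transition between two charts -/

noncomputable section Transition

variable {n : ℕ} {H : Type*} [TopologicalSpace H]
  (I : ModelWithCorners ℝ (EuclideanSpace ℝ (Fin n)) H)
  {M : Type*} [TopologicalSpace M] [ChartedSpace H M] [IsManifold I ∞ M]
  [RiemannianBundle (fun x : M => TangentSpace I x)]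

/-- The interior points of `M` are the points sent by a chart to the interior of its target. -/
lemma mem_interior_target_iff {x₀ p : M} (hp : p ∈ (extChartAt I x₀).source) :
    extChartAt I x₀ p ∈ interior (extChartAt I x₀).target ↔ p ∈ I.interior M :=
  (I.isInteriorPoint_iff_of_mem_atlas (n := ∞) (by simp) (chart_mem_atlas H x₀)
    (by simpa using hp)).symm

lemma symm_mem_interior {x₀ : M} {y : EuclideanSpace ℝ (Fin n)}
    (hy : y ∈ interior (extChartAt I x₀).target) : (extChartAt I x₀).symm y ∈ I.interior M := by
  have hyt := interior_subset hy
  rw [← mem_interior_target_iff I ((extChartAt I x₀).map_target hyt),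
    (extChartAt I x₀).right_inv hyt]
  exact hy

/-- The coordinate change between the charts around `x₀` and `x₁`. -/
def transition (x₀ x₁ : M) (y : EuclideanSpace ℝ (Fin n)) : EuclideanSpace ℝ (Fin n) :=
  extChartAt I x₁ ((extChartAt I x₀).symm y)

variable {I} {x₀ x₁ : M} {y : EuclideanSpace ℝ (Fin n)}

lemma contMDiffAt_extChartAt_symm_of_mem_interior (hy : y ∈ interior (extChartAt I x₀).target) :
    ContMDiffAt 𝓘(ℝ, EuclideanSpace ℝ (Fin n)) I ∞ (extChartAt I x₀).symm y :=
  (contMDiffOn_extChartAt_symm x₀).contMDiffAt (mem_interior_iff_mem_nhds.1 hy)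

lemma eventually_mem_source (hy : y ∈ interior (extChartAt I x₀).target)
    (hs : (extChartAt I x₀).symm y ∈ (extChartAt I x₁).source) :
    ∀ᶠ z in 𝓝 y, z ∈ interior (extChartAt I x₀).target ∧
      (extChartAt I x₀).symm z ∈ (extChartAt I x₁).source := by
  filter_upwards [isOpen_interior.mem_nhds hy,
    (contMDiffAt_extChartAt_symm_of_mem_interior hy).continuousAt.eventually
      ((isOpen_extChartAt_source x₁).mem_nhds hs)] with z h1 h2 using ⟨h1, h2⟩

lemma symm_transition (hs : (extChartAt I x₀).symm y ∈ (extChartAt I x₁).source) :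
    (extChartAt I x₁).symm (transition I x₀ x₁ y) = (extChartAt I x₀).symm y :=
  (extChartAt I x₁).left_inv hs

lemma transition_mem_interior (hy : y ∈ interior (extChartAt I x₀).target)
    (hs : (extChartAt I x₀).symm y ∈ (extChartAt I x₁).source) :
    transition I x₀ x₁ y ∈ interior (extChartAt I x₁).target :=
  (mem_interior_target_iff I hs).2 (symm_mem_interior I hy)

lemma contDiffAt_transition (hy : y ∈ interior (extChartAt I x₀).target)
    (hs : (extChartAt I x₀).symm y ∈ (extChartAt I x₁).source) :
    ContDiffAt ℝ ∞ (transition I x₀ x₁) y := by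
  rw [← contMDiffAt_iff_contDiffAt]
  exact (contMDiffAt_extChartAt' (by simpa using hs)).comp y
    (contMDiffAt_extChartAt_symm_of_mem_interior hy)

lemma chartSymmDeriv_eq_mfderiv (hy : y ∈ interior (extChartAt I x₀).target) :
    chartSymmDeriv I x₀ y
      = mfderiv 𝓘(ℝ, EuclideanSpace ℝ (Fin n)) I (extChartAt I x₀).symm y :=
  mfderivWithin_of_mem_nhds
    (mem_interior_iff_mem_nhds.1 (interior_target_subset_interior_range I x₀ hy))

lemma hasMFDerivAt_symm (hy : y ∈ interior (extChartAt I x₀).target) :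
    HasMFDerivAt 𝓘(ℝ, EuclideanSpace ℝ (Fin n)) I (extChartAt I x₀).symm y
      (chartSymmDeriv I x₀ y) := by
  rw [chartSymmDeriv_eq_mfderiv hy]
  exact ((contMDiffAt_extChartAt_symm_of_mem_interior hy).mdifferentiableAt
    (by simp)).hasMFDerivAt

/-- The chain rule for `(chart x₀)⁻¹ = (chart x₁)⁻¹ ∘ transition`. Both sides are tangent vectors at
the same point, but in types that are only definitionally equal to the model space, where the
equality is stated. -/
lemma chartSymmDeriv_transition (hy : y ∈ interior (extChartAt I x₀).target)
    (hs : (extChartAt I x₀).symm y ∈ (extChartAt I x₁).source) (X : EuclideanSpace ℝ (Fin n)) :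
    (chartSymmDeriv I x₀ y X : EuclideanSpace ℝ (Fin n))
      = chartSymmDeriv I x₁ (transition I x₀ x₁ y) (fderiv ℝ (transition I x₀ x₁) y X) := by
  have h1 := hasMFDerivAt_symm (transition_mem_interior hy hs)
  have h2 := ((contDiffAt_transition hy hs).differentiableAt
    (by simp)).hasFDerivAt.hasMFDerivAt
  have h3 := (h1.comp y h2).congr_of_eventuallyEq (f₁ := (extChartAt I x₀).symm) (by
    filter_upwards [eventually_mem_source hy hs] with z hz using (symm_transition hz.2).symm)
  have h4 := h3.mfderiv
  rw [← chartSymmDeriv_eq_mfderiv hy] at h4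
  exact DFunLike.congr_fun h4 X

lemma surjective_fderiv_transition (hy : y ∈ interior (extChartAt I x₀).target)
    (hs : (extChartAt I x₀).symm y ∈ (extChartAt I x₁).source) :
    Function.Surjective (fderiv ℝ (transition I x₀ x₁) y) := by
  refine LinearMap.injective_iff_surjective (f := (fderiv ℝ (transition I x₀ x₁) y).toLinearMap).1
    fun X Y h => ?_
  have h' : fderiv ℝ (transition I x₀ x₁) y X = fderiv ℝ (transition I x₀ x₁) y Y := h
  exact chartSymmDeriv_injective I (interior_subset hy)
    ((chartSymmDeriv_transition hy hs X).trans
      ((congrArg _ h').trans (chartSymmDeriv_transition hy hs Y).symm))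

variable (I) in
/-- The inner product of the tangent space at `p`, on the model space. The point is a plain
argument, so that it can be rewritten. -/
def tangentInner (p : M) (X Y : EuclideanSpace ℝ (Fin n)) : ℝ :=
  inner ℝ (show TangentSpace I p from X) (show TangentSpace I p from Y)

lemma chartMetric_transition (hy : y ∈ interior (extChartAt I x₀).target)
    (hs : (extChartAt I x₀).symm y ∈ (extChartAt I x₁).source) (X Y : EuclideanSpace ℝ (Fin n)) :
    chartMetric I x₀ y X Y = chartMetric I x₁ (transition I x₀ x₁ y)
      (fderiv ℝ (transition I x₀ x₁) y X) (fderiv ℝ (transition I x₀ x₁) y Y) := by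
  have h : ∀ (x : M) z X Y, chartMetric I x z X Y = tangentInner I ((extChartAt I x).symm z)
      (chartSymmDeriv I x z X) (chartSymmDeriv I x z Y) := fun x z X Y =>
    chartMetric_apply I x z X Y
  rw [h, h, symm_transition hs, chartSymmDeriv_transition hy hs X,
    chartSymmDeriv_transition hy hs Y]
  rfl

/-- The chart around `p` identifies isometrically the tangent space at `p` with the model space. -/
lemma chartMetric_self (p : M) (X Y : EuclideanSpace ℝ (Fin n)) :
    chartMetric I p (extChartAt I p p) X Y
      = inner ℝ (show TangentSpace I p from X) (show TangentSpace I p from Y) := by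
  have h : chartMetric I p (extChartAt I p p) X Y
      = tangentInner I ((extChartAt I p).symm (extChartAt I p p))
      (chartSymmDeriv I p (extChartAt I p p) X) (chartSymmDeriv I p (extChartAt I p p) Y) :=
    chartMetric_apply I p _ X Y
  have h' : ∀ X : EuclideanSpace ℝ (Fin n),
      (chartSymmDeriv I p (extChartAt I p p) X : EuclideanSpace ℝ (Fin n)) = X := fun X =>
    DFunLike.congr_fun (mfderivWithin_range_extChartAt_symm (I := I) (x := p)) X
  rw [h, h' X, h' Y, extChartAt_to_inv]
  rfl

variable [IsContMDiffRiemannianBundle I ∞ (EuclideanSpace ℝ (Fin n))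
  (fun x : M => TangentSpace I x)]

lemma chartChristoffel_transition (hy : y ∈ interior (extChartAt I x₀).target)
    (hs : (extChartAt I x₀).symm y ∈ (extChartAt I x₁).source) (X Y : EuclideanSpace ℝ (Fin n)) :
    fderiv ℝ (transition I x₀ x₁) y (chartChristoffel I x₀ y X Y)
      = fderiv ℝ (fderiv ℝ (transition I x₀ x₁)) y X Y
        + chartChristoffel I x₁ (transition I x₀ x₁ y) (fderiv ℝ (transition I x₀ x₁) y X)
          (fderiv ℝ (transition I x₀ x₁) y Y) := by
  have hy' := transition_mem_interior hy hs
  refine (isLeviCivita_chartChristoffel I hy).map_christoffel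
    (isLeviCivita_chartChristoffel I hy')
    ((contDiffAt_chartMetric I hy').differentiableAt (by simp))
    ((contDiffAt_transition hy hs).of_le (WithTop.coe_le_coe.2 le_top))
    ((contDiffAt_chartMetric I hy).differentiableAt (by simp)) ?_
    (chartMetric_symm I x₁ _) (fun X hX => ?_) (surjective_fderiv_transition hy hs) X Y
  · filter_upwards [eventually_mem_source hy hs] with z hz using chartMetric_transition hz.1 hz.2
  · by_contra h
    exact (chartMetric_pos I (interior_subset hy') h).ne' hX

end Transition

/-! ### Hessian, gradient and Laplacian in different charts -/

noncomputable section Hessian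

variable {n : ℕ} {H : Type*} [TopologicalSpace H]
  {I : ModelWithCorners ℝ (EuclideanSpace ℝ (Fin n)) H}
  {M : Type*} [TopologicalSpace M] [ChartedSpace H M] [IsManifold I ∞ M]
  [RiemannianBundle (fun x : M => TangentSpace I x)]

variable (I) in
/-- The Hessian of `u` in the chart around `x₀`, as a bilinear form. -/
def chartHess (x₀ : M) (u : M → ℝ) (y : EuclideanSpace ℝ (Fin n)) :
    EuclideanSpace ℝ (Fin n) →L[ℝ] EuclideanSpace ℝ (Fin n) →L[ℝ] ℝ :=
  hessForm (chartChristoffel I x₀) (u ∘ (extChartAt I x₀).symm) y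

variable (I) in
/-- The squared norm of the gradient of `u`, computed in the chart around `x₀`. -/
def chartGradSq (x₀ : M) (u : M → ℝ) (y : EuclideanSpace ℝ (Fin n)) : ℝ :=
  gradSqForm (stdVec n) (fun k => chartTraceVec I x₀ k y)
    (fderiv ℝ (u ∘ (extChartAt I x₀).symm) y)

variable {x₀ x₁ : M} {y : EuclideanSpace ℝ (Fin n)} {u : M → ℝ}

lemma contDiffAt_comp_symm (hy : y ∈ interior (extChartAt I x₀).target)
    (hu : ContMDiffAt I 𝓘(ℝ, ℝ) ∞ u ((extChartAt I x₀).symm y)) :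
    ContDiffAt ℝ ∞ (u ∘ (extChartAt I x₀).symm) y := by
  rw [← contMDiffAt_iff_contDiffAt]
  exact hu.comp y (contMDiffAt_extChartAt_symm_of_mem_interior hy)

lemma hessianMatrix_eq (hy : y ∈ interior (extChartAt I x₀).target)
    (hu : ContMDiffAt I 𝓘(ℝ, ℝ) ∞ u ((extChartAt I x₀).symm y)) (i j : Fin n) :
    hessianMatrix I x₀ u y i j = chartHess I x₀ u y (stdVec n i) (stdVec n j) := by
  have hr := interior_target_subset_interior_range I x₀ hy
  have hv := contDiffAt_comp_symm hy hu
  have hd : DifferentiableAt ℝ (fderiv ℝ (u ∘ (extChartAt I x₀).symm)) y :=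
    (hv.fderiv_right (m := 1) (WithTop.coe_le_coe.2 le_top)).differentiableAt (by simp)
  have h1 : partialDeriv I j (u ∘ (extChartAt I x₀).symm)
      =ᶠ[𝓝 y] fun z => fderiv ℝ (u ∘ (extChartAt I x₀).symm) z (stdVec n j) := by
    filter_upwards [isOpen_interior.mem_nhds hr] with z hz
      using partialDeriv_of_mem_interior I hz _ _
  have h2 : partialDeriv I i (partialDeriv I j (u ∘ (extChartAt I x₀).symm)) y
      = fderiv ℝ (fderiv ℝ (u ∘ (extChartAt I x₀).symm)) y (stdVec n i) (stdVec n j) := by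
    rw [partialDeriv_of_mem_interior I hr, h1.fderiv_eq,
      (hasFDerivAt_clm_apply_const hd (stdVec n j)).fderiv]
    rfl
  rw [hessianMatrix, Matrix.of_apply, h2]
  simp only [chartHess, hessForm, sub_apply, compForm_apply, partialDeriv_of_mem_interior I hr]
  congr 1
  rw [← sum_coord_mul _ (chartChristoffel I x₀ y (stdVec n i) (stdVec n j))]
  refine Finset.sum_congr rfl fun k _ => ?_
  rw [chartChristoffel, matrixMap_apply_coord, matrixForm_single]
  rfl

/-- At `p` the chart around `p` has the identity as derivative, so that tangent vectors are their
own coordinates. -/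
lemma hessian_eq {p : M} (hp : p ∈ I.interior M) (hu : ContMDiffAt I 𝓘(ℝ, ℝ) ∞ u p)
    (X Y : EuclideanSpace ℝ (Fin n)) :
    hessian I u p X Y = chartHess I p u (extChartAt I p p) X Y := by
  have hy := (mem_interior_target_iff I (mem_extChartAt_source p)).2 hp
  have hc : ∀ (X : EuclideanSpace ℝ (Fin n)) k,
      coordComponent I p (p := p) X k = X k := fun X k =>
    congrArg (fun v : EuclideanSpace ℝ (Fin n) => v k)
      (DFunLike.congr_fun (mfderiv_extChartAt_self (I := I) (x := p)) X)
  simp only [hessian, hc, hessianMatrix_eq hy (by rwa [extChartAt_to_inv])]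
  rw [bilin_apply_eq_sum (chartHess I p u (extChartAt I p p))]
  exact Finset.sum_congr rfl fun i _ => Finset.sum_congr rfl fun j _ => by rw [mul_assoc]

lemma laplacian_eq {p : M} (hp : p ∈ I.interior M) (hu : ContMDiffAt I 𝓘(ℝ, ℝ) ∞ u p) :
    laplacian I u p = traceForm (stdVec n) (fun k => chartTraceVec I p k (extChartAt I p p))
      (chartHess I p u (extChartAt I p p)) := by
  have hy := (mem_interior_target_iff I (mem_extChartAt_source p)).2 hp
  simp only [laplacian, hessianMatrix_eq hy (by rwa [extChartAt_to_inv]), traceForm, chartTraceVec,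
    map_sum, map_smul, smul_eq_mul]

variable [IsContMDiffRiemannianBundle I ∞ (EuclideanSpace ℝ (Fin n))
  (fun x : M => TangentSpace I x)]

lemma chartHess_transition (hy : y ∈ interior (extChartAt I x₀).target)
    (hs : (extChartAt I x₀).symm y ∈ (extChartAt I x₁).source)
    (hu : ContMDiffAt I 𝓘(ℝ, ℝ) ∞ u ((extChartAt I x₀).symm y)) (X Y : EuclideanSpace ℝ (Fin n)) :
    chartHess I x₀ u y X Y = chartHess I x₁ u (transition I x₀ x₁ y)
        (fderiv ℝ (transition I x₀ x₁) y X) (fderiv ℝ (transition I x₀ x₁) y Y) ∧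
      fderiv ℝ (u ∘ (extChartAt I x₀).symm) y X
        = fderiv ℝ (u ∘ (extChartAt I x₁).symm) (transition I x₀ x₁ y)
          (fderiv ℝ (transition I x₀ x₁) y X) := by
  refine hessForm_comp ((contDiffAt_comp_symm (transition_mem_interior hy hs) ?_).of_le
    (WithTop.coe_le_coe.2 le_top))
    ((contDiffAt_transition hy hs).of_le (WithTop.coe_le_coe.2 le_top)) ?_
    (chartChristoffel_transition hy hs) X Y
  · rwa [symm_transition hs]
  · filter_upwards [eventually_mem_source hy hs] with z hz
    simp only [Function.comp, symm_transition hz.2]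

lemma isFrame_transition (hy : y ∈ interior (extChartAt I x₀).target)
    (hs : (extChartAt I x₀).symm y ∈ (extChartAt I x₁).source) {ι : Type*} [Fintype ι]
    {e : ι → EuclideanSpace ℝ (Fin n)} (he : IsFrame (chartMetric I x₀ y) e) :
    IsFrame (chartMetric I x₁ (transition I x₀ x₁ y))
      (fun a => fderiv ℝ (transition I x₀ x₁) y (e a)) := by
  refine ⟨fun a => by rw [← chartMetric_transition hy hs, he.1], fun Y => ?_⟩
  obtain ⟨X, rfl⟩ := surjective_fderiv_transition hy hs Y
  simp only [← chartMetric_transition hy hs]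
  conv_lhs => rw [he.2 X]
  simp

lemma traceForm_transition (hy : y ∈ interior (extChartAt I x₀).target)
    (hs : (extChartAt I x₀).symm y ∈ (extChartAt I x₁).source)
    {B B' : EuclideanSpace ℝ (Fin n) →L[ℝ] EuclideanSpace ℝ (Fin n) →L[ℝ] ℝ}
    (hB : ∀ X, B X X = B' (fderiv ℝ (transition I x₀ x₁) y X)
      (fderiv ℝ (transition I x₀ x₁) y X)) :
    traceForm (stdVec n) (fun k => chartTraceVec I x₀ k y) B
      = traceForm (stdVec n) (fun k => chartTraceVec I x₁ k (transition I x₀ x₁ y)) B' := by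
  obtain ⟨e, he⟩ := exists_isFrame I (interior_subset hy)
  rw [traceForm_chartTraceVec I (interior_subset hy) he, traceForm_chartTraceVec I
    (interior_subset (transition_mem_interior hy hs)) (isFrame_transition hy hs he)]
  exact Finset.sum_congr rfl fun a _ => hB (e a)

lemma gradSqForm_eq_traceForm {E κ : Type*} [NormedAddCommGroup E] [NormedSpace ℝ E] [Fintype κ]
    (b P : κ → E) (α : E →L[ℝ] ℝ) : gradSqForm b P α = traceForm b P (α.smulRight α) := by
  simp [gradSqForm, traceForm]

lemma chartGradSq_transition (hy : y ∈ interior (extChartAt I x₀).target)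
    (hs : (extChartAt I x₀).symm y ∈ (extChartAt I x₁).source)
    (hu : ContMDiffAt I 𝓘(ℝ, ℝ) ∞ u ((extChartAt I x₀).symm y)) :
    chartGradSq I x₀ u y = chartGradSq I x₁ u (transition I x₀ x₁ y) := by
  rw [chartGradSq, chartGradSq, gradSqForm_eq_traceForm, gradSqForm_eq_traceForm]
  refine traceForm_transition hy hs fun X => ?_
  simp only [ContinuousLinearMap.smulRight_apply, smul_apply, smul_eq_mul,
    (chartHess_transition hy hs hu X X).2]

/-- The Laplace-Beltrami operator can be computed in any chart. -/
lemma laplacian_symm_eq (hy : y ∈ interior (extChartAt I x₀).target)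
    (hu : ContMDiffAt I 𝓘(ℝ, ℝ) ∞ u ((extChartAt I x₀).symm y)) :
    laplacian I u ((extChartAt I x₀).symm y)
      = traceForm (stdVec n) (fun k => chartTraceVec I x₀ k y) (chartHess I x₀ u y) := by
  rw [laplacian_eq (symm_mem_interior I hy) hu]
  exact (traceForm_transition hy (mem_extChartAt_source _)
    fun X => (chartHess_transition hy (mem_extChartAt_source _) hu X X).1).symm

end Hessian

/-! ### Gradient bound for Lipschitz functions -/

noncomputable section GradientBound

variable {n : ℕ} {H : Type*} [TopologicalSpace H]
  {I : ModelWithCorners ℝ (EuclideanSpace ℝ (Fin n)) H}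
  {M : Type*} [PseudoEMetricSpace M] [ChartedSpace H M] [IsManifold I ∞ M]
  [RiemannianBundle (fun x : M => TangentSpace I x)]
  [IsContMDiffRiemannianBundle I ∞ (EuclideanSpace ℝ (Fin n)) (fun x : M => TangentSpace I x)]
  [IsRiemannianManifold I M]

variable (I) in
/-- The derivative of the inverse of a chart is locally bounded. -/
lemma exists_norm_chartSymmDeriv_le (x : M) : ∃ C : ℝ≥0,
    ∀ᶠ y in 𝓝[range I] (extChartAt I x x), ∀ X, ‖chartSymmDeriv I x y X‖ ≤ C * ‖X‖ := by
  have hc := ((contDiffOn_chartMetric I x).continuousOn _ (mem_extChartAt_target x)).norm.eventually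
    (Iic_mem_nhds (lt_add_one ‖chartMetric I x (extChartAt I x x)‖))
  rw [nhdsWithin_extChartAt_target_eq] at hc
  set k : ℝ := ‖chartMetric I x (extChartAt I x x)‖ + 1 with hk
  have hk1 : 1 ≤ k := by linarith [norm_nonneg (chartMetric I x (extChartAt I x x))]
  refine ⟨⟨k, by linarith⟩, ?_⟩
  filter_upwards [hc] with y hy X
  refine le_of_sq_le_sq ?_ (by positivity)
  rw [← real_inner_self_eq_norm_sq, ← chartMetric_apply]
  calc chartMetric I x y X X ≤ ‖chartMetric I x y‖ * ‖X‖ * ‖X‖ :=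
        (le_abs_self _).trans ((chartMetric I x y).le_opNorm₂ X X)
    _ ≤ k * ‖X‖ * ‖X‖ := by gcongr
    _ ≤ k * (k * ‖X‖ * ‖X‖) := le_mul_of_one_le_left (by positivity) hk1
    _ = (k * ‖X‖) ^ 2 := by ring

variable (I) in
/-- The inverse of a chart is Lipschitz near the centre of the chart, for the Riemannian
distance. -/
lemma exists_edist_symm_le (x : M) : ∃ C : ℝ≥0, ∃ r > 0,
    ∀ y ∈ Metric.ball (extChartAt I x x) r ∩ range I,
    ∀ z ∈ Metric.ball (extChartAt I x x) r ∩ range I,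
      edist ((extChartAt I x).symm y) ((extChartAt I x).symm z) ≤ C * edist y z := by
  have : IsManifold I 1 M := .of_le (n := ∞) (by simp)
  obtain ⟨C, hC⟩ := exists_norm_chartSymmDeriv_le I x
  obtain ⟨r, r_pos, hr⟩ := Metric.mem_nhdsWithin_iff.1
    (Filter.inter_mem (extChartAt_target_mem_nhdsWithin x) hC)
  refine ⟨C, r, r_pos, fun y hy z hz => ?_⟩
  rw [IsRiemannianManifold.out (I := I)]
  -- the distance is at most the length of the image of a segment, which stays in the convex
  -- set `range I`
  let η := ContinuousAffineMap.lineMap (R := ℝ) y z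
  set γ := (extChartAt I x).symm ∘ η
  have hη : ∀ t ∈ Icc (0 : ℝ) 1, η t ∈ (extChartAt I x).target ∧
      ∀ X, ‖chartSymmDeriv I x (η t) X‖ ≤ C * ‖X‖ := by
    intro t ht
    refine hr (((convex_ball _ _).inter I.convex_range).segment_subset hy hz ?_)
    rw [segment_eq_image_lineMap]
    exact ⟨t, ht, rfl⟩
  have η_smooth : ContMDiffOn 𝓘(ℝ, ℝ) 𝓘(ℝ, EuclideanSpace ℝ (Fin n)) 1 η (Icc 0 1) := by
    apply ContMDiff.contMDiffOn
    rw [contMDiff_iff_contDiff]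
    exact ContinuousAffineMap.contDiff _
  have hle : Manifold.riemannianEDist I ((extChartAt I x).symm y) ((extChartAt I x).symm z)
      ≤ Manifold.pathELength I γ 0 1 := by
    apply Manifold.riemannianEDist_le_pathELength _ _ _ zero_le_one
    · exact (contMDiffOn_extChartAt_symm x).comp η_smooth fun t ht => (hη t ht).1
    · simp [γ, η, ContinuousAffineMap.coe_lineMap_eq]
    · simp [γ, η, ContinuousAffineMap.coe_lineMap_eq]
  apply hle.trans
  rw [← lintegral_fderiv_lineMap_eq_edist, Manifold.pathELength_eq_lintegral_mfderivWithin_Icc,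
    ← MeasureTheory.lintegral_const_mul' _ _ ENNReal.coe_ne_top]
  refine MeasureTheory.setLIntegral_mono' measurableSet_Icc fun t ht => ?_
  have h1 : mfderivWithin 𝓘(ℝ, ℝ) I γ (Icc 0 1) t = (chartSymmDeriv I x (η t)).comp
      (mfderivWithin 𝓘(ℝ, ℝ) 𝓘(ℝ, EuclideanSpace ℝ (Fin n)) η (Icc 0 1) t) := by
    apply mfderivWithin_comp
    · exact mdifferentiableWithinAt_extChartAt_symm (hη t ht).1
    · exact η_smooth.mdifferentiableOn one_ne_zero t ht
    · exact fun s hs => extChartAt_target_subset_range x (hη s hs).1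
    · rw [uniqueMDiffWithinAt_iff_uniqueDiffWithinAt]
      exact uniqueDiffOn_Icc zero_lt_one t ht
  have h2 : mfderivWithin 𝓘(ℝ, ℝ) I γ (Icc 0 1) t (1 : ℝ)
      = chartSymmDeriv I x (η t) (fderivWithin ℝ η (Icc 0 1) t 1) := by
    rw [h1, mfderivWithin_eq_fderivWithin]
    rfl
  have h3 : ‖chartSymmDeriv I x (η t) (fderivWithin ℝ η (Icc 0 1) t 1)‖ₑ
      ≤ C * ‖fderivWithin ℝ η (Icc 0 1) t 1‖ₑ := by
    rw [← ofReal_norm, ← ofReal_norm, ← ENNReal.ofReal_coe_nnreal,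
      ← ENNReal.ofReal_mul C.coe_nonneg]
    exact ENNReal.ofReal_le_ofReal ((hη t ht).2 _)
  exact (congrArg (fun v : TangentSpace I (γ t) => ‖v‖ₑ) h2).trans_le h3

/-- Near a point `x₀` the manifold has bounded geometry, and the derivatives of `L`-Lipschitz
functions are bounded. -/
lemma eventually_localGeometry (L : ℝ≥0) (x₀ : M) : ∃ K : ℝ, ∀ᶠ p in 𝓝 x₀, p ∈ I.interior M →
    p ∈ (extChartAt I x₀).source ∧
    (∀ e : Fin n → EuclideanSpace ℝ (Fin n), IsFrame (chartMetric I x₀ (extChartAt I x₀ p)) e →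
      LocalGeometry (chartMetric I x₀) (chartChristoffel I x₀) (stdVec n)
        (chartTraceVec I x₀) (extChartAt I x₀ p) e K) ∧
    ∀ u : M → ℝ, LipschitzOnWith L u (I.interior M) →
      ‖fderiv ℝ (u ∘ (extChartAt I x₀).symm) (extChartAt I x₀ p)‖ ≤ K := by
  obtain ⟨C, r, hr, hC⟩ := exists_edist_symm_le I x₀
  obtain ⟨K, hK, hgeom⟩ := exists_localGeometry I (L * C : ℝ≥0) x₀ (mem_extChartAt_target x₀)
  have ht : Filter.Tendsto (extChartAt I x₀) (𝓝 x₀)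
      (𝓝[(extChartAt I x₀).target] (extChartAt I x₀ x₀)) :=
    tendsto_nhdsWithin_iff.2 ⟨continuousAt_extChartAt x₀, by
      filter_upwards [extChartAt_source_mem_nhds (I := I) x₀] with p hp
        using (extChartAt I x₀).map_source hp⟩
  refine ⟨K, ?_⟩
  filter_upwards [ht.eventually hgeom, extChartAt_source_mem_nhds (I := I) x₀,
    (continuousAt_extChartAt (I := I) x₀).eventually (Metric.ball_mem_nhds _ hr)]
    with p h1 h2 h3 hp
  have hy := (mem_interior_target_iff I h2).2 hp
  refine ⟨h2, h1 hy, fun u hu => ?_⟩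
  have hs : interior (extChartAt I x₀).target ∩ Metric.ball (extChartAt I x₀ x₀) r
      ∈ 𝓝 (extChartAt I x₀ p) :=
    Filter.inter_mem (isOpen_interior.mem_nhds hy) (Metric.isOpen_ball.mem_nhds h3)
  have hl : LipschitzOnWith (L * C) (u ∘ (extChartAt I x₀).symm)
      (interior (extChartAt I x₀).target ∩ Metric.ball (extChartAt I x₀ x₀) r) := by
    intro y hy z hz
    have hyr := extChartAt_target_subset_range x₀ (interior_subset hy.1)
    have hzr := extChartAt_target_subset_range x₀ (interior_subset hz.1)
    calc _ ≤ L * edist ((extChartAt I x₀).symm y) ((extChartAt I x₀).symm z) :=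
          hu (symm_mem_interior I hy.1) (symm_mem_interior I hz.1)
      _ ≤ L * (C * edist y z) := by
          gcongr
          exact hC y ⟨hy.2, hyr⟩ z ⟨hz.2, hzr⟩
      _ = _ := by rw [← mul_assoc]; simp
  exact (norm_fderiv_le_of_lipschitzOn ℝ hs hl).trans hK

end GradientBound

/-! ### The maximum principle -/

section Touching

/-- A compactness argument: if the sets `S c` increase with `c` and being in `S c` is an open
condition also with respect to `c`, then a compact set that is not contained in `S β` is touched by
the boundary of some `S c` with `β ≤ c`. -/
lemma exists_touching {X : Type*} [TopologicalSpace X] {K : Set X} (hK : IsCompact K)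
    {S : ℝ → Set X} (hmono : Monotone S)
    (hopen : ∀ p ∈ K, ∀ c, p ∈ S c → ∃ c' < c, ∀ᶠ q in 𝓝 p, q ∈ S c')
    (hex : ∀ p ∈ K, ∃ c, p ∈ S c) {β : ℝ} (hβ : ¬ K ⊆ S β) :
    ∃ c ≥ β, (∀ c' > c, K ⊆ S c') ∧ ∃ p ∈ K, p ∉ S c := by
  have hstrict : ∀ c, K ⊆ S c → ∃ c' < c, K ⊆ S c' := fun c hc => by
    refine hK.induction_on (p := fun s => ∃ c' < c, s ⊆ S c') ⟨c - 1, by simp⟩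
      (fun s t hst ⟨c', h, h'⟩ => ⟨c', h, hst.trans h'⟩) ?_ ?_
    · rintro s t ⟨c', h, h'⟩ ⟨c'', k, k'⟩
      exact ⟨max c' c'', max_lt h k, union_subset (h'.trans (hmono (le_max_left _ _)))
        (k'.trans (hmono (le_max_right _ _)))⟩
    · intro p hp
      obtain ⟨c', h, h'⟩ := hopen p hp c (hc hp)
      exact ⟨_, mem_nhdsWithin_of_mem_nhds h', c', h, fun q hq => hq⟩
  obtain ⟨c₁, hc₁⟩ : ∃ c, K ⊆ S c := by
    refine hK.induction_on (p := fun s => ∃ c, s ⊆ S c) ⟨0, by simp⟩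
      (fun s t hst ⟨c', h'⟩ => ⟨c', hst.trans h'⟩) ?_ ?_
    · rintro s t ⟨c', h'⟩ ⟨c'', k'⟩
      exact ⟨max c' c'', union_subset (h'.trans (hmono (le_max_left _ _)))
        (k'.trans (hmono (le_max_right _ _)))⟩
    · intro p hp
      obtain ⟨c, hc⟩ := hex p hp
      obtain ⟨c', -, h'⟩ := hopen p hp c hc
      exact ⟨_, mem_nhdsWithin_of_mem_nhds h', c', fun q hq => hq⟩
  -- `c` is the infimum of the constants whose set contains `K`
  set T : Set ℝ := {c | K ⊆ S c} with hT
  have hlow : ∀ c ∈ T, β ≤ c := fun c hc => by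
    by_contra h
    exact hβ (hc.trans (hmono (not_le.1 h).le))
  have hbdd : BddBelow T := ⟨β, hlow⟩
  have hne : T.Nonempty := ⟨c₁, hc₁⟩
  refine ⟨sInf T, le_csInf hne hlow, fun c' hc' => ?_, ?_⟩
  · obtain ⟨c, hc, hlt⟩ := exists_lt_of_csInf_lt hne hc'
    exact hc.trans (hmono hlt.le)
  · by_contra! h
    obtain ⟨c', hlt, hc'⟩ := hstrict _ h
    exact absurd (csInf_le hbdd hc') (not_le.2 hlt)

end Touching

noncomputable section Barrier

variable {n : ℕ} {H : Type*} [TopologicalSpace H]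
  {I : ModelWithCorners ℝ (EuclideanSpace ℝ (Fin n)) H}
  {M : Type*} [TopologicalSpace M] [ChartedSpace H M] [IsManifold I ∞ M]
  [RiemannianBundle (fun x : M => TangentSpace I x)]

variable (I) in
/-- The form `(c - ε |∇u|²) g - D²u` in the chart around `x₀`. -/
def defectForm (ε : ℝ) (x₀ : M) (u : M → ℝ) (c : ℝ) (y : EuclideanSpace ℝ (Fin n)) :
    EuclideanSpace ℝ (Fin n) →L[ℝ] EuclideanSpace ℝ (Fin n) →L[ℝ] ℝ :=
  (c - ε * chartGradSq I x₀ u y) • chartMetric I x₀ y - chartHess I x₀ u y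

lemma defectForm_apply (ε : ℝ) (x₀ : M) (u : M → ℝ) (c : ℝ) (y X Y : EuclideanSpace ℝ (Fin n)) :
    defectForm I ε x₀ u c y X Y
      = (c - ε * chartGradSq I x₀ u y) * chartMetric I x₀ y X Y - chartHess I x₀ u y X Y := rfl

variable (I) in
/-- The points where `D²u + ε |∇u|² g < c g`, each of them in the chart around it. -/
def belowSet (ε : ℝ) (u : M → ℝ) (c : ℝ) : Set M :=
  {p | ∀ X, X ≠ 0 → 0 < defectForm I ε p u c (extChartAt I p p) X X}

variable {ε : ℝ} {x₀ x₁ p : M} {y : EuclideanSpace ℝ (Fin n)} {u : M → ℝ} {c : ℝ}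

lemma chartMetric_self_pos (p : M) {X : EuclideanSpace ℝ (Fin n)} (hX : X ≠ 0) :
    0 < chartMetric I p (extChartAt I p p) X X :=
  chartMetric_pos I (mem_extChartAt_target p) hX

lemma belowSet_mono : Monotone (belowSet I ε u) := by
  intro c c' h p hp X hX
  have h1 := hp X hX
  rw [defectForm_apply] at h1 ⊢
  nlinarith [chartMetric_self_pos (I := I) p hX]

lemma defectForm_nonneg_of_forall_gt (h : ∀ c' > c, p ∈ belowSet I ε u c')
    (X : EuclideanSpace ℝ (Fin n)) : 0 ≤ defectForm I ε p u c (extChartAt I p p) X X := by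
  rcases eq_or_ne X 0 with rfl | hX
  · simp
  by_contra! hneg
  have hg := chartMetric_self_pos (I := I) p hX
  have h1 := h (c - defectForm I ε p u c (extChartAt I p p) X X
    / chartMetric I p (extChartAt I p p) X X) (by
      have := div_neg_of_neg_of_pos hneg hg
      linarith) X hX
  have h2 : defectForm I ε p u c (extChartAt I p p) X X
      / chartMetric I p (extChartAt I p p) X X * chartMetric I p (extChartAt I p p) X X
      = defectForm I ε p u c (extChartAt I p p) X X := div_mul_cancel₀ _ hg.ne'
  rw [defectForm_apply, sub_right_comm, sub_mul, h2] at h1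
  linarith [defectForm_apply (I := I) ε p u c (extChartAt I p p) X X]

variable [IsContMDiffRiemannianBundle I ∞ (EuclideanSpace ℝ (Fin n))
  (fun x : M => TangentSpace I x)]

lemma defectForm_transition (hy : y ∈ interior (extChartAt I x₀).target)
    (hs : (extChartAt I x₀).symm y ∈ (extChartAt I x₁).source)
    (hu : ContMDiffAt I 𝓘(ℝ, ℝ) ∞ u ((extChartAt I x₀).symm y)) (X Y : EuclideanSpace ℝ (Fin n)) :
    defectForm I ε x₀ u c y X Y = defectForm I ε x₁ u c (transition I x₀ x₁ y)
      (fderiv ℝ (transition I x₀ x₁) y X) (fderiv ℝ (transition I x₀ x₁) y Y) := by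
  rw [defectForm_apply, defectForm_apply, chartGradSq_transition hy hs hu,
    (chartHess_transition hy hs hu X Y).1, chartMetric_transition hy hs]

/-- The defect form at a point, in the chart around this point, and in another chart. -/
lemma exists_defectForm_eq (hy : y ∈ interior (extChartAt I x₀).target)
    (hu : ContMDiffAt I 𝓘(ℝ, ℝ) ∞ u ((extChartAt I x₀).symm y)) :
    ∃ A : EuclideanSpace ℝ (Fin n) →L[ℝ] EuclideanSpace ℝ (Fin n), Function.Surjective A ∧
      (∀ X, defectForm I ε x₀ u c y X X = defectForm I ε ((extChartAt I x₀).symm y) u c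
        (extChartAt I ((extChartAt I x₀).symm y) ((extChartAt I x₀).symm y)) (A X) (A X)) :=
  ⟨_, surjective_fderiv_transition hy (mem_extChartAt_source _),
    fun X => defectForm_transition hy (mem_extChartAt_source _) hu X X⟩

lemma mem_belowSet_of_chart (hy : y ∈ interior (extChartAt I x₀).target)
    (hu : ContMDiffAt I 𝓘(ℝ, ℝ) ∞ u ((extChartAt I x₀).symm y))
    (h : ∀ X, X ≠ 0 → 0 < defectForm I ε x₀ u c y X X) :
    (extChartAt I x₀).symm y ∈ belowSet I ε u c := by
  obtain ⟨A, hA, hAe⟩ := exists_defectForm_eq (ε := ε) (c := c) hy hu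
  intro Y hY
  obtain ⟨X, rfl⟩ := hA Y
  rw [← hAe]
  exact h X fun hX => hY (by rw [hX, map_zero])

lemma continuousAt_chartHess (hy : y ∈ interior (extChartAt I x₀).target)
    (hu : ContMDiffAt I 𝓘(ℝ, ℝ) ∞ u ((extChartAt I x₀).symm y)) :
    ContinuousAt (chartHess I x₀ u) y := by
  have hv := contDiffAt_comp_symm hy hu
  have h1 : ContDiffAt ℝ 1 (fderiv ℝ (u ∘ (extChartAt I x₀).symm)) y :=
    hv.fderiv_right (WithTop.coe_le_coe.2 le_top)
  have h2 : ContDiffAt ℝ 0 (fderiv ℝ (fderiv ℝ (u ∘ (extChartAt I x₀).symm))) y :=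
    h1.fderiv_right (by norm_num)
  have h3 : ContinuousAt (fun z => compForm (fderiv ℝ (u ∘ (extChartAt I x₀).symm) z)) y :=
    (ContinuousLinearMap.continuous compForm).continuousAt.comp h1.continuousAt
  exact h2.continuousAt.sub (h3.clm_apply (contDiffAt_chartChristoffel I hy).continuousAt)

lemma continuousAt_chartGradSq (hy : y ∈ interior (extChartAt I x₀).target)
    (hu : ContMDiffAt I 𝓘(ℝ, ℝ) ∞ u ((extChartAt I x₀).symm y)) :
    ContinuousAt (chartGradSq I x₀ u) y := by
  have hv := contDiffAt_comp_symm hy hu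
  have h1 : ContDiffAt ℝ 1 (fderiv ℝ (u ∘ (extChartAt I x₀).symm)) y :=
    hv.fderiv_right (WithTop.coe_le_coe.2 le_top)
  unfold chartGradSq gradSqForm
  exact tendsto_finsetSum _ fun k _ => (h1.continuousAt.clm_apply continuousAt_const).mul
    (h1.continuousAt.clm_apply (contDiffAt_chartTraceVec I hy k).continuousAt)

/-- At interior points, being in `belowSet` is an open condition in the point and in the constant.
-/
lemma exists_lt_mem_belowSet (hp : p ∈ I.interior M)
    (hu : ∀ᶠ q in 𝓝 p, ContMDiffAt I 𝓘(ℝ, ℝ) ∞ u q) (hc : p ∈ belowSet I ε u c) :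
    ∃ c' < c, ∀ᶠ q in 𝓝 p, q ∈ belowSet I ε u c' := by
  have hy := (mem_interior_target_iff I (mem_extChartAt_source p)).2 hp
  set y := extChartAt I p p with hydef
  have hup : ContMDiffAt I 𝓘(ℝ, ℝ) ∞ u ((extChartAt I p).symm y) := by
    rw [hydef, extChartAt_to_inv]
    exact hu.self_of_nhds
  have hcont : ContinuousAt (fun a : ℝ × EuclideanSpace ℝ (Fin n) =>
      defectForm I ε p u a.1 a.2) (c, y) := by
    have hsnd : ContinuousAt (Prod.snd : ℝ × EuclideanSpace ℝ (Fin n) → _) (c, y) :=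
      continuousAt_snd
    have hG : ContinuousAt (fun a : ℝ × EuclideanSpace ℝ (Fin n) =>
        chartGradSq I p u a.2) (c, y) :=
      ContinuousAt.comp (g := chartGradSq I p u) (continuousAt_chartGradSq hy hup) hsnd
    have hM : ContinuousAt (fun a : ℝ × EuclideanSpace ℝ (Fin n) =>
        chartMetric I p a.2) (c, y) :=
      ContinuousAt.comp (g := chartMetric I p) (contDiffAt_chartMetric I hy).continuousAt hsnd
    have hH : ContinuousAt (fun a : ℝ × EuclideanSpace ℝ (Fin n) =>
        chartHess I p u a.2) (c, y) :=
      ContinuousAt.comp (g := chartHess I p u) (continuousAt_chartHess hy hup) hsnd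
    exact ((continuousAt_fst.sub (continuousAt_const.mul hG)).smul hM).sub hH
  obtain ⟨δ, hδ, hev⟩ := eventually_posDef hcont.tendsto hc
  rw [nhds_prod_eq] at hev
  have hev' := hev.curry
  obtain ⟨c', h1, h2⟩ := ((hev'.filter_mono (nhdsWithin_le_nhds (s := Iio c))).and
    self_mem_nhdsWithin).exists
  refine ⟨c', h2, ?_⟩
  filter_upwards [(continuousAt_extChartAt (I := I) p).eventually h1,
    (I.isOpen_interior (n := ∞) (by simp)).mem_nhds hp, hu,
    extChartAt_source_mem_nhds (I := I) p] with q hq hqi hqu hqs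
  have e := (extChartAt I p).left_inv hqs
  have := mem_belowSet_of_chart (ε := ε) (c := c') (u := u)
    ((mem_interior_target_iff I hqs).2 hqi) (by rwa [e]) fun X hX =>
      lt_of_lt_of_le (by positivity) (hq X)
  rwa [e] at this

lemma exists_mem_belowSet (ε : ℝ) (p : M) (u : M → ℝ) : ∃ c, p ∈ belowSet I ε u c := by
  obtain ⟨δ, hδ, h⟩ := exists_pos_mul_sq_le (chartMetric I p (extChartAt I p p))
    (fun X hX => chartMetric_self_pos p hX)
  refine ⟨ε * chartGradSq I p u (extChartAt I p p)
    + (‖chartHess I p u (extChartAt I p p)‖ + 1) / δ, fun X hX => ?_⟩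
  rw [defectForm_apply, add_sub_cancel_left]
  have hX' : 0 < ‖X‖ := norm_pos_iff.2 hX
  have h1 : chartHess I p u (extChartAt I p p) X X
      ≤ ‖chartHess I p u (extChartAt I p p)‖ * ‖X‖ * ‖X‖ :=
    (le_abs_self _).trans ((chartHess I p u (extChartAt I p p)).le_opNorm₂ X X)
  have h2 : (‖chartHess I p u (extChartAt I p p)‖ + 1) / δ * (δ * ‖X‖ ^ 2)
      ≤ (‖chartHess I p u (extChartAt I p p)‖ + 1) / δ
        * chartMetric I p (extChartAt I p p) X X := by gcongr; exact h X
  have h3 : (‖chartHess I p u (extChartAt I p p)‖ + 1) / δ * (δ * ‖X‖ ^ 2)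
      = (‖chartHess I p u (extChartAt I p p)‖ + 1) * ‖X‖ ^ 2 := by field_simp
  nlinarith

/-- The gradient term in an orthonormal frame. -/
lemma chartGradSq_eq_sum (hy : y ∈ (extChartAt I x₀).target) {ι : Type*} [Fintype ι]
    {e : ι → EuclideanSpace ℝ (Fin n)} (he : IsFrame (chartMetric I x₀ y) e) :
    chartGradSq I x₀ u y = ∑ a, fderiv ℝ (u ∘ (extChartAt I x₀).symm) y (e a) ^ 2 := by
  rw [chartGradSq, gradSqForm_eq_traceForm, traceForm_chartTraceVec I hy he]
  simp [pow_two]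

lemma chartGradSq_nonneg (hy : y ∈ (extChartAt I x₀).target) : 0 ≤ chartGradSq I x₀ u y := by
  obtain ⟨e, he⟩ := exists_isFrame I hy
  rw [chartGradSq_eq_sum hy he]
  positivity

end Barrier

noncomputable section Estimate

variable {n : ℕ} {H : Type*} [TopologicalSpace H]
  {I : ModelWithCorners ℝ (EuclideanSpace ℝ (Fin n)) H}
  {M : Type*} [PseudoEMetricSpace M] [ChartedSpace H M] [IsManifold I ∞ M]
  [RiemannianBundle (fun x : M => TangentSpace I x)]
  [IsContMDiffRiemannianBundle I ∞ (EuclideanSpace ℝ (Fin n)) (fun x : M => TangentSpace I x)]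
  [IsRiemannianManifold I M]

variable (I) in
/-- The gradient of `L`-Lipschitz functions is locally bounded. -/
lemma eventually_chartGradSq_le (L : ℝ≥0) (x₀ : M) : ∃ G : ℝ, ∀ᶠ p in 𝓝 x₀, p ∈ I.interior M →
    ∀ u : M → ℝ, LipschitzOnWith L u (I.interior M) → ContMDiffAt I 𝓘(ℝ, ℝ) ∞ u p →
      chartGradSq I p u (extChartAt I p p) ≤ G := by
  obtain ⟨K, hK⟩ := eventually_localGeometry (I := I) L x₀
  refine ⟨∑ _a : Fin n, (K * K) ^ 2, ?_⟩
  filter_upwards [hK] with p hp hpi u hu hup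
  obtain ⟨hs, hgeom, hlip⟩ := hp hpi
  have hy := (mem_interior_target_iff I hs).2 hpi
  have e0 := (extChartAt I x₀).left_inv hs
  have e1 := chartGradSq_transition (u := u) (x₁ := p) hy
    (by rw [e0]; exact mem_extChartAt_source p)
    (by rwa [e0])
  rw [transition, e0] at e1
  obtain ⟨e, he⟩ := exists_isFrame I (interior_subset hy)
  rw [← e1, chartGradSq_eq_sum (interior_subset hy) he]
  refine Finset.sum_le_sum fun a _ => sq_le_sq' ?_ ?_ <;>
  have h1 := (fderiv ℝ (u ∘ (extChartAt I x₀).symm) (extChartAt I x₀ p)).le_opNorm (e a) <;>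
  have h2 : ‖fderiv ℝ (u ∘ (extChartAt I x₀).symm) (extChartAt I x₀ p)‖ * ‖e a‖ ≤ K * K :=
    mul_le_mul (hlip u hu) ((hgeom e he).frame_le a) (norm_nonneg _)
      ((norm_nonneg _).trans (hlip u hu)) <;>
  have h3 := abs_le.1 (h1.trans h2) <;>
  linarith [h3.1, h3.2]

variable (I) in
/-- The local form of the maximum principle: if `Δu` is a large constant near `p` and
`D²u + ε |∇u|² g ≤ c g` near `p`, then this inequality is strict at `p`. -/
lemma eventually_mem_belowSet (L : ℝ≥0) (hε : 0 < ε) (hε1 : ε ≤ 1) (x₀ : M) :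
    ∃ m₁ : ℝ, ∀ᶠ p in 𝓝 x₀, p ∈ I.interior M → ∀ u : M → ℝ, LipschitzOnWith L u (I.interior M) →
      (∀ᶠ q in 𝓝 p, ContMDiffAt I 𝓘(ℝ, ℝ) ∞ u q) → ∀ m : ℝ, m₁ < |m| →
      (∀ᶠ q in 𝓝 p, laplacian I u q = m) → ∀ c : ℝ,
      (∀ᶠ q in 𝓝 p, ∀ X, 0 ≤ defectForm I ε q u c (extChartAt I q q) X X) →
      p ∈ belowSet I ε u c := by
  obtain ⟨K, hK⟩ := eventually_localGeometry (I := I) L x₀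
  refine ⟨K ^ 6 * (2 + K ^ 41 / ε), ?_⟩
  filter_upwards [hK] with p hp hpi u hu hup m hm hlap c hmax
  obtain ⟨hs, hgeom, hlip⟩ := hp hpi
  have hy := (mem_interior_target_iff I hs).2 hpi
  have e0 := (extChartAt I x₀).left_inv hs
  set y := extChartAt I x₀ p with hydef
  have htend : Filter.Tendsto (extChartAt I x₀).symm (𝓝 y) (𝓝 p) := by
    have := (contMDiffAt_extChartAt_symm_of_mem_interior hy).continuousAt.tendsto
    rwa [e0] at this
  have hup' : ContMDiffAt I 𝓘(ℝ, ℝ) ∞ u ((extChartAt I x₀).symm y) := by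
    rw [e0]
    exact hup.self_of_nhds
  have hall : ∀ᶠ z in 𝓝 y, ∀ X, 0 ≤ defectForm I ε x₀ u c z X X := by
    filter_upwards [htend.eventually hmax, htend.eventually hup, isOpen_interior.mem_nhds hy]
      with z h1 h2 h3 X
    obtain ⟨A, -, hA⟩ := exists_defectForm_eq (ε := ε) (c := c) h3 h2
    rw [hA]
    exact h1 _
  -- otherwise the defect form degenerates at `p`, and the estimate at a maximum bounds `|m|`
  by_contra hcon
  have hex : ∃ X, X ≠ 0 ∧ defectForm I ε x₀ u c y X X = 0 := by
    by_contra! h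
    refine hcon ?_
    have := mem_belowSet_of_chart (ε := ε) (c := c) hy hup' fun X hX =>
      lt_of_le_of_ne (hall.self_of_nhds X) (h X hX).symm
    rwa [e0] at this
  obtain ⟨X, hX, hX0⟩ := hex
  have hg := chartMetric_pos I (interior_subset hy) hX
  set r := Real.sqrt (chartMetric I x₀ y X X) with hr
  have hr0 : 0 < r := Real.sqrt_pos.2 hg
  have hr2 : r * r = chartMetric I x₀ y X X := Real.mul_self_sqrt hg.le
  obtain ⟨e, he⟩ := exists_isFrame I (interior_subset hy)
  refine absurd ((hgeom e he).abs_laplacian_le (v := u ∘ (extChartAt I x₀).symm) (m := m) (c := c)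
    (X := r⁻¹ • X) ((contDiffAt_comp_symm hy hup').of_le (WithTop.coe_le_coe.2 le_top))
    (hlip u hu) hε hε1 ?_ ?_ ?_ ?_) (not_le.2 hm)
  · filter_upwards [htend.eventually hlap, htend.eventually hup, isOpen_interior.mem_nhds hy]
      with z h1 h2 h3
    rw [← h1, laplacian_symm_eq h3 h2]
    rfl
  · filter_upwards [hall] with z hz X
    have := hz X
    rw [defectForm_apply, chartHess, chartGradSq] at this
    linarith
  · simp only [map_smul, smul_apply, smul_eq_mul, ← hr2]
    field_simp
  · have h1 : defectForm I ε x₀ u c y (r⁻¹ • X) (r⁻¹ • X) = 0 := by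
      simp [hX0]
    rw [defectForm_apply, chartHess, chartGradSq] at h1
    linarith

variable [CompactSpace M]

variable (I M) in
/-- By compactness of `M`, the gradient bound for `L`-Lipschitz functions is uniform. -/
lemma exists_chartGradSq_le (L : ℝ≥0) : ∃ G : ℝ, ∀ p ∈ I.interior M,
    ∀ u : M → ℝ, LipschitzOnWith L u (I.interior M) → ContMDiffAt I 𝓘(ℝ, ℝ) ∞ u p →
      chartGradSq I p u (extChartAt I p p) ≤ G := by
  have := isCompact_univ.induction_on (X := M) (p := fun s => ∃ G : ℝ, ∀ p ∈ s, p ∈ I.interior M →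
    ∀ u : M → ℝ, LipschitzOnWith L u (I.interior M) → ContMDiffAt I 𝓘(ℝ, ℝ) ∞ u p →
      chartGradSq I p u (extChartAt I p p) ≤ G) ⟨0, by simp⟩
    (fun s t hst ⟨G, hG⟩ => ⟨G, fun p hp => hG p (hst hp)⟩)
    (fun s t ⟨G, hG⟩ ⟨G', hG'⟩ => ⟨max G G', fun p hp hpi u h1 h2 => hp.elim
      (fun h => (hG p h hpi u h1 h2).trans (le_max_left _ _))
      (fun h => (hG' p h hpi u h1 h2).trans (le_max_right _ _))⟩)
    (fun x _ => by
      obtain ⟨G, hG⟩ := eventually_chartGradSq_le I L x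
      exact ⟨_, mem_nhdsWithin_of_mem_nhds hG, G, fun p hp => hp⟩)
  simpa using this

variable (I M) in
/-- By compactness of `M`, the constant of the local maximum principle is uniform. -/
lemma exists_forall_mem_belowSet (L : ℝ≥0) (hε : 0 < ε) (hε1 : ε ≤ 1) :
    ∃ m₁ : ℝ, ∀ p ∈ I.interior M, ∀ u : M → ℝ, LipschitzOnWith L u (I.interior M) →
      (∀ᶠ q in 𝓝 p, ContMDiffAt I 𝓘(ℝ, ℝ) ∞ u q) → ∀ m : ℝ, m₁ < |m| →
      (∀ᶠ q in 𝓝 p, laplacian I u q = m) → ∀ c : ℝ,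
      (∀ᶠ q in 𝓝 p, ∀ X, 0 ≤ defectForm I ε q u c (extChartAt I q q) X X) →
      p ∈ belowSet I ε u c := by
  have := isCompact_univ.induction_on (X := M) (p := fun s => ∃ m₁ : ℝ, ∀ p ∈ s,
      p ∈ I.interior M → ∀ u : M → ℝ, LipschitzOnWith L u (I.interior M) →
      (∀ᶠ q in 𝓝 p, ContMDiffAt I 𝓘(ℝ, ℝ) ∞ u q) → ∀ m : ℝ, m₁ < |m| →
      (∀ᶠ q in 𝓝 p, laplacian I u q = m) → ∀ c : ℝ,
      (∀ᶠ q in 𝓝 p, ∀ X, 0 ≤ defectForm I ε q u c (extChartAt I q q) X X) →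
      p ∈ belowSet I ε u c) ⟨0, by simp⟩
    (fun s t hst ⟨G, hG⟩ => ⟨G, fun p hp => hG p (hst hp)⟩)
    (fun s t ⟨G, hG⟩ ⟨G', hG'⟩ => ⟨max G G', fun p hp hpi u h1 h2 m hm => hp.elim
      (fun h => hG p h hpi u h1 h2 m ((le_max_left _ _).trans_lt hm))
      (fun h => hG' p h hpi u h1 h2 m ((le_max_right _ _).trans_lt hm))⟩)
    (fun x _ => by
      obtain ⟨G, hG⟩ := eventually_mem_belowSet I L hε hε1 x
      exact ⟨_, mem_nhdsWithin_of_mem_nhds hG, G, fun p hp => hp⟩)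
  simpa using this

variable (I M) in
/-- The maximum principle: if `|Δu|` is a large constant in an open set `E`, then an upper bound of
`D²u + ε |∇u|² g` outside a compact subset of `E` holds in the whole of `E`. -/
theorem exists_subset_belowSet (L : ℝ≥0) (hε : 0 < ε) (hε1 : ε ≤ 1) :
    ∃ m₁ : ℝ, ∀ u : M → ℝ, LipschitzOnWith L u (I.interior M) → ∀ m : ℝ, m₁ < |m| →
      ∀ E ⊆ I.interior M, IsOpen E → ContMDiffOn I 𝓘(ℝ, ℝ) ∞ u E →
      (∀ q ∈ E, laplacian I u q = m) → ∀ β : ℝ, ∀ K ⊆ E, IsCompact K →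
      E \ K ⊆ belowSet I ε u β → E ⊆ belowSet I ε u β := by
  obtain ⟨m₁, hm₁⟩ := exists_forall_mem_belowSet I M L hε hε1
  refine ⟨m₁, fun u hu m hm E hEi hE hsm hlap β K hKE hK hout => ?_⟩
  have hsm' : ∀ p ∈ E, ∀ᶠ q in 𝓝 p, ContMDiffAt I 𝓘(ℝ, ℝ) ∞ u q := fun p hp => by
    filter_upwards [hE.mem_nhds hp] with q hq using hsm.contMDiffAt (hE.mem_nhds hq)
  by_cases hKβ : K ⊆ belowSet I ε u β
  · intro p hp
    by_cases hpK : p ∈ K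
    exacts [hKβ hpK, hout ⟨hp, hpK⟩]
  · exfalso
    obtain ⟨c, hc, hall, p, hpK, hpc⟩ := exists_touching hK belowSet_mono
      (fun p hp c hc => exists_lt_mem_belowSet (hEi (hKE hp)) (hsm' p (hKE hp)) hc)
      (fun p _ => exists_mem_belowSet ε p u) hKβ
    -- the bound by `c` holds in the whole of `E` but is not strict at `p`
    refine hpc (hm₁ p (hEi (hKE hpK)) u hu (hsm' p (hKE hpK)) m hm ?_ c ?_)
    · filter_upwards [hE.mem_nhds (hKE hpK)] with q hq using hlap q hq
    · filter_upwards [hE.mem_nhds (hKE hpK)] with q hq X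
      refine defectForm_nonneg_of_forall_gt (fun c' hc' => ?_) X
      by_cases hqK : q ∈ K
      · exact hall c' hc' hqK
      · exact belowSet_mono (hc.le.trans hc'.le) (hout ⟨hq, hqK⟩)

end Estimate

/-! ### Second-order differential equations -/

section SecondOrderODE

variable {E : Type*} [NormedAddCommGroup E] [NormedSpace ℝ E]

/-- The flow of a `C¹` vector field near a point, Lipschitz in the initial value and with values
in a given neighborhood. -/
lemma exists_flow [CompleteSpace E] {f : E → E} {x₀ : E} (hf : ContDiffAt ℝ 1 f x₀) {U : Set E}
    (hU : U ∈ 𝓝 x₀) : ∃ r > (0 : ℝ), ∃ ε > (0 : ℝ), ∃ α : E → ℝ → E, ∃ L : ℝ≥0,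
      (∀ x ∈ Metric.closedBall x₀ r, α x 0 = x ∧
        ∀ t ∈ Ioo (-ε) ε, HasDerivAt (α x) (f (α x t)) t ∧ α x t ∈ U) ∧
      ∀ t ∈ Ioo (-ε) ε, LipschitzOnWith L (α · t) (Metric.closedBall x₀ r) := by
  obtain ⟨ε, hε, a, r, C, K, hr, hpl⟩ := IsPicardLindelof.of_contDiffAt_one hf
  obtain ⟨α, hα, L, hL⟩ :=
    (hpl 0).exists_forall_mem_closedBall_eq_hasDerivWithinAt_lipschitzOnWith
  simp only [zero_sub, zero_add] at hα hL
  have hcont : ContinuousOn (Function.uncurry α) (Metric.closedBall x₀ r ×ˢ Icc (-ε) ε) :=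
    continuousOn_prod_of_continuousOn_lipschitzOnWith _ L
      (fun x hx => HasDerivWithinAt.continuousOn (hα x hx).2) hL
  have hx₀ : x₀ ∈ Metric.closedBall x₀ (r : ℝ) := Metric.mem_closedBall_self r.coe_nonneg
  have hnhds : Metric.closedBall x₀ (r : ℝ) ×ˢ Icc (-ε) ε ∈ 𝓝 (x₀, (0 : ℝ)) :=
    prod_mem_nhds (Metric.closedBall_mem_nhds _ hr) (Icc_mem_nhds (by linarith) hε)
  have hev : ∀ᶠ q in 𝓝 (x₀, (0 : ℝ)), Function.uncurry α q ∈ U := by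
    refine (hcont.continuousAt hnhds).eventually ?_
    have : Function.uncurry α (x₀, 0) = x₀ := (hα x₀ hx₀).1
    rw [this]
    exact hU
  obtain ⟨η, hη, hball⟩ := Metric.eventually_nhds_iff_ball.1 hev
  refine ⟨min r (η / 2), by positivity, min ε η, lt_min hε hη, α, L, fun x hx => ?_, fun t ht => ?_⟩
  · have hx' : x ∈ Metric.closedBall x₀ (r : ℝ) :=
      Metric.closedBall_subset_closedBall (min_le_left _ _) hx
    refine ⟨(hα x hx').1, fun t ht => ?_⟩
    have h1 : -ε < t := lt_of_le_of_lt (by simp) ht.1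
    have h2 : t < ε := ht.2.trans_le (min_le_left _ _)
    refine ⟨((hα x hx').2 t ⟨h1.le, h2.le⟩).hasDerivAt (Icc_mem_nhds h1 h2), hball (x, t) ?_⟩
    have h3 : |t| < η := (abs_lt.2 ht).trans_le (min_le_right _ _)
    have h4 : dist x x₀ < η :=
      ((Metric.mem_closedBall.1 hx).trans (min_le_right _ _)).trans_lt (by linarith)
    simpa [Prod.dist_eq] using ⟨h4, h3⟩
  · have h1 : -ε < t := lt_of_le_of_lt (by simp) ht.1
    have h2 : t < ε := ht.2.trans_le (min_le_left _ _)
    exact (hL t ⟨h1.le, h2.le⟩).mono (Metric.closedBall_subset_closedBall (min_le_left _ _))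

/-- A path with bounded acceleration deviates quadratically from its tangent line. -/
lemma norm_sub_sub_smul_le {z ζ φ : ℝ → E} {ε C : ℝ} (hz : ∀ t ∈ Ico 0 ε, HasDerivAt z (ζ t) t)
    (hζ : ∀ t ∈ Ico 0 ε, HasDerivAt ζ (φ t) t) (hC : ∀ t ∈ Ico 0 ε, ‖φ t‖ ≤ C) {s : ℝ}
    (hs : s ∈ Ico 0 ε) : ‖z s - z 0 - s • ζ 0‖ ≤ C * s * s := by
  have hmem : ∀ t ∈ Icc 0 s, t ∈ Ico 0 ε := fun t ht => ⟨ht.1, ht.2.trans_lt hs.2⟩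
  have hs0 : (0 : ℝ) ∈ Ico 0 ε := hmem 0 ⟨le_rfl, hs.1⟩
  have hC0 : 0 ≤ C := (norm_nonneg _).trans (hC 0 hs0)
  have h1 : ∀ t ∈ Icc 0 s, ‖ζ t - ζ 0‖ ≤ C * s := fun t ht => by
    have := norm_image_sub_le_of_norm_deriv_le_segment' (f := ζ) (f' := φ) (a := 0) (b := s)
      (C := C)
      (fun x hx => (hζ x (hmem x hx)).hasDerivWithinAt)
      (fun x hx => hC x (hmem x (Ico_subset_Icc_self hx))) t ht
    refine this.trans ?_
    rw [sub_zero]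
    gcongr
    exact ht.2
  have h2 : ∀ t ∈ Icc 0 s, HasDerivWithinAt (fun t => z t - t • ζ 0) (ζ t - ζ 0) (Icc 0 s) t :=
    fun t ht => by
      have h := ((hz t (hmem t ht)).sub
        ((hasDerivAt_id t).smul_const (ζ 0))).hasDerivWithinAt (s := Icc 0 s)
      rw [one_smul] at h
      exact h
  have h3 := norm_image_sub_le_of_norm_deriv_le_segment' h2
    (fun x hx => h1 x (Ico_subset_Icc_self hx)) s ⟨hs.1, le_rfl⟩
  simp only [zero_smul, sub_zero] at h3
  rwa [sub_right_comm]

/-- The solutions of a second order equation that start at `y₀` reach all the points close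
to `y₀`, at a speed bounded below and above. -/
lemma exists_solution_through [CompleteSpace E] {F : E × E → E} {y₀ : E}
    (hF : ContDiffAt ℝ 1 F (y₀, 0)) {U : Set (E × E)} (hU : U ∈ 𝓝 (y₀, (0 : E))) :
    ∃ r > (0 : ℝ), ∃ ε > (0 : ℝ), ∃ δ > (0 : ℝ), ∀ y, y ≠ y₀ → ‖y - y₀‖ < δ →
      ∃ z ζ : ℝ → E, z 0 = y₀ ∧ r / 4 ≤ ‖ζ 0‖ ∧ ‖ζ 0‖ ≤ r ∧ z (2 * ‖y - y₀‖ / r) = y ∧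
        ∀ t ∈ Ioo (-ε) ε, HasDerivAt z (ζ t) t ∧ HasDerivAt ζ (F (z t, ζ t)) t ∧
          (z t, ζ t) ∈ U := by
  obtain ⟨K, s, hs, hK⟩ := hF.exists_lipschitzOnWith
  have hb := hF.continuousAt.norm.eventually (Iic_mem_nhds (lt_add_one ‖F (y₀, 0)‖))
  set B : ℝ := ‖F (y₀, 0)‖ + 1 with hB
  have hB0 : 0 < B := by positivity
  have hf : ContDiffAt ℝ 1 (fun q : E × E => (q.2, F q)) (y₀, 0) := contDiffAt_snd.prodMk hF
  obtain ⟨r, hr, ε, hε, α, L, hα, hL⟩ := exists_flow hf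
    (Filter.inter_mem hU (Filter.inter_mem hs hb))
  have hw : ∀ w : E, ‖w‖ ≤ r → (y₀, w) ∈ Metric.closedBall (y₀, (0 : E)) r := fun w hw => by
    simpa [Prod.dist_eq, hr.le] using hw
  have hIco : ∀ t ∈ Ico 0 ε, t ∈ Ioo (-ε) ε := fun t ht => ⟨by linarith [ht.1], ht.2⟩
  have hz : ∀ w, ‖w‖ ≤ r → ∀ t ∈ Ioo (-ε) ε, HasDerivAt (fun t => (α (y₀, w) t).1)
      (α (y₀, w) t).2 t := fun w hwr t ht => ((hα _ (hw w hwr)).2 t ht).1.fst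
  have hζ : ∀ w, ‖w‖ ≤ r → ∀ t ∈ Ioo (-ε) ε, HasDerivAt (fun t => (α (y₀, w) t).2)
      (F (α (y₀, w) t)) t := fun w hwr t ht => ((hα _ (hw w hwr)).2 t ht).1.snd
  have h0 : ∀ w, ‖w‖ ≤ r → α (y₀, w) 0 = (y₀, w) := fun w hwr => (hα _ (hw w hwr)).1
  have hU' : ∀ w, ‖w‖ ≤ r → ∀ t ∈ Ioo (-ε) ε, α (y₀, w) t ∈ U ∧ α (y₀, w) t ∈ s ∧
      ‖F (α (y₀, w) t)‖ ≤ B := fun w hwr t ht => ((hα _ (hw w hwr)).2 t ht).2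
  have hest1 : ∀ w, ‖w‖ ≤ r → ∀ t ∈ Ico 0 ε, ‖(α (y₀, w) t).1 - y₀ - t • w‖ ≤ B * t * t := by
    intro w hwr t ht
    have := norm_sub_sub_smul_le (fun t ht => hz w hwr t (hIco t ht))
      (fun t ht => hζ w hwr t (hIco t ht)) (fun t ht => (hU' w hwr t (hIco t ht)).2.2) ht
    simpa [h0 w hwr] using this
  have hest2 : ∀ w w', ‖w‖ ≤ r → ‖w'‖ ≤ r → ∀ t ∈ Ico 0 ε,
      ‖((α (y₀, w) t).1 - (α (y₀, w') t).1) - t • (w - w')‖ ≤ K * (L * ‖w - w'‖) * t * t := by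
    intro w w' hwr hwr' t ht
    have := norm_sub_sub_smul_le (C := K * (L * ‖w - w'‖))
      (fun t ht => (hz w hwr t (hIco t ht)).sub (hz w' hwr' t (hIco t ht)))
      (fun t ht => (hζ w hwr t (hIco t ht)).sub (hζ w' hwr' t (hIco t ht))) (fun t ht => ?_) ht
    · simpa [h0 w hwr, h0 w' hwr'] using this
    · have h1 := hK.dist_le_mul _ (hU' w hwr t (hIco t ht)).2.1 _ (hU' w' hwr' t (hIco t ht)).2.1
      have h2 := (hL t (hIco t ht)).dist_le_mul _ (hw w hwr) _ (hw w' hwr')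
      rw [← dist_eq_norm]
      refine h1.trans ?_
      gcongr
      simpa [Prod.dist_eq, dist_eq_norm] using h2
  -- up to the time `δ₁` the acceleration changes the rescaled endpoint map `h` below by at most
  -- `r / 8`, and its Lipschitz constant by at most `1 / 2`
  set δ₁ : ℝ := min ε (min (r / (8 * B)) (1 / (2 * (K * L + 1)))) with hδ₁
  have hδ₁pos : 0 < δ₁ := by positivity
  refine ⟨r, hr, ε, hε, r * δ₁ / 2, by positivity, fun y hy hyδ => ?_⟩
  set t := 2 * ‖y - y₀‖ / r with ht
  have hny : 0 < ‖y - y₀‖ := norm_pos_iff.2 (sub_ne_zero.2 hy)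
  have ht0 : 0 < t := by positivity
  have htδ : t < δ₁ := by
    rw [ht, div_lt_iff₀ hr]
    linarith
  have htε : t ∈ Ico 0 ε := ⟨ht0.le, htδ.trans_le (min_le_left _ _)⟩
  have htB : B * t ≤ r / 8 := by
    have h1 : t ≤ r / (8 * B) := htδ.le.trans ((min_le_right _ _).trans (min_le_left _ _))
    calc B * t ≤ B * (r / (8 * B)) := by gcongr
      _ = r / 8 := by field_simp
  have htK : K * L * t ≤ 1 / 2 := by
    have h1 : t ≤ 1 / (2 * (K * L + 1)) :=
      htδ.le.trans ((min_le_right _ _).trans (min_le_right _ _))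
    calc K * L * t ≤ (K * L + 1) * (1 / (2 * (K * L + 1))) := by
          gcongr
          linarith
      _ = 1 / 2 := by field_simp
  -- the velocity of the straight path from `y₀` to `y`
  set w₀ := t⁻¹ • (y - y₀) with hw₀
  have hw₀n : ‖w₀‖ = r / 2 := by
    rw [hw₀, norm_smul, norm_inv, Real.norm_of_nonneg ht0.le, ht]
    field_simp
  set h : E → E := fun w => t⁻¹ • ((α (y₀, w) t).1 - y₀) with hh
  have hball : ∀ w ∈ Metric.closedBall w₀ (r / 4), r / 4 ≤ ‖w‖ ∧ ‖w‖ ≤ r := fun w hw => by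
    rw [mem_closedBall_iff_norm] at hw
    have h1 := norm_sub_norm_le w₀ w
    have h2 := norm_sub_norm_le w w₀
    rw [norm_sub_rev] at h1
    constructor <;> linarith
  -- the map `h` is close to the identity, so its image of the ball around `w₀` contains `w₀` itself
  have happrox : ApproximatesLinearOn h (ContinuousLinearMap.id ℝ E)
      (Metric.closedBall w₀ (r / 4)) (1 / 2) := by
    intro w hw w' hw'
    have := hest2 w w' (hball w hw).2 (hball w' hw').2 t htε
    have e : h w - h w' - (ContinuousLinearMap.id ℝ E) (w - w')
        = t⁻¹ • ((α (y₀, w) t).1 - (α (y₀, w') t).1 - t • (w - w')) := by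
      simp only [hh, smul_sub, ContinuousLinearMap.id_apply, smul_smul, inv_mul_cancel₀ ht0.ne',
        one_smul]
      abel
    rw [e, norm_smul, norm_inv, Real.norm_of_nonneg ht0.le]
    calc _ ≤ t⁻¹ * (K * (L * ‖w - w'‖) * t * t) := by gcongr
      _ = (K * L * t) * ‖w - w'‖ := by field_simp
      _ ≤ _ := by
        push_cast
        gcongr
  have hsurj := happrox.surjOn_closedBall_of_nonlinearRightInverse
    ⟨id, 1, fun y => by simp, fun y => rfl⟩ (by positivity : (0 : ℝ) ≤ r / 4) subset_rfl
  have hmem : w₀ ∈ Metric.closedBall (h w₀)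
      ((((1 : ℝ≥0) : ℝ)⁻¹ - ((1 / 2 : ℝ≥0) : ℝ)) * (r / 4)) := by
    rw [mem_closedBall_iff_norm, norm_sub_rev]
    have h1 := hest1 w₀ (by linarith) t htε
    have e : h w₀ - w₀ = t⁻¹ • ((α (y₀, w₀) t).1 - y₀ - t • w₀) := by
      simp only [hh, smul_sub, smul_smul, inv_mul_cancel₀ ht0.ne', one_smul]
    rw [e, norm_smul, norm_inv, Real.norm_of_nonneg ht0.le]
    calc _ ≤ t⁻¹ * (B * t * t) := by gcongr
      _ = B * t := by field_simp
      _ ≤ r / 8 := htB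
      _ = _ := by push_cast; ring
  obtain ⟨w, hwball, hw'⟩ := hsurj hmem
  obtain ⟨hw1, hw2⟩ := hball w hwball
  refine ⟨fun t => (α (y₀, w) t).1, fun t => (α (y₀, w) t).2, by simp [h0 w hw2],
    by simpa [h0 w hw2] using hw1, by simpa [h0 w hw2] using hw2, ?_, fun t ht =>
    ⟨hz w hw2 t ht, hζ w hw2 t ht, (hU' w hw2 t ht).1⟩⟩
  have := smul_right_injective E (inv_ne_zero ht0.ne') hw'
  simpa using this

end SecondOrderODE

/-! ### Geodesics and lower semicontinuity of semiconcave functions -/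

noncomputable section Geodesics

variable {n : ℕ} {H : Type*} [TopologicalSpace H]
  {I : ModelWithCorners ℝ (EuclideanSpace ℝ (Fin n)) H}
  {M : Type*} [TopologicalSpace M] [ChartedSpace H M] [IsManifold I ∞ M]
  [RiemannianBundle (fun x : M => TangentSpace I x)]
  [IsContMDiffRiemannianBundle I ∞ (EuclideanSpace ℝ (Fin n)) (fun x : M => TangentSpace I x)]

variable (I) in
/-- The path `z`, with velocity `ζ`, solves on `s` the geodesic equation of the chart
around `x₀`. -/
def IsChartGeodesic (x₀ : M) (z ζ : ℝ → EuclideanSpace ℝ (Fin n)) (s : Set ℝ) : Prop :=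
  ∀ t ∈ s, z t ∈ interior (extChartAt I x₀).target ∧ HasDerivAt z (ζ t) t ∧
    HasDerivAt ζ (-chartChristoffel I x₀ (z t) (ζ t) (ζ t)) t

variable {x₀ : M} {z ζ : ℝ → EuclideanSpace ℝ (Fin n)} {s : Set ℝ}

/-- The speed is constant because the connection is compatible with the metric. -/
lemma IsChartGeodesic.hasDerivAt_speed (h : IsChartGeodesic I x₀ z ζ s) {t : ℝ} (ht : t ∈ s) :
    HasDerivAt (fun t => chartMetric I x₀ (z t) (ζ t) (ζ t)) 0 t := by
  obtain ⟨hy, hz, hζ⟩ := h t ht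
  have hg := ((contDiffAt_chartMetric I hy).differentiableAt
    (by simp)).hasFDerivAt.comp_hasDerivAt t hz
  have h1 := (hg.clm_apply hζ).clm_apply hζ
  have h2 := chartMetric_compat I hy (ζ t) (ζ t) (ζ t)
  refine h1.congr_deriv ?_
  simp only [Function.comp_apply, add_apply, map_neg, neg_apply, h2]
  ring

lemma IsChartGeodesic.speed_eq {a b : ℝ} (h : IsChartGeodesic I x₀ z ζ (Ioo a b)) {t t' : ℝ}
    (ht : t ∈ Ioo a b) (ht' : t' ∈ Ioo a b) :
    chartMetric I x₀ (z t) (ζ t) (ζ t) = chartMetric I x₀ (z t') (ζ t') (ζ t') :=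
  isOpen_Ioo.is_const_of_deriv_eq_zero isPreconnected_Ioo
    (fun _ ht => (h.hasDerivAt_speed ht).differentiableAt.differentiableWithinAt)
    (fun _ ht => (h.hasDerivAt_speed ht).deriv) ht ht'

lemma IsChartGeodesic.contDiffOn {a b : ℝ} (h : IsChartGeodesic I x₀ z ζ (Ioo a b)) :
    ContDiffOn ℝ 2 z (Ioo a b) := by
  have hζ : ContDiffOn ℝ 1 ζ (Ioo a b) := by
    have hc : ContinuousOn (deriv ζ) (Ioo a b) := by
      have : ContinuousOn (fun t => -chartChristoffel I x₀ (z t) (ζ t) (ζ t)) (Ioo a b) := by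
        intro t ht
        obtain ⟨hy, hz, hζ⟩ := h t ht
        have hΓ : ContinuousAt (fun t => chartChristoffel I x₀ (z t)) t :=
          ContinuousAt.comp (g := chartChristoffel I x₀)
            (contDiffAt_chartChristoffel I hy).continuousAt hz.continuousAt
        exact ((hΓ.clm_apply hζ.continuousAt).clm_apply
          hζ.continuousAt).neg.continuousWithinAt
      exact this.congr fun t ht => (h t ht).2.2.deriv
    rw [show (1 : WithTop ℕ∞) = 0 + 1 by norm_num, contDiffOn_succ_iff_deriv_of_isOpen isOpen_Ioo]
    exact ⟨fun t ht => (h t ht).2.2.differentiableAt.differentiableWithinAt, by simp,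
      contDiffOn_zero.2 hc⟩
  rw [show (2 : WithTop ℕ∞) = 1 + 1 by norm_num, contDiffOn_succ_iff_deriv_of_isOpen isOpen_Ioo]
  exact ⟨fun t ht => (h t ht).2.1.differentiableAt.differentiableWithinAt, by simp,
    hζ.congr fun t ht => (h t ht).2.1.deriv⟩

/-- A solution of the geodesic equation in a chart, with unit speed, is a geodesic. -/
lemma IsChartGeodesic.isUnitSpeedGeodesic {a b a' b' : ℝ}
    (h : IsChartGeodesic I x₀ z ζ (Ioo a' b')) (hab : a < b) (ha : a' < a) (hb : b < b')
    (hspeed : ∀ t ∈ Icc a b, chartMetric I x₀ (z t) (ζ t) (ζ t) = 1) :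
    IsUnitSpeedGeodesic I (fun t => (extChartAt I x₀).symm (z t)) a b := by
  have hsub : ∀ t ∈ Icc a b, t ∈ Ioo a' b' := fun t ht =>
    ⟨ha.trans_le ht.1, ht.2.trans_lt hb⟩
  have hU := uniqueDiffOn_Icc hab
  refine ⟨hab, fun t ht => symm_mem_interior I (h t (hsub t ht)).1, ?_, fun t ht => ?_,
    fun t ht k => ?_⟩
  · intro t ht
    have h1 : ContMDiffAt 𝓘(ℝ, ℝ) 𝓘(ℝ, EuclideanSpace ℝ (Fin n)) 2 z t :=
      (h.contDiffOn.contDiffAt (isOpen_Ioo.mem_nhds (hsub t ht))).contMDiffAt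
    exact (((contMDiffAt_extChartAt_symm_of_mem_interior (h t (hsub t ht)).1).of_le
      (WithTop.coe_le_coe.2 le_top)).comp t h1).contMDiffWithinAt
  · obtain ⟨hy, hz, -⟩ := h t (hsub t ht)
    have h1 := (hasMFDerivAt_symm hy).comp t hz.hasFDerivAt.hasMFDerivAt
    have h2 := h1.hasMFDerivWithinAt.mfderivWithin (s := Icc a b) (hU t ht).uniqueMDiffWithinAt
    have h3 : mfderivWithin 𝓘(ℝ, ℝ) I (fun t => (extChartAt I x₀).symm (z t)) (Icc a b) t (1 : ℝ)
        = chartSymmDeriv I x₀ (z t) (ζ t) := by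
      refine (DFunLike.congr_fun h2 (1 : ℝ)).trans ?_
      exact congrArg (chartSymmDeriv I x₀ (z t)) (one_smul ℝ (ζ t))
    have h4 : ‖chartSymmDeriv I x₀ (z t) (ζ t)‖ = 1 := by
      have := hspeed t ht
      rw [chartMetric_apply, real_inner_self_eq_norm_sq] at this
      exact (pow_eq_one_iff_of_nonneg (norm_nonneg _) two_ne_zero).1 this
    exact (congrArg (fun v : TangentSpace I ((extChartAt I x₀).symm (z t)) => ‖v‖) h3).trans h4
  · -- at time `t` the equation has to be transferred to the chart around the point `q` at that time
    obtain ⟨hy, hz, hζ⟩ := h t (hsub t ht)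
    set q := (extChartAt I x₀).symm (z t) with hq
    have hs : (extChartAt I x₀).symm (z t) ∈ (extChartAt I q).source := mem_extChartAt_source q
    have hτ := contDiffAt_transition hy hs
    have hev : ∀ᶠ r in 𝓝 t, r ∈ Ioo a' b' ∧ z r ∈ interior (extChartAt I x₀).target ∧
        (extChartAt I x₀).symm (z r) ∈ (extChartAt I q).source := by
      filter_upwards [isOpen_Ioo.mem_nhds (hsub t ht),
        hz.continuousAt.eventually (eventually_mem_source hy hs)] with r h1 h2 using ⟨h1, h2⟩
    have hd1 : ∀ᶠ r in 𝓝 t, ∀ i : Fin n, HasDerivAt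
        (fun r => transition I x₀ q (z r) i) (fderiv ℝ (transition I x₀ q) (z r) (ζ r) i) r := by
      filter_upwards [hev] with r hr i
      have h1 := ((contDiffAt_transition hr.2.1 hr.2.2).differentiableAt
        (by simp)).hasFDerivAt.comp_hasDerivAt r (h r hr.1).2.1
      exact (EuclideanSpace.proj i : EuclideanSpace ℝ (Fin n) →L[ℝ] ℝ).hasFDerivAt.comp_hasDerivAt
        r h1
    have hd2 : HasDerivAt (fun r => fderiv ℝ (transition I x₀ q) (z r) (ζ r))
        (-chartChristoffel I q (transition I x₀ q (z t)) (fderiv ℝ (transition I x₀ q) (z t) (ζ t))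
          (fderiv ℝ (transition I x₀ q) (z t) (ζ t))) t := by
      have h1 := (((hτ.fderiv_right (m := 1) (WithTop.coe_le_coe.2 le_top)).differentiableAt
        (by simp)).hasFDerivAt.comp_hasDerivAt t hz).clm_apply hζ
      refine h1.congr_deriv ?_
      rw [map_neg, Function.comp_apply, chartChristoffel_transition hy hs]
      abel
    have hd3 : ∀ i : Fin n, derivWithin (fun r => transition I x₀ q (z r) i) (Icc a b) t
        = fderiv ℝ (transition I x₀ q) (z t) (ζ t) i := fun i =>
      (hd1.self_of_nhds i).hasDerivWithinAt.derivWithin (hU t ht)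
    have hd4 : derivWithin (derivWithin (fun r => transition I x₀ q (z r) k) (Icc a b)) (Icc a b) t
        = -chartChristoffel I q (transition I x₀ q (z t))
          (fderiv ℝ (transition I x₀ q) (z t) (ζ t))
          (fderiv ℝ (transition I x₀ q) (z t) (ζ t)) k := by
      have h1 : HasDerivWithinAt (fun r => fderiv ℝ (transition I x₀ q) (z r) (ζ r) k) _
          (Icc a b) t := ((EuclideanSpace.proj k :
            EuclideanSpace ℝ (Fin n) →L[ℝ] ℝ).hasFDerivAt.comp_hasDerivAt t hd2).hasDerivWithinAt
      refine (h1.congr_of_eventuallyEq_of_mem ?_ ht).derivWithin (hU t ht)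
      filter_upwards [hd1.filter_mono nhdsWithin_le_nhds, self_mem_nhdsWithin] with r h2 h3
      exact (h2 k).hasDerivWithinAt.derivWithin (hU r h3)
    have hd5 : chartChristoffel I q (transition I x₀ q (z t))
          (fderiv ℝ (transition I x₀ q) (z t) (ζ t))
          (fderiv ℝ (transition I x₀ q) (z t) (ζ t)) k
        = ∑ i, ∑ j, christoffel I q k i j (transition I x₀ q (z t))
          * fderiv ℝ (transition I x₀ q) (z t) (ζ t) i
          * fderiv ℝ (transition I x₀ q) (z t) (ζ t) j := by
      rw [chartChristoffel, matrixMap_apply_coord, matrixForm_apply]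
      simp only [Matrix.of_apply, mul_assoc]
    have e : ∀ i : Fin n, (fun r => extChartAt I q ((extChartAt I x₀).symm (z r)) i)
        = fun r => transition I x₀ q (z r) i := fun i => rfl
    have e' : extChartAt I q q = transition I x₀ q (z t) := rfl
    simp only [e, e', hd3, hd4, hd5]
    ring

/-- Linear reparametrization of a geodesic. -/
lemma IsChartGeodesic.comp_mul {a b c : ℝ} (h : IsChartGeodesic I x₀ z ζ (Ioo a b)) (hc : 0 < c) :
    IsChartGeodesic I x₀ (fun t => z (c * t)) (fun t => c • ζ (c * t)) (Ioo (a / c) (b / c)) := by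
  intro t ht
  have ht' : c * t ∈ Ioo a b := by
    have h1 := ht.1
    have h2 := ht.2
    rw [div_lt_iff₀ hc] at h1
    rw [lt_div_iff₀ hc] at h2
    constructor <;> linarith
  obtain ⟨hy, hz, hζ⟩ := h _ ht'
  have hl : HasDerivAt (fun t : ℝ => c * t) c t := by simpa using (hasDerivAt_id t).const_mul c
  refine ⟨hy, hz.scomp t hl, ((hζ.scomp t hl).const_smul c).congr_deriv ?_⟩
  simp [smul_smul]

/-- Points close to an interior point `p` lie on unit speed geodesics that start at `p` and have a
length bounded below. -/
lemma exists_geodesic_through {p : M} (hp : p ∈ I.interior M) : ∃ T > (0 : ℝ), ∃ A : ℝ,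
    ∀ᶠ x in 𝓝 p, x ≠ p → ∃ (γ : ℝ → M) (s : ℝ), IsUnitSpeedGeodesic I γ 0 T ∧ γ 0 = p ∧
      0 < s ∧ s < T ∧ s ≤ A * ‖extChartAt I p x - extChartAt I p p‖ ∧ γ s = x := by
  have hy := (mem_interior_target_iff I (mem_extChartAt_source p)).2 hp
  set y₀ := extChartAt I p p with hy₀
  have hF : ContDiffAt ℝ 1 (fun q : EuclideanSpace ℝ (Fin n) × EuclideanSpace ℝ (Fin n) =>
      -chartChristoffel I p q.1 q.2 q.2) (y₀, 0) := by
    have h1 : ContDiffAt ℝ 1 (fun q : EuclideanSpace ℝ (Fin n) × EuclideanSpace ℝ (Fin n) =>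
        chartChristoffel I p q.1) (y₀, 0) :=
      ContDiffAt.comp (g := chartChristoffel I p) (y₀, (0 : EuclideanSpace ℝ (Fin n)))
        ((contDiffAt_chartChristoffel I hy).of_le (WithTop.coe_le_coe.2 le_top)) contDiffAt_fst
    exact ((h1.clm_apply contDiffAt_snd).clm_apply contDiffAt_snd).neg
  have hU : {q : EuclideanSpace ℝ (Fin n) × EuclideanSpace ℝ (Fin n) |
      q.1 ∈ interior (extChartAt I p).target} ∈ 𝓝 (y₀, (0 : EuclideanSpace ℝ (Fin n))) :=
    (isOpen_interior.preimage continuous_fst).mem_nhds hy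
  obtain ⟨r, hr, ε, hε, δ, hδ, hsol⟩ := exists_solution_through hF hU
  obtain ⟨κ, hκ, hpos⟩ := exists_pos_mul_sq_le (chartMetric I p y₀)
    (fun X hX => chartMetric_self_pos p hX)
  -- lower and upper bounds of the initial speed, for the metric
  set σ₁ := Real.sqrt (κ * (r / 4) ^ 2) with hσ₁
  set σ₂ := Real.sqrt (‖chartMetric I p y₀‖ * r ^ 2) with hσ₂
  have hσ₁pos : 0 < σ₁ := Real.sqrt_pos.2 (by positivity)
  set A := σ₂ * (2 / r) with hA
  have hA0 : 0 ≤ A := by positivity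
  set T := σ₁ * ε / 2 with hT
  have hT0 : 0 < T := by positivity
  refine ⟨T, hT0, A, ?_⟩
  have hcont : Filter.Tendsto (fun x => ‖extChartAt I p x - y₀‖) (𝓝 p) (𝓝 0) := by
    have := ((continuousAt_extChartAt (I := I) p).sub_const y₀).norm
    rwa [← hy₀, sub_self, norm_zero] at this
  filter_upwards [hcont.eventually (gt_mem_nhds hδ),
    hcont.eventually (gt_mem_nhds (show 0 < T / (A + 1) by positivity)),
    extChartAt_source_mem_nhds (I := I) p] with x hxδ hxT hxs hxp
  have hne : extChartAt I p x ≠ y₀ := fun h =>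
    hxp ((extChartAt I p).injOn hxs (mem_extChartAt_source p) h)
  obtain ⟨z, ζ, hz0, hζ1, hζ2, hzy, hode⟩ := hsol _ hne hxδ
  have hgeo : IsChartGeodesic I p z ζ (Ioo (-ε) ε) := fun t ht =>
    ⟨(hode t ht).2.2, (hode t ht).1, (hode t ht).2.1⟩
  have h0mem : (0 : ℝ) ∈ Ioo (-ε) ε := ⟨by linarith, hε⟩
  set σ := Real.sqrt (chartMetric I p y₀ (ζ 0) (ζ 0)) with hσ
  have hle : chartMetric I p y₀ (ζ 0) (ζ 0) ≤ ‖chartMetric I p y₀‖ * r ^ 2 :=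
    calc _ ≤ ‖chartMetric I p y₀‖ * ‖ζ 0‖ * ‖ζ 0‖ :=
          (le_abs_self _).trans ((chartMetric I p y₀).le_opNorm₂ _ _)
      _ ≤ ‖chartMetric I p y₀‖ * r * r := by gcongr
      _ = _ := by ring
  have hσσ₁ : σ₁ ≤ σ := Real.sqrt_le_sqrt ((by gcongr : κ * (r / 4) ^ 2 ≤ κ * ‖ζ 0‖ ^ 2).trans
    (hpos (ζ 0)))
  have hσσ₂ : σ ≤ σ₂ := Real.sqrt_le_sqrt hle
  have hσ0 : 0 < σ := hσ₁pos.trans_le hσσ₁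
  have hσσ : σ * σ = chartMetric I p y₀ (ζ 0) (ζ 0) :=
    Real.mul_self_sqrt ((by positivity : 0 ≤ κ * ‖ζ 0‖ ^ 2).trans (hpos (ζ 0)))
  have hgeo' := hgeo.comp_mul (inv_pos.2 hσ0)
  simp only [div_inv_eq_mul] at hgeo'
  have hny : 0 < ‖extChartAt I p x - y₀‖ := norm_pos_iff.2 (sub_ne_zero.2 hne)
  have hTσ : T < ε * σ := by
    rw [hT]
    nlinarith
  have hsA : σ * (2 * ‖extChartAt I p x - y₀‖ / r) ≤ A * ‖extChartAt I p x - y₀‖ := by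
    rw [hA]
    calc _ = σ * (2 / r) * ‖extChartAt I p x - y₀‖ := by ring
      _ ≤ _ := by gcongr
  refine ⟨fun t => (extChartAt I p).symm (z (σ⁻¹ * t)), σ * (2 * ‖extChartAt I p x - y₀‖ / r),
    hgeo'.isUnitSpeedGeodesic hT0 (by nlinarith) hTσ fun t ht => ?_, ?_, by positivity, ?_,
    hsA, ?_⟩
  · have ht' : σ⁻¹ * t ∈ Ioo (-ε) ε := by
      have h1 : 0 ≤ σ⁻¹ * t := mul_nonneg (inv_pos.2 hσ0).le ht.1
      refine ⟨by linarith, ?_⟩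
      rw [inv_mul_lt_iff₀ hσ0]
      linarith [ht.2]
    have h1 := hgeo.speed_eq ht' h0mem
    rw [hz0, ← hσσ] at h1
    simp only [map_smul, smul_apply, smul_eq_mul, h1]
    field_simp
  · simp only [mul_zero, hz0, hy₀, extChartAt_to_inv]
  · refine hsA.trans_lt ?_
    rw [lt_div_iff₀ (by positivity)] at hxT
    nlinarith
  · simp only [inv_mul_cancel_left₀ hσ0.ne', hzy]
    exact (extChartAt I p).left_inv hxs

/-- A bounded semiconcave function is lower semicontinuous at the interior points. -/
lemma IsSemiconcave.eventually_lt {C : ℝ} (hC : 0 ≤ C) {d : M → ℝ} (hd : IsSemiconcave I C d)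
    {B : ℝ} (hB : ∀ x ∈ I.interior M, |d x| ≤ B) {p : M} (hp : p ∈ I.interior M) {a : ℝ}
    (ha : a < d p) : ∀ᶠ x in 𝓝 p, a < d x := by
  obtain ⟨T, hT, A, hev⟩ := exists_geodesic_through hp
  set D := |d p| + C * T ^ 2 + B with hD
  have hlim : Filter.Tendsto (fun x => A * ‖extChartAt I p x - extChartAt I p p‖ / T * D)
      (𝓝 p) (𝓝 0) := by
    have := ((((continuousAt_extChartAt (I := I) p).sub_const
      (extChartAt I p p)).norm.const_mul A).div_const T).mul_const D
    simpa [ContinuousAt] using this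
  filter_upwards [hev, hlim.eventually (gt_mem_nhds (sub_pos.2 ha))] with x hx hxa
  rcases eq_or_ne x p with rfl | hxp
  · exact ha
  obtain ⟨γ, s, hγ, hγ0, hs0, hsT, hsA, rfl⟩ := hx hxp
  -- convexity of `C t² - d (γ t)` at the point `s` between `0` and `T`, where `s` is small
  have hconv := (hd γ 0 T hγ).2 (left_mem_Icc.2 hT.le) (right_mem_Icc.2 hT.le)
    (sub_nonneg.2 ((div_le_one hT).2 hsT.le)) (by positivity : 0 ≤ s / T) (by ring)
  have e : (1 - s / T) • (0 : ℝ) + (s / T) • T = s := by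
    simp only [smul_eq_mul]
    field_simp
    ring
  rw [e] at hconv
  simp only [smul_eq_mul, hγ0] at hconv
  have hBT := abs_le.1 (hB (γ T) (hγ.mem_interior T (right_mem_Icc.2 hT.le)))
  have hD0 : 0 ≤ D := by
    have := (abs_nonneg _).trans (hB p hp)
    positivity
  have hq : s / T * (d p + (C * T ^ 2 - d (γ T)))
      ≤ A * ‖extChartAt I p (γ s) - extChartAt I p p‖ / T * D := by
    calc _ ≤ s / T * D := by
          gcongr
          linarith [le_abs_self (d p), hBT.1]
      _ ≤ _ := by gcongr
  have hCs : 0 ≤ C * s ^ 2 := by positivity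
  nlinarith

end Geodesics

/-! ### Convexity along geodesics -/

section Convexity

/-- A continuous function is convex if subtracting an affine function never produces an interior
local maximum. -/
lemma convexOn_of_no_isLocalMax {a b : ℝ} {g : ℝ → ℝ} (hg : ContinuousOn g (Icc a b))
    (h : ∀ t ∈ Ioo a b, ∀ m : ℝ, ¬ IsLocalMax (fun s => g s - m * s) t) :
    ConvexOn ℝ (Icc a b) g := by
  refine LinearOrder.convexOn_of_lt (convex_Icc a b) fun x hx y hy hxy θ ϑ hθ hϑ hsum => ?_
  by_contra! hlt
  -- subtracting the chord on `[x, y]` produces a function with an interior maximum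
  set m := (g y - g x) / (y - x) with hm
  have hyx : 0 < y - x := sub_pos.2 hxy
  set k : ℝ → ℝ := fun s => g s - m * s with hk
  have hmy : m * (y - x) = g y - g x := div_mul_cancel₀ _ hyx.ne'
  have hkxy : k x = k y := by
    simp only [hk]
    linarith
  set z := θ • x + ϑ • y with hz
  have hzk : k x < k z := by
    simp only [smul_eq_mul] at hlt hz
    have e : m * z = m * x + ϑ * (g y - g x) := by
      rw [hz, ← hmy, eq_sub_of_add_eq hsum]
      ring
    simp only [hk, e]
    have hθ' : θ = 1 - ϑ := by linarith
    rw [hθ'] at hlt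
    linarith
  have hzmem : z ∈ Icc x y := by
    simp only [hz, smul_eq_mul]
    have hθ' : θ = 1 - ϑ := by linarith
    rw [hθ']
    constructor <;> nlinarith
  have hkc : ContinuousOn k (Icc x y) :=
    (hg.mono (Icc_subset_Icc hx.1 hy.2)).sub (by fun_prop)
  obtain ⟨t, ht, hmax⟩ := isCompact_Icc.exists_isMaxOn ⟨z, hzmem⟩ hkc
  have hzt : k z ≤ k t := hmax hzmem
  have htx : t ≠ x := by
    rintro rfl
    linarith
  have hty : t ≠ y := by
    rintro rfl
    linarith
  have htio : t ∈ Ioo x y := ⟨lt_of_le_of_ne ht.1 htx.symm, lt_of_le_of_ne ht.2 hty⟩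
  exact h t ⟨hx.1.trans_lt htio.1, htio.2.trans_le hy.2⟩ m
    (hmax.isLocalMax (Icc_mem_nhds htio.1 htio.2))

/-- The second-order jet of a `C²` function along a `C²` path. -/
lemma HasJetTwo.comp_path {E F : Type*} [NormedAddCommGroup E] [NormedSpace ℝ E]
    [NormedAddCommGroup F] [NormedSpace ℝ F] {v : E → F} {y : ℝ → E} {t₀ : ℝ}
    (hv : ContDiffAt ℝ 2 v (y t₀)) (hy : ContDiffAt ℝ 2 y t₀) :
    HasJetTwo (fun t => v (y (t₀ + t))) (v (y t₀)) (fderiv ℝ v (y t₀) (deriv y t₀))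
      (fderiv ℝ (fderiv ℝ v) (y t₀) (deriv y t₀) (deriv y t₀)
        + fderiv ℝ v (y t₀) (deriv (deriv y) t₀)) := by
  have hl : Filter.Tendsto (fun t : ℝ => t₀ + t) (𝓝 0) (𝓝 t₀) := by
    have : ContinuousAt (fun t : ℝ => t₀ + t) 0 := by fun_prop
    simpa [ContinuousAt] using this
  have h1 : ∀ᶠ t in 𝓝 t₀, HasDerivAt y (deriv y t) t := by
    filter_upwards [hy.eventually (by simp)] with t ht using
      (ht.differentiableAt (by simp)).hasDerivAt
  have h2 : ∀ᶠ z in 𝓝 (y t₀), DifferentiableAt ℝ v z := by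
    filter_upwards [hv.eventually (by simp)] with z hz using hz.differentiableAt (by simp)
  have h3 : ∀ᶠ t in 𝓝 t₀, HasDerivAt (fun t => v (y t)) (fderiv ℝ v (y t) (deriv y t)) t := by
    filter_upwards [h1, hy.continuousAt.eventually h2] with t h4 h5
      using h5.hasFDerivAt.comp_hasDerivAt t h4
  have h4 : HasDerivAt (deriv y) (deriv (deriv y) t₀) t₀ := by
    have hfd : ContDiffAt ℝ 1 (fderiv ℝ y) t₀ := hy.fderiv_right (by norm_num)
    have hd : DifferentiableAt ℝ (fun t => fderiv ℝ y t 1) t₀ :=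
      (hfd.differentiableAt (by simp)).clm_apply (differentiableAt_const _)
    exact hd.hasDerivAt
  have h5 : DifferentiableAt ℝ (fderiv ℝ v) (y t₀) :=
    (hv.fderiv_right (m := 1) (by norm_num)).differentiableAt (by simp)
  have h6 := (h5.hasFDerivAt.comp_hasDerivAt t₀ h1.self_of_nhds).clm_apply h4
  refine ⟨fun t => fderiv ℝ v (y (t₀ + t)) (deriv y (t₀ + t)), by simp, by simp, ?_, ?_⟩
  · filter_upwards [hl.eventually h3] with t ht
    exact ht.comp_const_add t₀ t
  · exact HasDerivAt.comp_const_add t₀ 0 (by rw [add_zero]; exact h6)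

lemma hasJetTwo_quadratic (c m t₀ : ℝ) :
    HasJetTwo (fun t : ℝ => c * (t₀ + t) ^ 2 - m * (t₀ + t)) (c * t₀ ^ 2 - m * t₀)
      (c * (2 * t₀) - m) (2 * c) := by
  refine ⟨fun t => c * (2 * (t₀ + t)) - m, by simp, by simp, .of_forall fun t => ?_, ?_⟩
  · have h := (hasDerivAt_id' t).const_add t₀
    exact (((h.fun_pow 2).const_mul c).sub (h.const_mul m)).congr_deriv (by simp)
  · have h := (hasDerivAt_id' (0 : ℝ)).const_add t₀
    exact (((h.const_mul 2).const_mul c).sub_const m).congr_deriv (by ring)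

end Convexity

noncomputable section Semiconcavity

variable {n : ℕ} {H : Type*} [TopologicalSpace H]
  {I : ModelWithCorners ℝ (EuclideanSpace ℝ (Fin n)) H}
  {M : Type*} [TopologicalSpace M] [ChartedSpace H M] [IsManifold I ∞ M]
  [RiemannianBundle (fun x : M => TangentSpace I x)]

lemma norm_sq_eq_chartMetric (p : M) (X : TangentSpace I p) :
    ‖X‖ ^ 2 = chartMetric I p (extChartAt I p p) X X :=
  (real_inner_self_eq_norm_sq X).symm.trans (chartMetric_self p X X).symm

lemma IsUnitSpeedGeodesic.contDiffAt {γ : ℝ → M} {a b t₀ : ℝ} (h : IsUnitSpeedGeodesic I γ a b)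
    (ht : t₀ ∈ Ioo a b) : ContDiffAt ℝ 2 (fun s => extChartAt I (γ t₀) (γ s)) t₀ := by
  have h1 : ContMDiffAt 𝓘(ℝ, ℝ) I 2 γ t₀ := h.contMDiffOn.contMDiffAt (Icc_mem_nhds ht.1 ht.2)
  have h2 : ContMDiffAt I 𝓘(ℝ, EuclideanSpace ℝ (Fin n)) 2 (extChartAt I (γ t₀)) (γ t₀) :=
    (contMDiffAt_extChartAt (n := ∞)).of_le (WithTop.coe_le_coe.2 le_top)
  exact (h2.comp t₀ h1).contDiffAt

/-- The unit speed condition, in the chart around `γ t₀`. -/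
lemma IsUnitSpeedGeodesic.chartMetric_deriv {γ : ℝ → M} {a b t₀ : ℝ}
    (h : IsUnitSpeedGeodesic I γ a b) (ht : t₀ ∈ Ioo a b) :
    chartMetric I (γ t₀) (extChartAt I (γ t₀) (γ t₀))
      (deriv (fun s => extChartAt I (γ t₀) (γ s)) t₀)
      (deriv (fun s => extChartAt I (γ t₀) (γ s)) t₀) = 1 := by
  have hnhds := Icc_mem_nhds ht.1 ht.2
  have h1 : MDifferentiableAt 𝓘(ℝ, ℝ) I γ t₀ :=
    (h.contMDiffOn.contMDiffAt hnhds).mdifferentiableAt (by simp)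
  have h2 : MDifferentiableAt I 𝓘(ℝ, EuclideanSpace ℝ (Fin n)) (extChartAt I (γ t₀)) (γ t₀) :=
    mdifferentiableAt_extChartAt (mem_chart_source H _)
  have h3 := h2.hasMFDerivAt.comp t₀ h1.hasMFDerivAt
  have h4 : deriv (fun s => extChartAt I (γ t₀) (γ s)) t₀
      = mfderiv 𝓘(ℝ, ℝ) I γ t₀ (1 : ℝ) := by
    have h5 := h3.mfderiv
    rw [mfderiv_eq_fderiv, mfderiv_extChartAt_self] at h5
    exact DFunLike.congr_fun h5 (1 : ℝ)
  have h6 := h.unit_speed t₀ (Ioo_subset_Icc_self ht)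
  rw [mfderivWithin_of_mem_nhds hnhds] at h6
  rw [h4]
  refine (norm_sq_eq_chartMetric (γ t₀) (mfderiv 𝓘(ℝ, ℝ) I γ t₀ (1 : ℝ))).symm.trans ?_
  rw [h6, one_pow]

/-- The geodesic equation at an inner time `t₀`, in the chart around `γ t₀`. -/
lemma IsUnitSpeedGeodesic.deriv_deriv {γ : ℝ → M} {a b t₀ : ℝ} (h : IsUnitSpeedGeodesic I γ a b)
    (ht : t₀ ∈ Ioo a b) :
    deriv (deriv (fun s => extChartAt I (γ t₀) (γ s))) t₀
      = -chartChristoffel I (γ t₀) (extChartAt I (γ t₀) (γ t₀))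
        (deriv (fun s => extChartAt I (γ t₀) (γ s)) t₀)
        (deriv (fun s => extChartAt I (γ t₀) (γ s)) t₀) := by
  set y : ℝ → EuclideanSpace ℝ (Fin n) := fun s => extChartAt I (γ t₀) (γ s) with hy
  have hyc : ContDiffAt ℝ 2 y t₀ := h.contDiffAt ht
  have htI : t₀ ∈ Icc a b := Ioo_subset_Icc_self ht
  have hU := uniqueDiffOn_Icc h.lt
  have hproj : ∀ (k : Fin n) {f : ℝ → EuclideanSpace ℝ (Fin n)} {f' : EuclideanSpace ℝ (Fin n)}
      {t : ℝ}, HasDerivAt f f' t → HasDerivAt (fun s => f s k) (f' k) t := fun k f f' t hf =>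
    (EuclideanSpace.proj k : EuclideanSpace ℝ (Fin n) →L[ℝ] ℝ).hasFDerivAt.comp_hasDerivAt t hf
  have h1 : ∀ᶠ t in 𝓝 t₀, HasDerivAt y (deriv y t) t := by
    filter_upwards [hyc.eventually (by simp)] with t ht using
      (ht.differentiableAt (by simp)).hasDerivAt
  have h2 : HasDerivAt (deriv y) (deriv (deriv y) t₀) t₀ := by
    have hfd : ContDiffAt ℝ 1 (fderiv ℝ y) t₀ := hyc.fderiv_right (by norm_num)
    have hd : DifferentiableAt ℝ (fun t => fderiv ℝ y t 1) t₀ :=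
      (hfd.differentiableAt (by simp)).clm_apply (differentiableAt_const _)
    exact hd.hasDerivAt
  have h3 : ∀ k : Fin n, derivWithin (fun s => y s k) (Icc a b) t₀ = deriv y t₀ k := fun k =>
    (hproj k h1.self_of_nhds).hasDerivWithinAt.derivWithin (hU t₀ htI)
  ext k
  have h4 : derivWithin (derivWithin (fun s => y s k) (Icc a b)) (Icc a b) t₀
      = deriv (deriv y) t₀ k := by
    refine ((hproj k h2).hasDerivWithinAt.congr_of_eventuallyEq_of_mem ?_ htI).derivWithin
      (hU t₀ htI)
    filter_upwards [h1.filter_mono nhdsWithin_le_nhds, self_mem_nhdsWithin] with r h5 h6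
    exact (hproj k h5).hasDerivWithinAt.derivWithin (hU r h6)
  have h5 := h.geodesic_eq t₀ htI k
  have e : ∀ i : Fin n, (fun s => extChartAt I (γ t₀) (γ s) i) = fun s => y s i := fun _ => rfl
  simp only [e, h3, h4] at h5
  rw [PiLp.neg_apply, chartChristoffel, matrixMap_apply_coord, matrixForm_apply]
  simp only [Matrix.of_apply]
  simp only [mul_assoc] at h5
  linarith

variable [IsContMDiffRiemannianBundle I ∞ (EuclideanSpace ℝ (Fin n))
  (fun x : M => TangentSpace I x)]

/-- A function `u ≤ d` below a `C`-semiconcave function is `c`-semiconcave, `C < c`, if its Hessian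
is less than `c` where `u < d`. -/
lemma isSemiconcave_of_hessian_lt {u d : M → ℝ} {C c : ℝ} (hC : 0 ≤ C) (hc : C < c)
    (hd : IsSemiconcave I C d) (hle : ∀ x ∈ I.interior M, u x ≤ d x)
    (hu : ContinuousOn u (I.interior M))
    (hsm : ∀ p ∈ nonContactSet I u d, ContMDiffAt I 𝓘(ℝ, ℝ) ∞ u p)
    (hhess : ∀ p ∈ nonContactSet I u d, ∀ X, X ≠ 0 →
      chartHess I p u (extChartAt I p p) X X < c * chartMetric I p (extChartAt I p p) X X) :
    IsSemiconcave I c u := by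
  intro γ a b hγ
  have huc : ContinuousOn (fun t => u (γ t)) (Icc a b) :=
    hu.comp hγ.contMDiffOn.continuousOn hγ.mem_interior
  refine convexOn_of_no_isLocalMax ((by fun_prop : ContinuousOn (fun t : ℝ => c * t ^ 2)
    (Icc a b)).sub huc) fun t₀ ht m hmax => ?_
  have htI := Ioo_subset_Icc_self ht
  have hp := hγ.mem_interior t₀ htI
  rcases (hle _ hp).lt_or_eq with hlt | heq
  · -- the second derivative of `u` along the geodesic is the Hessian, so that of
    -- `c t² - u (γ t)` exceeds `c > 0` at `t₀`
    have hE : γ t₀ ∈ nonContactSet I u d := ⟨hp, hlt⟩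
    set y : ℝ → EuclideanSpace ℝ (Fin n) := fun s => extChartAt I (γ t₀) (γ s) with hy
    have hyc : ContDiffAt ℝ 2 y t₀ := hγ.contDiffAt ht
    have hyi := (mem_interior_target_iff I (mem_extChartAt_source (γ t₀))).2 hp
    have hv : ContDiffAt ℝ 2 (u ∘ (extChartAt I (γ t₀)).symm) (y t₀) :=
      (contDiffAt_comp_symm hyi (by rw [extChartAt_to_inv]; exact hsm _ hE)).of_le
        (WithTop.coe_le_coe.2 le_top)
    have hspeed : chartMetric I (γ t₀) (y t₀) (deriv y t₀) (deriv y t₀) = 1 :=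
      hγ.chartMetric_deriv ht
    have hne : deriv y t₀ ≠ 0 := fun h => by
      rw [h] at hspeed
      simp at hspeed
    have hH := hhess _ hE (deriv y t₀) hne
    have hacc : deriv (deriv y) t₀
        = -chartChristoffel I (γ t₀) (y t₀) (deriv y t₀) (deriv y t₀) := hγ.deriv_deriv ht
    have hjet := (hasJetTwo_quadratic c m t₀).sub (HasJetTwo.comp_path hv hyc)
    have hmax' : IsLocalMax (fun t => (c * (t₀ + t) ^ 2 - m * (t₀ + t))
        - (u ∘ (extChartAt I (γ t₀)).symm) (y (t₀ + t))) 0 := by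
      have hl : Filter.Tendsto (fun t : ℝ => t₀ + t) (𝓝 0) (𝓝 t₀) := by
        have : ContinuousAt (fun t : ℝ => t₀ + t) 0 := by fun_prop
        simpa [ContinuousAt] using this
      have hsrc : ∀ᶠ t in 𝓝 t₀, γ t ∈ (extChartAt I (γ t₀)).source :=
        (hγ.contMDiffOn.continuousOn.continuousAt (Icc_mem_nhds ht.1 ht.2)).eventually
          (extChartAt_source_mem_nhds (γ t₀))
      filter_upwards [hl.eventually hmax, hl.eventually hsrc] with t h1 h2
      simp only [Function.comp, hy, add_zero, (extChartAt I (γ t₀)).left_inv h2,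
        extChartAt_to_inv]
      linarith
    have h2 := (hjet.of_isLocalMax hmax').2
    rw [hspeed, mul_one] at hH
    simp only [chartHess, hessForm, sub_apply, compForm_apply] at hH
    rw [hacc, map_neg] at h2
    have hH' : fderiv ℝ (fderiv ℝ (u ∘ (extChartAt I (γ t₀)).symm)) (y t₀) (deriv y t₀)
          (deriv y t₀)
        - fderiv ℝ (u ∘ (extChartAt I (γ t₀)).symm) (y t₀)
          (chartChristoffel I (γ t₀) (y t₀) (deriv y t₀) (deriv y t₀)) < c := hH
    linarith
  · -- at a contact point the semiconcavity of `d` passes to `u`, with a gain of `c - C`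
    have hk := hd γ a b hγ
    have hl : ∀ σ : ℝ, Filter.Tendsto (fun h : ℝ => t₀ + σ * h) (𝓝[>] 0) (𝓝 t₀) := fun σ => by
      have : ContinuousAt (fun h : ℝ => t₀ + σ * h) 0 := by fun_prop
      have h0 : Filter.Tendsto (fun h : ℝ => t₀ + σ * h) (𝓝 0) (𝓝 t₀) := by
        simpa [ContinuousAt] using this
      exact h0.mono_left nhdsWithin_le_nhds
    have hI := Icc_mem_nhds ht.1 ht.2
    obtain ⟨h, ⟨⟨h1, h2⟩, h3, h4⟩, hpos⟩ := ((((hl 1).eventually hmax).and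
      ((hl (-1)).eventually hmax)).and (((hl 1).eventually hI).and
      ((hl (-1)).eventually hI)) |>.and self_mem_nhdsWithin).exists
    have hpos' : 0 < h := hpos
    have hmid := hk.2 h3 h4 (by norm_num : (0 : ℝ) ≤ 1 / 2) (by norm_num : (0 : ℝ) ≤ 1 / 2)
      (by norm_num)
    have e : (1 / 2 : ℝ) • (t₀ + 1 * h) + (1 / 2 : ℝ) • (t₀ + -1 * h) = t₀ := by
      simp only [smul_eq_mul]
      ring
    rw [e] at hmid
    simp only [smul_eq_mul] at hmid
    have h5 := hle _ (hγ.mem_interior _ h3)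
    have h6 := hle _ (hγ.mem_interior _ h4)
    have h7 : 0 < (c - C) * h ^ 2 := mul_pos (sub_pos.2 hc) (by positivity)
    nlinarith

end Semiconcavity

/-! ### Semiconcavity for a large right-hand side -/

noncomputable section Main

variable {n : ℕ} {H : Type*} [TopologicalSpace H]
  {I : ModelWithCorners ℝ (EuclideanSpace ℝ (Fin n)) H}
  {M : Type*} [PseudoEMetricSpace M] [CompactSpace M] [ChartedSpace H M] [IsManifold I ∞ M]
  [RiemannianBundle (fun x : M => TangentSpace I x)]
  [IsContMDiffRiemannianBundle I ∞ (EuclideanSpace ℝ (Fin n)) (fun x : M => TangentSpace I x)]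
  [IsRiemannianManifold I M]

variable (I) in
/-- The non-contact set is open because `u` is continuous and `d` is lower semicontinuous. -/
lemma isOpen_nonContactSet {C B : ℝ} (hC : 0 ≤ C) {u d : M → ℝ} (hd : IsSemiconcave I C d)
    (hB : ∀ x ∈ I.interior M, |d x| ≤ B) (hu : ContinuousOn u (I.interior M)) :
    IsOpen (nonContactSet I u d) := by
  have hopen : IsOpen (I.interior M) := I.isOpen_interior (n := ∞) (by simp)
  refine isOpen_iff_mem_nhds.2 fun p hp => ?_
  obtain ⟨a, h1, h2⟩ := exists_between hp.2
  filter_upwards [hopen.mem_nhds hp.1, (hu.continuousAt (hopen.mem_nhds hp.1)).eventually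
    (gt_mem_nhds h1), hd.eventually_lt hC hB hp.1 h2] with x hx hx1 hx2
  exact ⟨hx, hx1.trans hx2⟩

variable (I) in
/-- Solutions below the obstacle `d` of an equation with a large right-hand side are semiconcave.
The threshold depends on `u` only through its Lipschitz constant. -/
theorem exists_isSemiconcave (L : ℝ≥0) {C B η : ℝ} (hC : 0 ≤ C) (hη : 0 < η) {d : M → ℝ}
    (hd : IsSemiconcave I C d) (hB : ∀ x ∈ I.interior M, |d x| ≤ B) :
    ∃ m₀ : ℝ, 0 < m₀ ∧ ∀ m ≥ m₀, ∀ u : M → ℝ, (∀ x ∈ I.interior M, u x ≤ d x) →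
      LipschitzOnWith L u (I.interior M) →
      ContMDiffOn I 𝓘(ℝ, ℝ) ∞ u (nonContactSet I u d) →
      (∀ x ∈ nonContactSet I u d, -laplacian I u x = 2 * m) →
      (∃ N ∈ 𝓝ˢ (frontier (nonContactSet I u d)), ∀ x ∈ nonContactSet I u d ∩ N,
        HessianLE I u (C + η / 2) x) →
      IsSemiconcave I (C + η) u := by
  obtain ⟨G, hG⟩ := exists_chartGradSq_le I M L
  -- `ε` is so small that `ε |∇u|² ≤ η / 4`, half of the gap between the constants `C + η / 2` and
  -- `C + η`
  set ε : ℝ := min 1 (η / (4 * (|G| + 1))) with hεdef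
  have hε : 0 < ε := lt_min one_pos (by positivity)
  have hεG : ε * G ≤ η / 4 :=
    calc ε * G ≤ η / (4 * (|G| + 1)) * (|G| + 1) :=
          mul_le_mul_of_nonneg (min_le_right _ _) (by linarith [le_abs_self G]) hε.le
            (by positivity)
      _ = η / 4 := by field_simp
  obtain ⟨m₁, hm₁⟩ := exists_subset_belowSet I M L hε (min_le_left _ _)
  refine ⟨|m₁| + 1, by positivity, fun m hm u hle hlip hsm hlap ⟨N, hN, hhess⟩ => ?_⟩
  have hm0 : 0 < m := lt_of_lt_of_le (by positivity) hm
  set E := nonContactSet I u d with hE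
  have hEo : IsOpen E := isOpen_nonContactSet I hC hd hB hlip.continuousOn
  have hEi : E ⊆ I.interior M := fun x hx => hx.1
  have hEsm : ∀ p ∈ E, ContMDiffAt I 𝓘(ℝ, ℝ) ∞ u p := fun p hp =>
    hsm.contMDiffAt (hEo.mem_nhds hp)
  have hsub : E ⊆ belowSet I ε u (C + η) := by
    -- outside the compact set `closure E \ interior N`, contained in `E`, the bound is an
    -- assumption
    refine hm₁ u hlip (-(2 * m)) ?_ E hEi hEo hsm (fun q hq => by linarith [hlap q hq]) _
      (closure E \ interior N) ?_ (isClosed_closure.sdiff isOpen_interior).isCompact ?_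
    · rw [abs_neg, abs_of_pos (by positivity)]
      linarith [le_abs_self m₁]
    · intro x hx
      by_contra hxE
      exact hx.2 (subset_interior_iff_mem_nhdsSet.2 hN
        ⟨hx.1, fun h => hxE (interior_subset h)⟩)
    · intro p hp X hX
      have hpN : p ∈ interior N := by
        by_contra h
        exact hp.2 ⟨subset_closure hp.1, h⟩
      have h1 : hessian I u p X X ≤ (C + η / 2) * ‖(show TangentSpace I p from X)‖ ^ 2 :=
        hhess p ⟨hp.1, interior_subset hpN⟩ X
      rw [norm_sq_eq_chartMetric, hessian_eq (hEi hp.1) (hEsm p hp.1)] at h1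
      have h2 := chartMetric_self_pos (I := I) p hX
      have h3 : ε * chartGradSq I p u (extChartAt I p p) ≤ η / 4 :=
        (mul_le_mul_of_nonneg_left (hG p (hEi hp.1) u hlip (hEsm p hp.1)) hε.le).trans hεG
      rw [defectForm_apply]
      have h4 : (C + η / 2) * chartMetric I p (extChartAt I p p) X X
          < (C + η - ε * chartGradSq I p u (extChartAt I p p))
            * chartMetric I p (extChartAt I p p) X X :=
        mul_lt_mul_of_pos_right (by linarith) h2
      exact sub_pos.2 (h1.trans_lt h4)
  refine isSemiconcave_of_hessian_lt hC (by linarith) hd hle hlip.continuousOn hEsm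
    fun p hp X hX => ?_
  have h1 := hsub hp X hX
  rw [defectForm_apply] at h1
  have h2 := chartMetric_self_pos (I := I) p hX
  have h3 : 0 ≤ ε * chartGradSq I p u (extChartAt I p p) :=
    mul_nonneg hε.le (chartGradSq_nonneg (mem_extChartAt_target p))
  nlinarith [mul_nonneg h3 h2.le]

end Main

end RiemannianChart

theorem proposition5p1 {n : ℕ} [NeZero n] {M : Type*} [EMetricSpace M] [CompactSpace M]
    [ChartedSpace (EuclideanHalfSpace n) M] [IsManifold (𝓡∂ n) ∞ M]
    [RiemannianBundle (fun x : M => TangentSpace (𝓡∂ n) x)]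
    [IsContMDiffRiemannianBundle (𝓡∂ n) ∞ (EuclideanSpace ℝ (Fin n))
      (fun x : M => TangentSpace (𝓡∂ n) x)]
    [IsRiemannianManifold (𝓡∂ n) M]
    (L : ℝ≥0) (hL : 0 < L) (C : ℝ) (hC : 0 < C)
    (d : M → ℝ)
    (hd_bdd : ∃ B : ℝ, ∀ x ∈ (𝓡∂ n).interior M, |d x| ≤ B)
    (hd_semi : RiemannianChart.IsSemiconcave (𝓡∂ n) C d)
    (u : ℝ → M → ℝ)
    (hu_le : ∀ m : ℝ, 0 < m → ∀ x ∈ (𝓡∂ n).interior M, u m x ≤ d x)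
    (hu_lip : ∀ m : ℝ, 0 < m → LipschitzOnWith L (u m) ((𝓡∂ n).interior M))
    (hu_smooth : ∀ m : ℝ, 0 < m →
      ContMDiffOn (𝓡∂ n) 𝓘(ℝ, ℝ) ∞ (u m) (RiemannianChart.nonContactSet (𝓡∂ n) (u m) d))
    (hu_eq : ∀ m : ℝ, 0 < m → ∀ x ∈ RiemannianChart.nonContactSet (𝓡∂ n) (u m) d,
      -RiemannianChart.laplacian (𝓡∂ n) (u m) x = 2 * m)
    (hu_precompact : ∀ m : ℝ, 0 < m → ∃ K : Set M, IsCompact K ∧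
      K ⊆ (𝓡∂ n).interior M ∧ RiemannianChart.nonContactSet (𝓡∂ n) (u m) d ⊆ K)
    (hu_bdry : ∀ η : ℝ, 0 < η → ∀ m : ℝ, 0 < m →
      ∃ N ∈ 𝓝ˢ (frontier (RiemannianChart.nonContactSet (𝓡∂ n) (u m) d)),
        ∀ x ∈ RiemannianChart.nonContactSet (𝓡∂ n) (u m) d ∩ N,
          RiemannianChart.HessianLE (𝓡∂ n) (u m) (C + η) x) :
    ∀ η : ℝ, 0 < η → ∃ m₀ : ℝ, 0 < m₀ ∧ ∀ m : ℝ, m₀ ≤ m →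
      RiemannianChart.IsSemiconcave (𝓡∂ n) (C + η) (u m) := by
  intro η hη
  obtain ⟨B, hB⟩ := hd_bdd
  obtain ⟨m₀, hm₀, h⟩ := RiemannianChart.exists_isSemiconcave (𝓡∂ n) L hC.le hη hd_semi hB
  refine ⟨m₀, hm₀, fun m hm => ?_⟩
  have hm0 : 0 < m := hm₀.trans_le hm
  exact h m hm (u m) (hu_le m hm0) (hu_lip m hm0) (hu_smooth m hm0) (hu_eq m hm0)
    (hu_bdry (η / 2) (half_pos hη) m hm0)
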